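/- Let $M$ be a smooth compact $4$-dimensional manifold, possibly with boundary, with a symplectic form $\omega$ (a smooth, closed, nondegenerate $2$-form) and a Riemannian metric. Let $H:M\to\mathbb R$ be a $C^2$ Hamiltonian, i.e. a $C^2$ function that is constant on each connected component of $\partial M$. Let $X_H$ be its Hamiltonian vector field, $d_pH(u)=\omega(X_H(p),u)$ for all $u\in T_pM$, let $X_H^t$ be the flow of $X_H$, and let $e\in H(M)$. An energy surface $\mathcal E_{H,e}$ is a connected component of $H^{-1}(\{e\})$; it is regular if it contains no critical point of $H$. At a regular point $x$ let $N_x=(\mathbb R X_H(x))^{\perp}$, let $\Pi_x:T_xM\to N_x$ be the orthogonal projection, and let $\mathcal N_x=N_x\cap\ker d_xH$, a plane. The transversal linear Poincaré flow is $\Phi_H^t(x)=\Pi_{X_H^t(x)}\circ DX_H^t(x)|_{\mathcal N_x}:\mathcal N_x\to\mathcal N_{X_H^t(x)}$. It admits a dominated splitting over a regular energy surface $\mathcal E_{H,e}$ if there are a continuous $\Phi_H^t$-invariant splitting $\mathcal N_x=\mathcal N_x^-\oplus\mathcal N_x^+$, $x\in\mathcal E_{H,e}$, into one-dimensional subbundles,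 an integer $m\ge 1$ and $\theta\in(0,1)$ such that $$\frac{\|\Phi_H^m(x)|_{\mathcal N_x^-}\|}{\|\Phi_H^m(x)|_{\mathcal N_x^+}\|}\le\theta\qquad\text{for all }x\in\mathcal E_{H,e}.$$ The pair $(H,e)$ is an Anosov Hamiltonian level if some energy surface $\mathcal E$ of $H$ at energy $e$ is hyperbolic for $X_H^t$: $\mathcal E$ is compact, $X_H^t$-invariant and regular, and there are a $DX_H^t$-invariant splitting $T_x\mathcal E=E_x^-\oplus\mathbb R X_H(x)\oplus E_x^+$ ($x\in\mathcal E$, $T_x\mathcal E=\ker d_xH$), an integer $m\ge1$ and $\theta\in(0,1)$ with $\|DX_H^m(x)|_{E_x^-}\|\le\theta$ and $\|DX_H^{-m}(x)|_{E_x^+}\|\le\theta$ for all $x\in\mathcal E$. Statement: if $\Phi_H^t$ admits a dominated splitting over a regular energy surface $\mathcal E_{H,e}$, then $(H,e)$ is an Anosov Hamiltonian level. -/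

import Mathlib

open Set Manifold Bundle Topology
open scoped ContDiff RealInnerProductSpace

noncomputable section HamiltonianDefs

/-! ### Symplectic forms on manifolds (possibly with boundary) -/

section Symplectic

variable {E : Type*} [NormedAddCommGroup E] [NormedSpace ℝ E]
  {HM : Type*} [TopologicalSpace HM] (I : ModelWithCorners ℝ E HM)
  {M : Type*} [TopologicalSpace M] [ChartedSpace HM M]

/-- The coordinate expression, in the preferred chart at `x`, of a field `σ` of alternating
2-forms on the tangent spaces: the pull-back of `σ` under the inverse of the extended chart. -/
def chartForm (σ : ∀ p : M, (TangentSpace I p) [⋀^Fin 2]→L[ℝ] ℝ) (x : M) (y : E) :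
    E [⋀^Fin 2]→L[ℝ] ℝ :=
  (σ ((extChartAt I x).symm y)).compContinuousLinearMap
    (mfderivWithin 𝓘(ℝ, E) I (extChartAt I x).symm (range I) y)

variable (M)

/-- A symplectic form: a smooth, closed, nondegenerate differential 2-form. Smoothness and
closedness are expressed in the charts of the manifold. -/
structure SymplecticForm where
  /-- the 2-form -/
  form : ∀ p : M, (TangentSpace I p) [⋀^Fin 2]→L[ℝ] ℝ
  smooth : ∀ x : M, ContDiffOn ℝ ∞ (chartForm I form x) (extChartAt I x).target
  closed : ∀ x : M, ∀ y ∈ (extChartAt I x).target,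
    extDerivWithin (chartForm I form x) (range I) y = 0
  nondegenerate : ∀ (p : M) (u : TangentSpace I p), (∀ v, form p ![u, v] = 0) → u = 0

end Symplectic

section Hamiltonian

variable {E : Type*} [NormedAddCommGroup E] [NormedSpace ℝ E]
  {HM : Type*} [TopologicalSpace HM] {I : ModelWithCorners ℝ E HM}
  {M : Type*} [TopologicalSpace M] [ChartedSpace HM M]

variable (I) in
/-- `C²` Hamiltonians: `C²` functions that are constant on each connected component of the
boundary of the manifold. -/
structure IsHamiltonian (H : M → ℝ) : Prop where
  contMDiff : ContMDiff I 𝓘(ℝ, ℝ) 2 H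
  const_boundary : ∀ x ∈ I.boundary M, ∀ y ∈ connectedComponentIn (I.boundary M) x, H y = H x

variable (I) in
/-- The differential `d_pH`, as a linear form on the tangent space. -/
def dH (H : M → ℝ) (p : M) : TangentSpace I p →L[ℝ] ℝ := mfderiv I 𝓘(ℝ, ℝ) H p

/-- Nondegeneracy in finite dimension: every linear form is represented by exactly one vector. -/
theorem SymplecticForm.existsUnique_dual [FiniteDimensional ℝ E] (σ : SymplecticForm I M) (p : M)
    (f : TangentSpace I p →L[ℝ] ℝ) :
    ∃! X : TangentSpace I p, ∀ u, f u = σ.form p ![X, u] := by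
  have : FiniteDimensional ℝ (TangentSpace I p) := inferInstanceAs (FiniteDimensional ℝ E)
  have hupd : ∀ c z : TangentSpace I p, Function.update ![c, 0] 1 z = ![c, z] := by
    intro c z
    funext i
    fin_cases i <;> rfl
  let B : TangentSpace I p →ₗ[ℝ] (TangentSpace I p →ₗ[ℝ] ℝ) :=
    LinearMap.mk₂ ℝ (fun u v => σ.form p ![u, v])
      (fun a b c => by
        simpa using (σ.form p).toMultilinearMap.cons_add ![c] a b)
      (fun r a c => by
        simpa using (σ.form p).toMultilinearMap.cons_smul ![c] r a)
      (fun c a b => by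
        have h := (σ.form p).toMultilinearMap.map_update_add ![c, 0] 1 a b
        simp only [hupd] at h
        exact h)
      (fun r c a => by
        have h := (σ.form p).toMultilinearMap.map_update_smul ![c, 0] 1 r a
        simp only [hupd] at h
        exact h)
  have hinj : Function.Injective B := by
    rw [← LinearMap.ker_eq_bot, LinearMap.ker_eq_bot']
    intro u hu
    exact σ.nondegenerate p u fun v => LinearMap.congr_fun hu v
  have hsurj : Function.Surjective B := by
    refine (LinearMap.injective_iff_surjective_of_finrank_eq_finrank ?_).1 hinj
    exact (Subspace.dual_finrank_eq (K := ℝ) (V := TangentSpace I p)).symm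
  obtain ⟨X, hX⟩ := hsurj (f : TangentSpace I p →ₗ[ℝ] ℝ)
  refine ⟨X, fun u => (LinearMap.congr_fun hX u).symm, fun Y hY => hinj ?_⟩
  rw [hX]
  exact LinearMap.ext fun u => (hY u).symm

/-- The Hamiltonian vector field `X_H`, determined by `d_pH(u) = σ(X_H(p), u)` for all `u`. -/
def hamVF [FiniteDimensional ℝ E] (σ : SymplecticForm I M) (H : M → ℝ) (p : M) :
    TangentSpace I p :=
  (σ.existsUnique_dual p (dH I H p)).choose

open Classical in
/-- The flow of a vector field `X`: `vectorFlow X t x` is the value at time `t` of the integral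
curve of `X` that starts at `x`, defined for all times (and it is `x` if there is none). -/
def vectorFlow (X : ∀ p : M, TangentSpace I p) (t : ℝ) (x : M) : M :=
  if h : ∃ γ : ℝ → M, γ 0 = x ∧ IsMIntegralCurve γ X then h.choose t else x

/-- The Hamiltonian flow `X_H^t`. -/
def hamFlow [FiniteDimensional ℝ E] (σ : SymplecticForm I M) (H : M → ℝ) (t : ℝ) (x : M) : M :=
  vectorFlow (hamVF σ H) t x

/-- The tangent flow `D_xX_H^t`. -/
def tangentFlow [FiniteDimensional ℝ E] (σ : SymplecticForm I M) (H : M → ℝ) (t : ℝ) (x : M) :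
    TangentSpace I x →L[ℝ] TangentSpace I (hamFlow σ H t x) :=
  mfderiv I I (hamFlow σ H t) x

/-- An energy surface: a connected component of the level set `H⁻¹{e}`. -/
def IsEnergySurface (H : M → ℝ) (e : ℝ) (S : Set M) : Prop :=
  ∃ x ∈ H ⁻¹' {e}, S = connectedComponentIn (H ⁻¹' {e}) x

variable (I) in
/-- A set is regular if it contains no critical point of `H`. -/
def IsRegularSet (H : M → ℝ) (S : Set M) : Prop := ∀ x ∈ S, dH I H x ≠ 0

variable (I) in
/-- The tangent space `ker d_xH` at `x` of the level set through a regular point `x`. -/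
def levelTangent (H : M → ℝ) (x : M) : Submodule ℝ (TangentSpace I x) :=
  LinearMap.ker (dH I H x : TangentSpace I x →ₗ[ℝ] ℝ)

/-- `F` is a continuous subbundle of the tangent bundle over `Λ`: near every point of `Λ` it is
spanned by a continuous frame. -/
def IsContinuousSubbundle [IsManifold I 1 M] (F : ∀ x : M, Submodule ℝ (TangentSpace I x)) (Λ : Set M) : Prop :=
  ∀ x₀ ∈ Λ, ∃ U ∈ 𝓝 x₀, ∃ (k : ℕ) (s : Fin k → ∀ x : M, TangentSpace I x),
    (∀ i, ContinuousOn (fun x => (⟨x, s i x⟩ : TangentBundle I M)) (Λ ∩ U)) ∧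
    ∀ x ∈ Λ ∩ U, LinearIndependent ℝ (fun i => s i x) ∧
      Submodule.span ℝ (range fun i => s i x) = F x

section Riemannian

variable [RiemannianBundle (fun x : M => TangentSpace I x)]

/-- The operator norm `‖L|_V‖` (for the Riemannian norms) of the restriction to a subspace `V` of
a linear map between two tangent spaces. -/
def restrNorm {x y : M} (L : TangentSpace I x →L[ℝ] TangentSpace I y)
    (V : Submodule ℝ (TangentSpace I x)) : ℝ :=
  ‖L.comp V.subtypeL‖

variable [FiniteDimensional ℝ E]

/-- The normal fibre `N_x`: the orthogonal complement of `X_H(x)`. -/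
def normalFibre (σ : SymplecticForm I M) (H : M → ℝ) (x : M) : Submodule ℝ (TangentSpace I x) :=
  (Submodule.span ℝ {hamVF σ H x})ᗮ

/-- The fibre `𝒩_x = N_x ∩ ker d_xH` of the transversal bundle. -/
def transFibre (σ : SymplecticForm I M) (H : M → ℝ) (x : M) : Submodule ℝ (TangentSpace I x) :=
  normalFibre σ H x ⊓ levelTangent I H x

/-- The orthogonal projection `Π_x` of `T_xM` onto `N_x`. -/
def normalProj (σ : SymplecticForm I M) (H : M → ℝ) (x : M) :
    TangentSpace I x →L[ℝ] TangentSpace I x :=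
  ((Submodule.span ℝ {hamVF σ H x})ᗮ).starProjection

/-- The map `Π_{X_H^t(x)} ∘ D_xX_H^t`. Its restriction to `N_x` is the linear Poincaré flow and its
restriction to `𝒩_x` is the transversal linear Poincaré flow `Φ_H^t(x)`; it is only ever
evaluated on subspaces of `𝒩_x`. -/
def poincareFlow (σ : SymplecticForm I M) (H : M → ℝ) (t : ℝ) (x : M) :
    TangentSpace I x →L[ℝ] TangentSpace I (hamFlow σ H t x) :=
  (normalProj σ H (hamFlow σ H t x)).comp (tangentFlow σ H t x)

/-- `𝒩_Λ = 𝒩⁻ ⊕ 𝒩⁺` is an `m`-dominated splitting over `Λ` for the transversal linear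
Poincaré flow; the bundles `𝒩⁻` and `𝒩⁺` are one-dimensional. -/
structure IsDominatedSplitting [IsManifold I 1 M] (σ : SymplecticForm I M) (H : M → ℝ) (Λ : Set M) (m : ℕ)
    (Nm Np : ∀ x : M, Submodule ℝ (TangentSpace I x)) : Prop where
  pos : 0 < m
  sup_eq : ∀ x ∈ Λ, Nm x ⊔ Np x = transFibre σ H x
  disjoint : ∀ x ∈ Λ, Disjoint (Nm x) (Np x)
  finrank_minus : ∀ x ∈ Λ, Module.finrank ℝ (Nm x) = 1
  finrank_plus : ∀ x ∈ Λ, Module.finrank ℝ (Np x) = 1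
  continuous_minus : IsContinuousSubbundle Nm Λ
  continuous_plus : IsContinuousSubbundle Np Λ
  invariant_minus : ∀ x ∈ Λ, ∀ t : ℝ,
    (Nm x).map (poincareFlow σ H t x : TangentSpace I x →ₗ[ℝ] TangentSpace I (hamFlow σ H t x)) =
      Nm (hamFlow σ H t x)
  invariant_plus : ∀ x ∈ Λ, ∀ t : ℝ,
    (Np x).map (poincareFlow σ H t x : TangentSpace I x →ₗ[ℝ] TangentSpace I (hamFlow σ H t x)) =
      Np (hamFlow σ H t x)
  dominated : ∃ θ : ℝ, 0 < θ ∧ θ < 1 ∧ ∀ x ∈ Λ,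
    restrNorm (poincareFlow σ H m x) (Nm x) / restrNorm (poincareFlow σ H m x) (Np x) ≤ θ

/-- The transversal linear Poincaré flow admits a dominated splitting over `Λ`. -/
def HasDominatedSplitting [IsManifold I 1 M] (σ : SymplecticForm I M) (H : M → ℝ) (Λ : Set M) : Prop :=
  ∃ (m : ℕ) (Nm Np : ∀ x : M, Submodule ℝ (TangentSpace I x)),
    IsDominatedSplitting σ H Λ m Nm Np

/-- `Λ`, a subset of a regular level set of `H`, is a (uniformly) hyperbolic set for the
Hamiltonian flow: it is compact and invariant, and the tangent bundle of the level set splits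
over `Λ` as `E⁻ ⊕ ℝX_H ⊕ E⁺`, invariantly under the tangent flow, with `E⁻` uniformly contracted
and `E⁺` uniformly expanded. -/
structure IsHyperbolicSet (σ : SymplecticForm I M) (H : M → ℝ) (Λ : Set M) : Prop where
  isCompact : IsCompact Λ
  invariant : ∀ t : ℝ, hamFlow σ H t '' Λ = Λ
  regular : IsRegularSet I H Λ
  splitting : ∃ (m : ℕ) (θ : ℝ) (Em Ep : ∀ x : M, Submodule ℝ (TangentSpace I x)),
    0 < m ∧ 0 < θ ∧ θ < 1 ∧ ∀ x ∈ Λ,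
      Em x ⊔ Submodule.span ℝ {hamVF σ H x} ⊔ Ep x = levelTangent I H x ∧
      iSupIndep ![Em x, Submodule.span ℝ {hamVF σ H x}, Ep x] ∧
      (∀ t : ℝ,
        (Em x).map
          (tangentFlow σ H t x : TangentSpace I x →ₗ[ℝ] TangentSpace I (hamFlow σ H t x)) =
          Em (hamFlow σ H t x) ∧
        (Ep x).map
          (tangentFlow σ H t x : TangentSpace I x →ₗ[ℝ] TangentSpace I (hamFlow σ H t x)) =
          Ep (hamFlow σ H t x)) ∧
      restrNorm (tangentFlow σ H m x) (Em x) ≤ θ ∧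
      restrNorm (tangentFlow σ H (-m) x) (Ep x) ≤ θ

/-- `(H, e)` is an Anosov Hamiltonian level: some energy surface of `H` at energy `e` is
hyperbolic for the Hamiltonian flow. -/
def IsAnosovLevel (σ : SymplecticForm I M) (H : M → ℝ) (e : ℝ) : Prop :=
  ∃ S : Set M, IsEnergySurface H e S ∧ IsHyperbolicSet σ H S

end Riemannian

end Hamiltonian

end HamiltonianDefs

/-!
The transversal linear Poincaré flow acts on the planes `𝒩_x`, and by invariance of the symplectic
form it preserves the area that `σ` induces on these planes. For an area preserving cocycle on
planes domination is hyperbolicity: if `u` and `v` span the two dominated lines at `x`, then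
`|σ(u, v)|` is comparable to `‖u‖ ‖v‖`, uniformly over the compact energy surface
(`exists_le_pairing`, `exists_pairing_le`), so the product of the growth rates on the two lines is
bounded above and below, while domination makes their quotient exponentially small. Hence the first
line is uniformly contracted and the second one uniformly expanded.

It remains to pass from the quotient by `X_H` to the tangent flow itself. A contracted line of the
quotient cocycle has a unique lift to a line of vectors whose tangent flow orbit tends to zero: the
drift along `X_H` is corrected by a convergent geometric series. The stable spaces obtained in this
way for both time directions are invariant and complement `ℝ X_H`. This is carried out for an
abstract cocycle in `IsFlowCocycle.exists_hyperbolic_splitting`.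

The facts about Hamiltonian flows that this uses are proved from the definitions. The manifold may
have a boundary; since the Hamiltonian is constant on boundary components, `X_H` is tangent to the
boundary (`localVF_tangent`). In a chart one extends the vector field past the half-space by means
of a retraction, solves the resulting Lipschitz equation, and checks that solutions remain in the
half-space and depend differentiably on the initial condition (`exists_local_flow`). Compactness
makes the flow complete (`exists_isMIntegralCurve_hamVF`). The form is preserved because in charts
its derivative along a solution of the variational equation is the Lie derivative, which vanishes
by closedness and by symmetry of the second derivative of the Hamiltonian
(`hasDerivAt_form_variational`, `pairing_flowMap`). Statements about the flow for all times follow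
from short times, uniform by compactness, by the group law (`forall_real_of_add`).
-/

/-! ### Hyperbolicity of an abstract linear cocycle over a flow -/

/-- A linear cocycle `D` over a flow `φ` on an invariant set `S`, acting on a fixed vector space `E`
that carries a norm `nrm x` for each base point `x`. The section `X` is invariant and bounded away
from zero and infinity, and `β x` is the `X`-coordinate, so that `v ↦ v - β x v • X x` is a
norm-decreasing projection along `X x`. -/
structure IsFlowCocycle {M E : Type*} [AddCommGroup E] [Module ℝ E] (S : Set M) (φ : ℝ → M → M)
    (D : ℝ → M → E →ₗ[ℝ] E) (X : M → E) (β : M → E →ₗ[ℝ] ℝ) (nrm : M → E → ℝ) : Prop where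
  mem : ∀ t, ∀ x ∈ S, φ t x ∈ S
  flow_zero : ∀ x ∈ S, φ 0 x = x
  flow_add : ∀ t s, ∀ x ∈ S, φ (t + s) x = φ t (φ s x)
  map_zero : ∀ x ∈ S, ∀ v, D 0 x v = v
  map_add : ∀ t s, ∀ x ∈ S, ∀ v, D (t + s) x v = D t (φ s x) (D s x v)
  map_X : ∀ t, ∀ x ∈ S, D t x (X x) = X (φ t x)
  coord_X : ∀ x ∈ S, β x (X x) = 1
  nrm_nonneg : ∀ x v, 0 ≤ nrm x v
  nrm_add : ∀ x v w, nrm x (v + w) ≤ nrm x v + nrm x w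
  nrm_smul : ∀ x (a : ℝ) v, nrm x (a • v) = |a| * nrm x v
  nrm_proj : ∀ x ∈ S, ∀ v, nrm x (v - β x v • X x) ≤ nrm x v
  bound : ∀ t, ∃ K, 0 ≤ K ∧ ∀ x ∈ S, ∀ v, nrm (φ t x) (D t x v) ≤ K * nrm x v
  lower : ∃ c > 0, ∀ x ∈ S, c ≤ nrm x (X x)
  upper : ∃ C, ∀ x ∈ S, nrm x (X x) ≤ C

/-- The cocycle induced by `D` on the quotients by `X`, realized on the kernels of `β`. -/
def quotCocycle {M E : Type*} [AddCommGroup E] [Module ℝ E] (φ : ℝ → M → M)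
    (D : ℝ → M → E →ₗ[ℝ] E) (X : M → E) (β : M → E →ₗ[ℝ] ℝ) (t : ℝ) (x : M) (v : E) : E :=
  D t x v - β (φ t x) (D t x v) • X (φ t x)

namespace IsFlowCocycle

variable {M E : Type*} [AddCommGroup E] [Module ℝ E] {S : Set M} {φ : ℝ → M → M}
  {D : ℝ → M → E →ₗ[ℝ] E} {X : M → E} {β : M → E →ₗ[ℝ] ℝ} {nrm : M → E → ℝ}

lemma nrm_zero (h : IsFlowCocycle S φ D X β nrm) (x : M) : nrm x 0 = 0 := by
  simpa using h.nrm_smul x 0 0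

lemma flow_comm (h : IsFlowCocycle S φ D X β nrm) (t s : ℝ) {x : M} (hx : x ∈ S) :
    φ t (φ s x) = φ s (φ t x) := by
  rw [← h.flow_add t s x hx, add_comm, h.flow_add s t x hx]

lemma flow_neg (h : IsFlowCocycle S φ D X β nrm) (t : ℝ) {x : M} (hx : x ∈ S) :
    φ (-t) (φ t x) = x := by
  rw [← h.flow_add (-t) t x hx, neg_add_cancel, h.flow_zero x hx]

lemma flow_neg' (h : IsFlowCocycle S φ D X β nrm) (t : ℝ) {x : M} (hx : x ∈ S) :
    φ t (φ (-t) x) = x := by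
  rw [← h.flow_add t (-t) x hx, add_neg_cancel, h.flow_zero x hx]

lemma map_comm (h : IsFlowCocycle S φ D X β nrm) (t s : ℝ) {x : M} (hx : x ∈ S) (v : E) :
    D t (φ s x) (D s x v) = D s (φ t x) (D t x v) := by
  rw [← h.map_add t s x hx, add_comm, h.map_add s t x hx]

lemma map_neg' (h : IsFlowCocycle S φ D X β nrm) (t : ℝ) {x : M} (hx : x ∈ S) (v : E) :
    D t (φ (-t) x) (D (-t) x v) = v := by
  rw [← h.map_add t (-t) x hx, add_neg_cancel, h.map_zero x hx]

lemma quot_zero (h : IsFlowCocycle S φ D X β nrm) {x : M} (hx : x ∈ S) {v : E} (hv : β x v = 0) :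
    quotCocycle φ D X β 0 x v = v := by
  simp [quotCocycle, h.map_zero x hx, h.flow_zero x hx, hv]

/-- The quotient cocycle does not see the `X`-component. -/
lemma quot_add_smul (h : IsFlowCocycle S φ D X β nrm) (t : ℝ) {x : M} (hx : x ∈ S) (v : E)
    (a : ℝ) : quotCocycle φ D X β t x (v + a • X x) = quotCocycle φ D X β t x v := by
  simp only [quotCocycle, _root_.map_add, map_smul, h.map_X t x hx, h.coord_X _ (h.mem t x hx),
    smul_eq_mul, mul_one, add_smul]
  abel

lemma quot_add (h : IsFlowCocycle S φ D X β nrm) (t s : ℝ) {x : M} (hx : x ∈ S) (v : E) :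
    quotCocycle φ D X β (t + s) x v =
      quotCocycle φ D X β t (φ s x) (quotCocycle φ D X β s x v) := by
  have h1 : quotCocycle φ D X β (t + s) x v = quotCocycle φ D X β t (φ s x) (D s x v) := by
    simp only [quotCocycle, h.map_add t s x hx, h.flow_add t s x hx]
  rw [h1]
  conv_rhs => rw [quotCocycle.eq_def φ D X β s x v, sub_eq_add_neg, ← neg_smul]
  rw [h.quot_add_smul t (h.mem s x hx)]

/-- The stable space at `x` for the time step `τ`, inside the span of the line field `N` and `X`:
the vectors that tend to zero under `D (k * τ)` as `k → ∞`. -/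
def stableSpace (h : IsFlowCocycle S φ D X β nrm) (N : M → Submodule ℝ E) (τ : ℝ) (x : M) :
    Submodule ℝ E where
  carrier := {v | v - β x v • X x ∈ N x ∧
    Filter.Tendsto (fun k : ℕ => nrm (φ (k * τ) x) (D (k * τ) x v)) Filter.atTop (𝓝 0)}
  add_mem' := by
    rintro v w ⟨hv, hv'⟩ ⟨hw, hw'⟩
    refine ⟨?_, ?_⟩
    · have := (N x).add_mem hv hw
      convert this using 1
      rw [_root_.map_add, add_smul]; abel
    · refine squeeze_zero (fun _ => h.nrm_nonneg _ _) (fun k => ?_) (by simpa using hv'.add hw')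
      rw [_root_.map_add]
      exact h.nrm_add _ _ _
  zero_mem' := by
    refine ⟨by simp, ?_⟩
    simp [h.nrm_zero]
  smul_mem' := by
    rintro a v ⟨hv, hv'⟩
    refine ⟨?_, ?_⟩
    · have := (N x).smul_mem a hv
      convert this using 1
      rw [map_smul, smul_sub, smul_smul, smul_eq_mul]
    · have := hv'.const_mul |a|
      simp only [mul_zero] at this
      refine this.congr fun k => ?_
      rw [map_smul, h.nrm_smul]

variable {N : M → Submodule ℝ E} {τ : ℝ}

lemma map_mem_stableSpace (h : IsFlowCocycle S φ D X β nrm)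
    (hinv : ∀ t, ∀ x ∈ S, ∀ n ∈ N x, quotCocycle φ D X β t x n ∈ N (φ t x))
    (t : ℝ) {x : M} (hx : x ∈ S) {v : E} (hv : v ∈ h.stableSpace N τ x) :
    D t x v ∈ h.stableSpace N τ (φ t x) := by
  obtain ⟨hv1, hv2⟩ := hv
  refine ⟨?_, ?_⟩
  · have := hinv t x hx _ hv1
    rwa [sub_eq_add_neg, ← neg_smul, h.quot_add_smul t hx] at this
  · obtain ⟨K, -, hK⟩ := h.bound t
    have h0 := hv2.const_mul K
    rw [mul_zero] at h0
    refine squeeze_zero (fun _ => h.nrm_nonneg _ _) (fun k => ?_) h0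
    rw [h.map_comm _ _ hx, h.flow_comm _ _ hx]
    exact hK _ (h.mem _ _ hx) _

lemma map_stableSpace (h : IsFlowCocycle S φ D X β nrm)
    (hinv : ∀ t, ∀ x ∈ S, ∀ n ∈ N x, quotCocycle φ D X β t x n ∈ N (φ t x))
    (t : ℝ) {x : M} (hx : x ∈ S) :
    (h.stableSpace N τ x).map (D t x) = h.stableSpace N τ (φ t x) := by
  apply le_antisymm
  · rintro _ ⟨v, hv, rfl⟩
    exact h.map_mem_stableSpace hinv t hx hv
  · intro w hw
    refine ⟨D (-t) (φ t x) w, ?_, ?_⟩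
    · have := h.map_mem_stableSpace hinv (-t) (h.mem t x hx) hw
      rwa [h.flow_neg t hx] at this
    · have := h.map_neg' t (h.mem t x hx) w
      rwa [h.flow_neg t hx] at this

lemma smul_X_mem_stableSpace (h : IsFlowCocycle S φ D X β nrm) {x : M} (hx : x ∈ S) {a : ℝ}
    (ha : a • X x ∈ h.stableSpace N τ x) : a = 0 := by
  obtain ⟨c, hc, hcX⟩ := h.lower
  have h1 := ha.2
  have h2 : ∀ k : ℕ, |a| * c ≤ nrm (φ (k * τ) x) (D (k * τ) x (a • X x)) := fun k => by
    rw [map_smul, h.nrm_smul, h.map_X _ x hx]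
    exact mul_le_mul_of_nonneg_left (hcX _ (h.mem _ x hx)) (abs_nonneg _)
  have h3 : |a| * c ≤ 0 := ge_of_tendsto' h1 h2
  have : |a| ≤ 0 := by
    by_contra hcon
    push Not at hcon
    exact absurd h3 (not_le.2 (mul_pos hcon hc))
  exact abs_nonpos_iff.1 this

lemma abs_coord_le (h : IsFlowCocycle S φ D X β nrm) : ∃ B, 0 ≤ B ∧ ∀ x ∈ S, ∀ v,
    |β x v| ≤ B * nrm x v := by
  obtain ⟨c, hc, hcX⟩ := h.lower
  refine ⟨2 / c, by positivity, fun x hx v => ?_⟩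
  have h1 : nrm x (β x v • X x) ≤ 2 * nrm x v := by
    have h2 := h.nrm_add x v ((-1 : ℝ) • (v - β x v • X x))
    have h3 := h.nrm_proj x hx v
    rw [h.nrm_smul] at h2
    have h4 : v + (-1 : ℝ) • (v - β x v • X x) = β x v • X x := by
      rw [neg_one_smul]; abel
    rw [h4] at h2
    norm_num at h2
    linarith
  rw [h.nrm_smul] at h1
  rw [div_mul_eq_mul_div, le_div_iff₀ hc]
  exact (mul_le_mul_of_nonneg_left (hcX x hx) (abs_nonneg _)).trans h1

/-- If the quotient cocycle contracts the line field `N` at a geometric rate, every `n ∈ N x` has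
a unique lift `n - b • X x` to the stable space, and the lifts are contracted at the same rate. The
number `b` is the limit of the `X`-coordinates of `D (k * τ) x n`, which form a Cauchy sequence. -/
lemma exists_lift (h : IsFlowCocycle S φ D X β nrm)
    (hN : ∀ x ∈ S, ∀ n ∈ N x, β x n = 0) {C r : ℝ} (hC : 0 ≤ C) (hr0 : 0 ≤ r) (hr1 : r < 1)
    (hcontr : ∀ x ∈ S, ∀ n ∈ N x, ∀ k : ℕ,
      nrm (φ (k * τ) x) (quotCocycle φ D X β (k * τ) x n) ≤ C * r ^ k * nrm x n) :
    ∃ C', 0 ≤ C' ∧ ∀ x ∈ S, ∀ n ∈ N x, ∃ b : ℝ, n - b • X x ∈ h.stableSpace N τ x ∧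
      ∀ k : ℕ, nrm (φ (k * τ) x) (D (k * τ) x (n - b • X x)) ≤ C' * r ^ k * nrm x n := by
  obtain ⟨B, hB, hβ⟩ := h.abs_coord_le
  obtain ⟨K, hK, hD⟩ := h.bound τ
  obtain ⟨U, hU⟩ := h.upper
  have hr : 0 < 1 - r := by linarith
  refine ⟨C + B * K * C / (1 - r) * |U|, by positivity, fun x hx n hn => ?_⟩
  set b : ℕ → ℝ := fun k => β (φ (k * τ) x) (D (k * τ) x n) with hb
  have hstep : ∀ k : ℕ, dist (b k) (b (k + 1)) ≤ B * K * C * nrm x n * r ^ k := by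
    intro k
    have e1 : ((k + 1 : ℕ) : ℝ) * τ = τ + k * τ := by push_cast; ring
    have hmem := h.mem (k * τ) x hx
    have e2 : D (k * τ) x n = quotCocycle φ D X β (k * τ) x n + b k • X (φ (k * τ) x) := by
      simp [quotCocycle, hb]
    have e3 : b (k + 1) = β (φ τ (φ (k * τ) x))
        (D τ (φ (k * τ) x) (quotCocycle φ D X β (k * τ) x n)) + b k := by
      have e4 : D (((k + 1 : ℕ) : ℝ) * τ) x n = D τ (φ (k * τ) x)
          (quotCocycle φ D X β (k * τ) x n) + b k • X (φ τ (φ (k * τ) x)) := by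
        rw [e1, h.map_add _ _ x hx, e2, _root_.map_add, map_smul, h.map_X _ _ hmem]
      change β (φ (((k + 1 : ℕ) : ℝ) * τ) x) (D (((k + 1 : ℕ) : ℝ) * τ) x n) = _
      rw [e4, e1, h.flow_add _ _ x hx, _root_.map_add, map_smul, h.coord_X _ (h.mem _ _ hmem),
        smul_eq_mul, mul_one]
    rw [dist_comm, Real.dist_eq, e3, add_sub_cancel_right]
    calc _ ≤ B * nrm _ _ := hβ _ (h.mem _ _ hmem) _
      _ ≤ B * (K * nrm _ _) := mul_le_mul_of_nonneg_left (hD _ hmem _) hB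
      _ ≤ B * (K * (C * r ^ k * nrm x n)) := by
        gcongr
        exact hcontr x hx n hn k
      _ = _ := by ring
  have hcauchy : CauchySeq b := cauchySeq_of_le_geometric r _ hr1 hstep
  obtain ⟨b₀, hlim⟩ := cauchySeq_tendsto_of_complete hcauchy
  have hdist : ∀ k, |b k - b₀| ≤ B * K * C * nrm x n * r ^ k / (1 - r) := fun k => by
    rw [← Real.dist_eq]
    exact dist_le_of_le_geometric_of_tendsto r _ hr1 hstep hlim k
  have hbound : ∀ k : ℕ, nrm (φ (k * τ) x) (D (k * τ) x (n - b₀ • X x)) ≤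
      (C + B * K * C / (1 - r) * |U|) * r ^ k * nrm x n := by
    intro k
    have hmem := h.mem (k * τ) x hx
    have e2 : D (k * τ) x (n - b₀ • X x) =
        quotCocycle φ D X β (k * τ) x n + (b k - b₀) • X (φ (k * τ) x) := by
      simp only [map_sub, map_smul, h.map_X _ x hx, quotCocycle, hb, sub_smul]
      abel
    rw [e2]
    refine (h.nrm_add _ _ _).trans ?_
    rw [h.nrm_smul]
    have h1 := hcontr x hx n hn k
    have h2 : |b k - b₀| * nrm (φ (k * τ) x) (X (φ (k * τ) x)) ≤
        B * K * C * nrm x n * r ^ k / (1 - r) * |U| :=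
      mul_le_mul (hdist k) ((hU _ hmem).trans (le_abs_self _)) (h.nrm_nonneg _ _)
        ((abs_nonneg _).trans (hdist k))
    calc _ ≤ C * r ^ k * nrm x n + B * K * C * nrm x n * r ^ k / (1 - r) * |U| := add_le_add h1 h2
      _ = _ := by ring
  refine ⟨b₀, ⟨?_, ?_⟩, hbound⟩
  · simpa [hN x hx n hn, h.coord_X x hx] using hn
  · have h0 : Filter.Tendsto (fun k : ℕ => (C + B * K * C / (1 - r) * |U|) * r ^ k * nrm x n)
        Filter.atTop (𝓝 0) := by
      have := (tendsto_pow_atTop_nhds_zero_of_lt_one hr0 hr1).const_mul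
        (C + B * K * C / (1 - r) * |U|)
      simpa using this.mul_const (nrm x n)
    exact squeeze_zero (fun _ => h.nrm_nonneg _ _) hbound h0

/-- The stable space is uniformly contracted. -/
lemma exists_contracts_stableSpace (h : IsFlowCocycle S φ D X β nrm)
    (hN : ∀ x ∈ S, ∀ n ∈ N x, β x n = 0) {C r : ℝ} (hC : 0 ≤ C) (hr0 : 0 ≤ r) (hr1 : r < 1)
    (hcontr : ∀ x ∈ S, ∀ n ∈ N x, ∀ k : ℕ,
      nrm (φ (k * τ) x) (quotCocycle φ D X β (k * τ) x n) ≤ C * r ^ k * nrm x n) :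
    ∃ C', 0 ≤ C' ∧ ∀ x ∈ S, ∀ v ∈ h.stableSpace N τ x, ∀ k : ℕ,
      nrm (φ (k * τ) x) (D (k * τ) x v) ≤ C' * r ^ k * nrm x v := by
  obtain ⟨C', hC', hlift⟩ := h.exists_lift hN hC hr0 hr1 hcontr
  refine ⟨C', hC', fun x hx v hv k => ?_⟩
  obtain ⟨b, hb, hbound⟩ := hlift x hx _ hv.1
  have h1 := Submodule.sub_mem _ hv hb
  have h2 : v - (v - β x v • X x - b • X x) = (β x v + b) • X x := by
    rw [add_smul]; abel
  rw [h2] at h1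
  have h3 := h.smul_X_mem_stableSpace hx h1
  have h4 : v - β x v • X x - b • X x = v := by
    rw [sub_sub, ← add_smul, h3, zero_smul, sub_zero]
  have h5 := hbound k
  rw [h4] at h5
  exact h5.trans (mul_le_mul_of_nonneg_left (h.nrm_proj x hx v) (by positivity))

section Domination

variable {Nm Np : M → Submodule ℝ E} {A : M → E → E → ℝ} {c C θ : ℝ}
  {m : ℕ}

/-- A dominated splitting `Nm ⊕ Np` whose area is preserved: since the product of the growth rates
on `Nm` and `Np` is bounded above and below while their ratio decays, `Nm` is contracted in the
future and `Np` in the past, both at the rate `√θ` per `m` units of time. -/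
lemma contracts_of_dominated (h : IsFlowCocycle S φ D X β nrm)
    (hminv : ∀ t, ∀ x ∈ S, ∀ n ∈ Nm x, quotCocycle φ D X β t x n ∈ Nm (φ t x))
    (hpinv : ∀ t, ∀ x ∈ S, ∀ n ∈ Np x, quotCocycle φ D X β t x n ∈ Np (φ t x))
    (hm : ∀ x ∈ S, ∃ u ∈ Nm x, 0 < nrm x u) (hp : ∀ x ∈ S, ∃ v ∈ Np x, 0 < nrm x v)
    (hmX : ∀ x ∈ S, ∀ u ∈ Nm x, β x u = 0) (hpX : ∀ x ∈ S, ∀ v ∈ Np x, β x v = 0)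
    (hc : 0 < c) (hC : 0 ≤ C)
    (hlow : ∀ x ∈ S, ∀ u ∈ Nm x, ∀ v ∈ Np x, c * (nrm x u * nrm x v) ≤ |A x u v|)
    (hupp : ∀ x ∈ S, ∀ u v, |A x u v| ≤ C * (nrm x u * nrm x v))
    (harea : ∀ t, ∀ x ∈ S, ∀ u ∈ Nm x, ∀ v ∈ Np x,
      A (φ t x) (quotCocycle φ D X β t x u) (quotCocycle φ D X β t x v) = A x u v)
    (hθ : 0 < θ)
    (hdom : ∀ x ∈ S, ∀ u ∈ Nm x, ∀ v ∈ Np x,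
      nrm (φ m x) (quotCocycle φ D X β m x u) * nrm x v ≤
        θ * (nrm (φ m x) (quotCocycle φ D X β m x v) * nrm x u)) :
    (∀ x ∈ S, ∀ u ∈ Nm x, ∀ k : ℕ, nrm (φ (k * (m : ℝ)) x)
        (quotCocycle φ D X β (k * (m : ℝ)) x u) ≤ √(C / c) * √θ ^ k * nrm x u) ∧
    (∀ x ∈ S, ∀ v ∈ Np x, ∀ k : ℕ, nrm (φ (k * (-m : ℝ)) x)
        (quotCocycle φ D X β (k * (-m : ℝ)) x v) ≤ √(C / c) * √θ ^ k * nrm x v) := by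
  have hup : ∀ t, ∀ x ∈ S, ∀ u ∈ Nm x, ∀ v ∈ Np x,
      c * (nrm (φ t x) (quotCocycle φ D X β t x u) * nrm (φ t x) (quotCocycle φ D X β t x v)) ≤ C * (nrm x u * nrm x v) :=
    fun t x hx u hu v hv =>
      (hlow _ (h.mem t x hx) _ (hminv t x hx u hu) _ (hpinv t x hx v hv)).trans
        (by rw [harea t x hx u hu v hv]; exact hupp x hx u v)
  have hdown : ∀ t, ∀ x ∈ S, ∀ u ∈ Nm x, ∀ v ∈ Np x,
      c * (nrm x u * nrm x v) ≤ C * (nrm (φ t x) (quotCocycle φ D X β t x u) * nrm (φ t x) (quotCocycle φ D X β t x v)) :=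
    fun t x hx u hu v hv => (hlow x hx u hu v hv).trans
      (by rw [← harea t x hx u hu v hv]; exact hupp _ (h.mem t x hx) _ _)
  have hpos : ∀ t, ∀ x ∈ S, ∀ v ∈ Np x, 0 < nrm x v → 0 < nrm (φ t x) (quotCocycle φ D X β t x v) := by
    intro t x hx v hv hv0
    obtain ⟨u, hu, hu0⟩ := hm x hx
    refine (h.nrm_nonneg _ _).lt_of_ne fun h0 => ?_
    have := hdown t x hx u hu v hv
    rw [← h0, mul_zero, mul_zero] at this
    exact absurd this (not_le.2 (by positivity))
  have hiter : ∀ k : ℕ, ∀ x ∈ S, ∀ u ∈ Nm x, ∀ v ∈ Np x, 0 < nrm x v →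
      nrm (φ (k * (m : ℝ)) x) (quotCocycle φ D X β (k * (m : ℝ)) x u) * nrm x v ≤
        θ ^ k * (nrm (φ (k * (m : ℝ)) x) (quotCocycle φ D X β (k * (m : ℝ)) x v) * nrm x u) := by
    intro k x hx u hu v hv hv0
    induction k with
    | zero =>
      simp only [Nat.cast_zero, zero_mul, h.flow_zero x hx, pow_zero, one_mul]
      rw [h.quot_zero hx (hmX x hx u hu), h.quot_zero hx (hpX x hx v hv), mul_comm]
    | succ k ih =>
      have e1 : ((k + 1 : ℕ) : ℝ) * m = m + k * m := by push_cast; ring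
      have hmem := h.mem (k * (m : ℝ)) x hx
      rw [e1, h.flow_add _ _ x hx, h.quot_add _ _ hx, h.quot_add _ _ hx]
      have h1 := hdom _ hmem _ (hminv (k * (m : ℝ)) x hx u hu) _ (hpinv (k * (m : ℝ)) x hx v hv)
      have hb := hpos (k * (m : ℝ)) x hx v hv hv0
      set a := nrm (φ (k * (m : ℝ)) x) (quotCocycle φ D X β (k * (m : ℝ)) x u)
      set b := nrm (φ (k * (m : ℝ)) x) (quotCocycle φ D X β (k * (m : ℝ)) x v)
      set a' := nrm (φ m (φ (k * (m : ℝ)) x)) (quotCocycle φ D X β m (φ (k * (m : ℝ)) x) (quotCocycle φ D X β (k * (m : ℝ)) x u))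
      set b' := nrm (φ m (φ (k * (m : ℝ)) x)) (quotCocycle φ D X β m (φ (k * (m : ℝ)) x) (quotCocycle φ D X β (k * (m : ℝ)) x v))
      have hb' : 0 ≤ b' := h.nrm_nonneg _ _
      refine le_of_mul_le_mul_right ?_ hb
      calc a' * nrm x v * b = (a' * b) * nrm x v := by ring
        _ ≤ (θ * (b' * a)) * nrm x v := mul_le_mul_of_nonneg_right h1 hv0.le
        _ = θ * b' * (a * nrm x v) := by ring
        _ ≤ θ * b' * (θ ^ k * (b * nrm x u)) := mul_le_mul_of_nonneg_left ih (by positivity)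
        _ = θ ^ (k + 1) * (b' * nrm x u) * b := by ring
  have hsqrt : ∀ (k : ℕ) {a b : ℝ}, 0 ≤ b → a ^ 2 * c ≤ C * θ ^ k * b ^ 2 →
      a ≤ √(C / c) * √θ ^ k * b := by
    intro k a b hb hab
    refine le_of_sq_le_sq ?_ (by positivity)
    rw [mul_pow, mul_pow, Real.sq_sqrt (by positivity), ← pow_mul, mul_comm k 2, pow_mul,
      Real.sq_sqrt hθ.le, div_mul_eq_mul_div, div_mul_eq_mul_div, le_div_iff₀ hc]
    exact hab
  refine ⟨fun x hx u hu k => ?_, fun y hy w hw k => ?_⟩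
  · obtain ⟨v, hv, hv0⟩ := hp x hx
    have h1 := hiter k x hx u hu v hv hv0
    have h2 := hup (k * (m : ℝ)) x hx u hu v hv
    set a := nrm (φ (k * (m : ℝ)) x) (quotCocycle φ D X β (k * (m : ℝ)) x u)
    set b := nrm (φ (k * (m : ℝ)) x) (quotCocycle φ D X β (k * (m : ℝ)) x v)
    have ha : 0 ≤ a := h.nrm_nonneg _ _
    have hu' := h.nrm_nonneg x u
    refine hsqrt k hu' (le_of_mul_le_mul_right ?_ hv0)
    calc a ^ 2 * c * nrm x v = a * c * (a * nrm x v) := by ring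
      _ ≤ a * c * (θ ^ k * (b * nrm x u)) := mul_le_mul_of_nonneg_left h1 (by positivity)
      _ = θ ^ k * nrm x u * (c * (a * b)) := by ring
      _ ≤ θ ^ k * nrm x u * (C * (nrm x u * nrm x v)) :=
        mul_le_mul_of_nonneg_left h2 (by positivity)
      _ = _ := by ring
  · have e1 : (k : ℝ) * (-m : ℝ) = -(k * (m : ℝ)) := by ring
    rw [e1]
    have hx := h.mem (-(k * (m : ℝ))) y hy
    have hv : quotCocycle φ D X β (-(k * (m : ℝ))) y w ∈ Np _ := hpinv _ y hy w hw
    have hback : quotCocycle φ D X β (k * (m : ℝ)) (φ (-(k * (m : ℝ))) y) (quotCocycle φ D X β (-(k * (m : ℝ))) y w) = w := by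
      rw [← h.quot_add _ _ hy, add_neg_cancel, h.quot_zero hy (hpX y hy w hw)]
    set x := φ (-(k * (m : ℝ))) y with hxdef
    set v := quotCocycle φ D X β (-(k * (m : ℝ))) y w with hvdef
    have hφ : φ (k * (m : ℝ)) x = y := h.flow_neg' _ hy
    rcases (h.nrm_nonneg x v).eq_or_lt with h0 | hv0
    · rw [← h0]
      exact mul_nonneg (by positivity) (h.nrm_nonneg _ _)
    obtain ⟨u, hu, hu0⟩ := hm x hx
    have h1 := hiter k x hx u hu v hv hv0
    have h2 := hdown (k * (m : ℝ)) x hx u hu v hv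
    rw [hφ, hback] at h1 h2
    set a := nrm y (quotCocycle φ D X β (k * (m : ℝ)) x u)
    have hw0 := h.nrm_nonneg y w
    refine hsqrt k hw0 (le_of_mul_le_mul_right ?_ hu0)
    calc nrm x v ^ 2 * c * nrm x u = nrm x v * (c * (nrm x u * nrm x v)) := by ring
      _ ≤ nrm x v * (C * (a * nrm y w)) := mul_le_mul_of_nonneg_left h2 hv0.le
      _ = C * nrm y w * (a * nrm x v) := by ring
      _ ≤ C * nrm y w * (θ ^ k * (nrm y w * nrm x u)) :=
        mul_le_mul_of_nonneg_left h1 (by positivity)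
      _ = _ := by ring

/-- An area-preserving dominated splitting of the quotient cocycle yields a hyperbolic splitting
`Em ⊕ ℝ X ⊕ Ep` for the cocycle itself. -/
theorem exists_hyperbolic_splitting (h : IsFlowCocycle S φ D X β nrm)
    (hminv : ∀ t, ∀ x ∈ S, ∀ n ∈ Nm x, quotCocycle φ D X β t x n ∈ Nm (φ t x))
    (hpinv : ∀ t, ∀ x ∈ S, ∀ n ∈ Np x, quotCocycle φ D X β t x n ∈ Np (φ t x))
    (hm : ∀ x ∈ S, ∃ u ∈ Nm x, 0 < nrm x u) (hp : ∀ x ∈ S, ∃ v ∈ Np x, 0 < nrm x v)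
    (hmX : ∀ x ∈ S, ∀ u ∈ Nm x, β x u = 0) (hpX : ∀ x ∈ S, ∀ v ∈ Np x, β x v = 0)
    (hdisj : ∀ x ∈ S, Disjoint (Nm x) (Np x))
    (hc : 0 < c) (hC : 0 ≤ C)
    (hlow : ∀ x ∈ S, ∀ u ∈ Nm x, ∀ v ∈ Np x, c * (nrm x u * nrm x v) ≤ |A x u v|)
    (hupp : ∀ x ∈ S, ∀ u v, |A x u v| ≤ C * (nrm x u * nrm x v))
    (harea : ∀ t, ∀ x ∈ S, ∀ u ∈ Nm x, ∀ v ∈ Np x,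
      A (φ t x) (quotCocycle φ D X β t x u) (quotCocycle φ D X β t x v) = A x u v)
    (hθ : 0 < θ) (hθ1 : θ < 1) (hmpos : 0 < m)
    (hdom : ∀ x ∈ S, ∀ u ∈ Nm x, ∀ v ∈ Np x,
      nrm (φ m x) (quotCocycle φ D X β m x u) * nrm x v ≤
        θ * (nrm (φ m x) (quotCocycle φ D X β m x v) * nrm x u)) :
    ∃ (p : ℕ) (Em Ep : M → Submodule ℝ E), 0 < p ∧ ∀ x ∈ S,
      Em x ⊔ Submodule.span ℝ {X x} ⊔ Ep x = Nm x ⊔ Np x ⊔ Submodule.span ℝ {X x} ∧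
      iSupIndep ![Em x, Submodule.span ℝ {X x}, Ep x] ∧
      (∀ t, (Em x).map (D t x) = Em (φ t x) ∧ (Ep x).map (D t x) = Ep (φ t x)) ∧
      (∀ v ∈ Em x, nrm (φ p x) (D p x v) ≤ 1 / 2 * nrm x v) ∧
      (∀ v ∈ Ep x, nrm (φ (-p) x) (D (-p) x v) ≤ 1 / 2 * nrm x v) := by
  obtain ⟨hcm, hcp⟩ := h.contracts_of_dominated hminv hpinv hm hp hmX hpX hc hC hlow hupp harea
    hθ hdom
  have hr1 : √θ < 1 := by rw [Real.sqrt_lt' one_pos]; simpa using hθ1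
  obtain ⟨C₁, hC₁, hE₁⟩ := h.exists_contracts_stableSpace hmX (Real.sqrt_nonneg _)
    (Real.sqrt_nonneg _) hr1 hcm
  obtain ⟨C₂, hC₂, hE₂⟩ := h.exists_contracts_stableSpace hpX (Real.sqrt_nonneg _)
    (Real.sqrt_nonneg _) hr1 hcp
  obtain ⟨_, -, hl₁⟩ := h.exists_lift hmX (Real.sqrt_nonneg _)
    (Real.sqrt_nonneg _) hr1 hcm
  obtain ⟨_, -, hl₂⟩ := h.exists_lift hpX (Real.sqrt_nonneg _)
    (Real.sqrt_nonneg _) hr1 hcp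
  obtain ⟨k, hk1, hk2, hk0⟩ : ∃ k : ℕ, C₁ * √θ ^ k < 1 / 2 ∧ C₂ * √θ ^ k < 1 / 2 ∧ 0 < k := by
    have ht := tendsto_pow_atTop_nhds_zero_of_lt_one (Real.sqrt_nonneg θ) hr1
    have t1 := (ht.const_mul C₁).eventually_lt_const
      (show C₁ * 0 < 1 / 2 by rw [mul_zero]; norm_num)
    have t2 := (ht.const_mul C₂).eventually_lt_const
      (show C₂ * 0 < 1 / 2 by rw [mul_zero]; norm_num)
    obtain ⟨k, hk⟩ := (t1.and (t2.and (Filter.eventually_gt_atTop 0))).exists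
    exact ⟨k, hk.1, hk.2.1, hk.2.2⟩
  refine ⟨k * m, h.stableSpace Nm m, h.stableSpace Np (-m), Nat.mul_pos hk0 hmpos,
    fun x hx => ⟨?_, ?_, fun t => ⟨h.map_stableSpace hminv t hx, h.map_stableSpace hpinv t hx⟩,
      fun v hv => ?_, fun v hv => ?_⟩⟩
  · have hspan : ∀ b : ℝ, b • X x ∈ Submodule.span ℝ {X x} := fun b =>
      Submodule.smul_mem _ _ (Submodule.mem_span_singleton_self _)
    apply le_antisymm
    · refine sup_le (sup_le (fun v hv => ?_) le_sup_right) (fun v hv => ?_)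
      · rw [← sub_add_cancel v (β x v • X x)]
        exact Submodule.add_mem_sup (Submodule.mem_sup_left hv.1) (hspan _)
      · rw [← sub_add_cancel v (β x v • X x)]
        exact Submodule.add_mem_sup (Submodule.mem_sup_right hv.1) (hspan _)
    · refine sup_le (sup_le (fun n hn => ?_) (fun n hn => ?_)) (le_sup_right.trans le_sup_left)
      · obtain ⟨b, hb, -⟩ := hl₁ x hx n hn
        rw [← sub_add_cancel n (b • X x)]
        exact Submodule.mem_sup_left (Submodule.add_mem_sup hb (hspan b))
      · obtain ⟨b, hb, -⟩ := hl₂ x hx n hn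
        rw [← sub_add_cancel n (b • X x), add_comm]
        exact Submodule.add_mem_sup (Submodule.mem_sup_right (hspan b)) hb
  · -- Projecting a relation `u + a • X x + v = 0` along `X x` gives a relation in `Nm x ⊕ Np x`.
    have key : ∀ u ∈ h.stableSpace Nm m x, ∀ v ∈ h.stableSpace Np (-m) x, ∀ a : ℝ,
        u + a • X x + v = 0 → u = 0 ∧ a = 0 ∧ v = 0 := by
      intro u hu v hv a huv
      have e1 : (u - β x u • X x) = -(v - β x v • X x) := by
        have e2 : β x u + a + β x v = 0 := by
          have := congrArg (β x) huv
          simpa [h.coord_X x hx] using this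
        have e3 : u = -(a • X x) - v := by
          rw [← sub_eq_zero, ← huv]; abel
        have e4 : β x u = -a - β x v := by linarith
        rw [e4]
        nth_rewrite 1 [e3]
        rw [sub_smul, neg_smul]
        abel
      have e5 : u - β x u • X x = 0 :=
        Submodule.disjoint_def.1 (hdisj x hx) _ hu.1 (e1 ▸ Submodule.neg_mem _ hv.1)
      have e6 : v - β x v • X x = 0 := by rwa [e5, eq_comm, neg_eq_zero] at e1
      rw [sub_eq_zero] at e5 e6
      have hu0 : u = 0 := by
        rw [e5] at hu ⊢
        rw [h.smul_X_mem_stableSpace hx hu, zero_smul]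
      have hv0 : v = 0 := by
        rw [e6] at hv ⊢
        rw [h.smul_X_mem_stableSpace hx hv, zero_smul]
      refine ⟨hu0, ?_, hv0⟩
      rw [hu0, hv0, zero_add, add_zero] at huv
      have := congrArg (β x) huv
      simpa [h.coord_X x hx] using this
    rw [iSupIndep_fin_three]
    simp only [Matrix.cons_val_zero, Matrix.cons_val_one, Matrix.cons_val]
    refine ⟨?_, ?_, ?_⟩ <;> rw [Submodule.disjoint_def] <;> intro w hw hw'
    · obtain ⟨y, hy, v, hv, rfl⟩ := Submodule.mem_sup.1 hw'
      obtain ⟨a, rfl⟩ := Submodule.mem_span_singleton.1 hy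
      refine neg_eq_zero.1 (key _ (Submodule.neg_mem _ hw) v hv a ?_).1
      abel
    · obtain ⟨v, hv, u, hu, hvu⟩ := Submodule.mem_sup.1 hw'
      obtain ⟨a, rfl⟩ := Submodule.mem_span_singleton.1 hw
      have := (key u hu v hv (-a) (by rw [neg_smul, ← hvu]; abel)).2.1
      rw [neg_eq_zero.1 this, zero_smul]
    · obtain ⟨u, hu, y, hy, rfl⟩ := Submodule.mem_sup.1 hw'
      obtain ⟨a, rfl⟩ := Submodule.mem_span_singleton.1 hy
      refine neg_eq_zero.1 (key u hu _ (Submodule.neg_mem _ hw) a ?_).2.2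
      abel
  · have := hE₁ x hx v hv k
    rw [Nat.cast_mul]
    exact this.trans (mul_le_mul_of_nonneg_right hk1.le (h.nrm_nonneg _ _))
  · have := hE₂ x hx v hv k
    rw [mul_neg] at this
    rw [Nat.cast_mul]
    exact this.trans (mul_le_mul_of_nonneg_right hk2.le (h.nrm_nonneg _ _))

end Domination

end IsFlowCocycle

/-! ### Local flows on half-spaces -/

section LocalFlow

/-- Two-sided Grönwall estimate on a short time interval. -/
lemma norm_le_of_norm_deriv_le {F : Type*} [NormedAddCommGroup F] [NormedSpace ℝ F]
    {f f' : ℝ → F} {K δ ε t : ℝ} (hK : 1 ≤ K) (hKε : K * ε ≤ 1) (hδ : 0 ≤ δ)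
    (hf : ∀ s, |s| < ε → HasDerivAt f (f' s) s)
    (hb : ∀ s, |s| < ε → ‖f' s‖ ≤ K * ‖f s‖ + δ) (ht : |t| < ε) :
    ‖f t‖ ≤ 3 * ‖f 0‖ + 2 * δ * |t| := by
  have key : ∀ {g g' : ℝ → F} {s : ℝ}, 0 ≤ s → s < ε →
      (∀ r, |r| < ε → HasDerivAt g (g' r) r) → (∀ r, |r| < ε → ‖g' r‖ ≤ K * ‖g r‖ + δ) →
      ‖g s‖ ≤ 3 * ‖g 0‖ + 2 * δ * s := by
    intro g g' s hs hsε hg hgb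
    have hlt : ∀ r ∈ Icc 0 s, |r| < ε := fun r hr => by
      rw [abs_of_nonneg hr.1]; exact hr.2.trans_lt hsε
    have h1 := norm_le_gronwallBound_of_norm_deriv_right_le (f := g) (f' := g') (δ := ‖g 0‖)
      (K := K) (ε := δ) (a := 0) (b := s)
      (fun r hr => (hg r (hlt r hr)).continuousAt.continuousWithinAt)
      (fun r hr => (hg r (hlt r (Ico_subset_Icc_self hr))).hasDerivWithinAt) le_rfl
      (fun r hr => hgb r (hlt r (Ico_subset_Icc_self hr))) s ⟨hs, le_rfl⟩
    refine h1.trans ?_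
    rw [gronwallBound_of_K_ne_0 (by positivity), sub_zero]
    have hKs0 : 0 ≤ K * s := by positivity
    have hKs : K * s ≤ 1 := (mul_le_mul_of_nonneg_left hsε.le (by positivity)).trans hKε
    have h2 : Real.exp (K * s) ≤ 3 :=
      (Real.exp_le_exp.2 hKs).trans (by linarith [Real.exp_one_lt_d9])
    have h3 : Real.exp (K * s) - 1 ≤ 2 * (K * s) := by
      have := Real.abs_exp_sub_one_le (x := K * s) (by rwa [abs_of_nonneg hKs0])
      rw [abs_of_nonneg hKs0] at this
      exact (le_abs_self _).trans this
    have h4 : δ / K * (Real.exp (K * s) - 1) ≤ δ / K * (2 * (K * s)) :=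
      mul_le_mul_of_nonneg_left h3 (by positivity)
    have h5 : δ / K * (2 * (K * s)) = 2 * δ * s := by field_simp
    have h6 := mul_le_mul_of_nonneg_left h2 (norm_nonneg (g 0))
    linarith
  rcases le_total 0 t with h | h
  · rw [abs_of_nonneg h] at ht ⊢
    exact key h ht hf hb
  · rw [abs_of_nonpos h] at ht ⊢
    have := key (g := fun r => f (-r)) (g' := fun r => -f' (-r)) (s := -t) (by linarith) ht
      (fun r hr => by
        have := (hf (-r) (by rwa [abs_neg])).scomp r (hasDerivAt_neg r)
        simpa [Function.comp_def] using this)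
      (fun r hr => by
        rw [norm_neg]; exact hb (-r) (by rwa [abs_neg]))
    simpa using this

lemma eq_of_forall_hasDerivAt_zero {F : Type*} [NormedAddCommGroup F] [NormedSpace ℝ F]
    {f : ℝ → F} {ε t : ℝ} (hf : ∀ s, |s| < ε → HasDerivAt f 0 s) (ht : |t| < ε) : f t = f 0 := by
  have hε : 0 < ε := (abs_nonneg t).trans_lt ht
  have hmem : ∀ s ∈ Metric.ball (0 : ℝ) ε, |s| < ε := fun s hs => by simpa using hs
  exact Metric.isOpen_ball.is_const_of_deriv_eq_zero (convex_ball (0 : ℝ) ε).isPreconnected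
    (fun s hs => (hf s (hmem s hs)).differentiableAt.differentiableWithinAt)
    (fun s hs => (hf s (hmem s hs)).deriv) (by simpa using ht) (Metric.mem_ball_self hε)

variable {E : Type*} [NormedAddCommGroup E] [NormedSpace ℝ E]

/-- A retraction onto the half-space `{0 ≤ ℓ}` that maps its complement to the boundary. -/
lemma exists_halfSpace_retraction (ℓ : E →L[ℝ] ℝ) : ∃ (r : E → E) (κ : ℝ), 1 ≤ κ ∧
    (∀ a b, ‖r a - r b‖ ≤ κ * ‖a - b‖) ∧ (∀ y, 0 ≤ ℓ (r y)) ∧ (∀ y, 0 ≤ ℓ y → r y = y) ∧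
    ∀ y, ℓ y ≤ 0 → ℓ (r y) = 0 := by
  obtain ⟨w, hw⟩ : ∃ w, ∀ y, ℓ y = 0 ∨ ℓ w = 1 := by
    by_cases h : ∀ y, ℓ y = 0
    · exact ⟨0, fun y => Or.inl (h y)⟩
    · push Not at h
      obtain ⟨v, hv⟩ := h
      exact ⟨(ℓ v)⁻¹ • v, fun y => Or.inr (by simp [hv])⟩
  refine ⟨fun y => y - min (ℓ y) 0 • w, 1 + ‖ℓ‖ * ‖w‖, le_add_of_nonneg_right (by positivity),
    fun a b => ?_, fun y => ?_, fun y hy => ?_, fun y hy => ?_⟩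
  · have h1 : a - min (ℓ a) 0 • w - (b - min (ℓ b) 0 • w) =
        (a - b) - (min (ℓ a) 0 - min (ℓ b) 0) • w := by
      rw [sub_smul]; abel
    rw [h1]
    refine (norm_sub_le _ _).trans ?_
    rw [norm_smul, Real.norm_eq_abs]
    have h2 : |min (ℓ a) 0 - min (ℓ b) 0| ≤ ‖ℓ‖ * ‖a - b‖ := by
      refine (abs_min_sub_min_le_max _ _ _ _).trans ?_
      rw [sub_self, abs_zero, max_eq_left (abs_nonneg _), ← map_sub, ← Real.norm_eq_abs]
      exact ℓ.le_opNorm _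
    nlinarith [mul_le_mul_of_nonneg_right h2 (norm_nonneg w)]
  · rcases hw y with h | h
    · simp [h]
    · simp [h]
  · simp [hy]
  · rcases hw y with h | h
    · simp [h]
    · simp [h, hy]

/-- A curve in `E` that starts in the half-space `{0 ≤ ℓ}` and whose velocity is tangent to the
boundary hyperplane as long as the curve is outside stays in the half-space. -/
lemma nonneg_of_tangent (ℓ : E →L[ℝ] ℝ) {c c' : ℝ → E} {ε t : ℝ} (h0 : 0 ≤ ℓ (c 0))
    (hc : ∀ s, |s| < ε → HasDerivAt c (c' s) s)
    (htan : ∀ s, |s| < ε → ℓ (c s) ≤ 0 → ℓ (c' s) = 0) (ht : |t| < ε) : 0 ≤ ℓ (c t) := by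
  -- The function `min (ℓ ∘ c) 0 ^ 2` is differentiable with derivative zero.
  have hsq : ∀ a : ℝ, HasDerivAt (fun x : ℝ => min x 0 ^ 2) (2 * min a 0) a := by
    intro a
    rcases lt_trichotomy a 0 with h | h | h
    · have h1 := hasDerivAt_pow 2 a
      rw [min_eq_left h.le]
      refine (h1.congr_of_eventuallyEq ?_).congr_deriv (by simp)
      filter_upwards [eventually_lt_nhds h] with x hx
      rw [min_eq_left hx.le]
    · subst h
      simp only [min_self, mul_zero]
      rw [hasDerivAt_iff_isLittleO_nhds_zero]
      simp only [zero_add, min_self, smul_zero, sub_zero, ne_eq, OfNat.ofNat_ne_zero,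
        not_false_eq_true, zero_pow]
      refine Asymptotics.IsBigO.trans_isLittleO (g := fun h : ℝ => h ^ 2) ?_ ?_
      · refine Asymptotics.IsBigO.of_bound 1 (Filter.Eventually.of_forall fun x => ?_)
        rw [one_mul, norm_pow, norm_pow, Real.norm_eq_abs, Real.norm_eq_abs]
        refine pow_le_pow_left₀ (abs_nonneg _) ?_ 2
        rcases le_total x 0 with h | h
        · rw [min_eq_left h]
        · rw [min_eq_right h, abs_zero]; exact abs_nonneg _
      · simpa using Asymptotics.isLittleO_pow_id (𝕜 := ℝ) (n := 2) (by norm_num)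
    · rw [min_eq_right h.le]
      refine ((hasDerivAt_const a (0 : ℝ)).congr_of_eventuallyEq ?_).congr_deriv (by simp)
      filter_upwards [eventually_gt_nhds h] with x hx
      rw [min_eq_right hx.le]; norm_num
  have hderiv : ∀ s, |s| < ε → HasDerivAt (fun s => min (ℓ (c s)) 0 ^ 2) 0 s := by
    intro s hs
    have h1 : HasDerivAt (fun s => ℓ (c s)) (ℓ (c' s)) s :=
      ℓ.hasFDerivAt.comp_hasDerivAt s (hc s hs)
    have h2 := (hsq (ℓ (c s))).comp s h1
    refine h2.congr_deriv ?_
    rcases le_total (ℓ (c s)) 0 with h | h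
    · rw [htan s hs h, mul_zero]
    · rw [min_eq_right h]; ring
  have h4 := eq_of_forall_hasDerivAt_zero hderiv ht
  rw [min_eq_right h0] at h4
  have h5 : min (ℓ (c t)) 0 = 0 := by simpa using h4
  exact min_eq_right_iff.1 h5

/-- A globally Lipschitz vector field has solutions on a common time interval for all initial values
in a unit ball. -/
lemma exists_flow_of_lipschitz [CompleteSpace E] {Y : E → E} {κ : ℝ} (hκ : 1 ≤ κ)
    (hY : ∀ a b, ‖Y a - Y b‖ ≤ κ * ‖a - b‖) (y₀ : E) :
    ∃ ε > 0, ∃ α : E → ℝ → E, ∀ z, ‖z - y₀‖ ≤ 1 → α z 0 = z ∧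
      ∀ t, |t| < ε → HasDerivAt (α z) (Y (α z t)) t := by
  lift κ to NNReal using by linarith
  set L : NNReal := ‖Y y₀‖₊ + κ * 2 with hL
  have hLpos : (0 : ℝ) < L := by rw [hL]; push_cast; positivity
  have hε : 0 < (L : ℝ)⁻¹ := by positivity
  have hpl : IsPicardLindelof (fun _ => Y) (tmin := -(L : ℝ)⁻¹) (tmax := (L : ℝ)⁻¹)
      ⟨0, by simp, by simp⟩ y₀ 2 1 L κ := by
    refine IsPicardLindelof.of_time_independent (fun x hx => ?_) ?_ ?_
    · have h1 := hY x y₀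
      have h2 : ‖x - y₀‖ ≤ 2 := by simpa [dist_eq_norm] using hx
      have h3 : ‖Y x‖ ≤ ‖Y y₀‖ + ‖Y x - Y y₀‖ := norm_le_insert' _ _
      rw [hL]; push_cast
      nlinarith [mul_le_mul_of_nonneg_left h2 κ.coe_nonneg]
    · exact (LipschitzWith.of_dist_le_mul fun a b => by
        rw [dist_eq_norm, dist_eq_norm]; exact hY a b).lipschitzOnWith
    · simp only [sub_zero, zero_sub, neg_neg, max_self, NNReal.coe_ofNat, NNReal.coe_one]
      rw [mul_inv_cancel₀ hLpos.ne']; norm_num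
  obtain ⟨α, hα⟩ := hpl.exists_forall_mem_closedBall_eq_forall_mem_Icc_hasDerivWithinAt
  refine ⟨(L : ℝ)⁻¹, hε, α, fun z hz => ?_⟩
  obtain ⟨h0, hd⟩ := hα z (by simpa [dist_eq_norm] using hz)
  refine ⟨h0, fun t ht => ?_⟩
  rw [abs_lt] at ht
  exact (hd t ⟨ht.1.le, ht.2.le⟩).hasDerivAt (Icc_mem_nhds ht.1 ht.2)

/-- The fundamental solution of a linear differential equation on a short time interval. -/
lemma exists_fundamental_solution [CompleteSpace E] {B : ℝ → E →L[ℝ] E} {Λ ε : ℝ} (hΛ : 1 ≤ Λ)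
    (hε : 0 ≤ ε) (hΛε : 2 * Λ * ε ≤ 1) (hB : ContinuousOn B (Icc (-ε) ε))
    (hBΛ : ∀ t ∈ Icc (-ε) ε, ‖B t‖ ≤ Λ) :
    ∃ A : ℝ → E →L[ℝ] E, A 0 = ContinuousLinearMap.id ℝ E ∧
      ∀ t, |t| < ε → HasDerivAt A ((B t).comp (A t)) t := by
  lift Λ to NNReal using by linarith
  have hpl : IsPicardLindelof (fun t (A : E →L[ℝ] E) => (B t).comp A) (tmin := -ε) (tmax := ε)
      ⟨0, by simpa using hε, hε⟩ (ContinuousLinearMap.id ℝ E) 1 0 (Λ * 2) Λ := by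
    refine ⟨fun t ht => ?_, fun A _ => ?_, fun t ht A hA => ?_, ?_⟩
    · refine (LipschitzWith.of_dist_le_mul fun a b => ?_).lipschitzOnWith
      rw [dist_eq_norm, dist_eq_norm, ← ContinuousLinearMap.comp_sub]
      exact (ContinuousLinearMap.opNorm_comp_le _ _).trans
        (mul_le_mul_of_nonneg_right (hBΛ t ht) (norm_nonneg _))
    · exact hB.clm_comp continuousOn_const
    · have h1 : ‖A - ContinuousLinearMap.id ℝ E‖ ≤ 1 := by simpa [dist_eq_norm] using hA
      have h2 : ‖A‖ ≤ 2 := by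
        have := norm_le_insert' A (ContinuousLinearMap.id ℝ E)
        have h3 : ‖ContinuousLinearMap.id ℝ E‖ ≤ 1 := ContinuousLinearMap.norm_id_le
        linarith
      push_cast
      exact (ContinuousLinearMap.opNorm_comp_le _ _).trans
        (mul_le_mul (hBΛ t ht) h2 (norm_nonneg _) Λ.coe_nonneg)
    · simp only [sub_zero, zero_sub, neg_neg, max_self, NNReal.coe_zero, NNReal.coe_one]
      push_cast
      linarith
  obtain ⟨A, h0, hA⟩ := hpl.exists_eq_forall_mem_Icc_hasDerivWithinAt₀
  refine ⟨A, h0, fun t ht => ?_⟩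
  rw [abs_lt] at ht
  exact (hA t ⟨ht.1.le, ht.2.le⟩).hasDerivAt (Icc_mem_nhds ht.1 ht.2)

/-- A `C¹` map on a half-space is Lipschitz on a small ball around any point, with a continuous
bounded derivative. -/
lemma exists_bound_fderivWithin [FiniteDimensional ℝ E] {K Ω : Set E} (hK : Convex ℝ K)
    (hKc : IsClosed K) (hKu : UniqueDiffOn ℝ K) {Y : E → E} {y₀ : E} (hΩ : Ω ∈ 𝓝[K] y₀)
    (hY : ∀ y ∈ Ω, ContDiffWithinAt ℝ 1 Y K y) :
    ∃ R > 0, ∃ Λ ≥ 1, (∀ y ∈ K, ‖y - y₀‖ ≤ R → y ∈ Ω ∧ ‖fderivWithin ℝ Y K y‖ ≤ Λ ∧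
        HasFDerivWithinAt Y (fderivWithin ℝ Y K y) K y) ∧
      UniformContinuousOn (fderivWithin ℝ Y K) (K ∩ Metric.closedBall y₀ R) ∧
      ∀ a ∈ K, ∀ b ∈ K, ‖a - y₀‖ ≤ R → ‖b - y₀‖ ≤ R → ‖Y a - Y b‖ ≤ Λ * ‖a - b‖ := by
  have : ProperSpace E := FiniteDimensional.proper_real E
  obtain ⟨R', hR', hsub⟩ := Metric.mem_nhdsWithin_iff.1 hΩ
  set R := R' / 2
  have hR : 0 < R := by positivity
  have hmem : ∀ y ∈ K, ‖y - y₀‖ ≤ R → y ∈ Ω := fun y hy hyR =>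
    hsub ⟨by rw [Metric.mem_ball, dist_eq_norm]; exact hyR.trans_lt (half_lt_self hR'), hy⟩
  have hmem' : ∀ y ∈ K ∩ Metric.closedBall y₀ R, y ∈ Ω := fun y hy =>
    hmem y hy.1 (by simpa [dist_eq_norm] using hy.2)
  have hcont : ContinuousOn (fderivWithin ℝ Y K) (K ∩ Metric.closedBall y₀ R) := fun y hy =>
    ((hY y (hmem' y hy)).fderivWithin_right hKu (m := 0) (by simp) hy.1).continuousWithinAt.mono
      inter_subset_left
  have hcomp : IsCompact (K ∩ Metric.closedBall y₀ R) :=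
    (isCompact_closedBall y₀ R).inter_left hKc
  obtain ⟨Λ, hΛ⟩ := hcomp.exists_bound_of_continuousOn hcont
  have hder : ∀ y ∈ K ∩ Metric.closedBall y₀ R,
      HasFDerivWithinAt Y (fderivWithin ℝ Y K y) K y := fun y hy =>
    ((hY y (hmem' y hy)).differentiableWithinAt (by simp)).hasFDerivWithinAt
  refine ⟨R, hR, max Λ 1, le_max_right _ _, fun y hy hyR => ?_,
    hcomp.uniformContinuousOn_of_continuous hcont, fun a ha b hb haR hbR => ?_⟩
  · have hy' : y ∈ K ∩ Metric.closedBall y₀ R := ⟨hy, by simpa [dist_eq_norm] using hyR⟩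
    exact ⟨hmem y hy hyR, (hΛ y hy').trans (le_max_left _ _), hder y hy'⟩
  · exact (hK.inter (convex_closedBall y₀ R)).norm_image_sub_le_of_norm_hasFDerivWithin_le
      (fun y hy => (hder y hy).mono inter_subset_left)
      (fun y hy => (hΛ y hy).trans (le_max_left _ _))
      ⟨hb, by simpa [dist_eq_norm] using hbR⟩ ⟨ha, by simpa [dist_eq_norm] using haR⟩

/-- Solutions of `c' = Y c` depend differentiably on the initial value, and the derivative solves
the variational equation: the difference quotient is an approximate solution of that equation. -/
lemma hasFDerivWithinAt_of_variational {K Z : Set E} (hK : Convex ℝ K) {Y : E → E} {y₀ z₀ : E}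
    {R Λ ε : ℝ} (hΛ : 1 ≤ Λ) (hΛε : Λ * ε ≤ 1)
    (hder : ∀ y ∈ K, ‖y - y₀‖ ≤ R → ‖fderivWithin ℝ Y K y‖ ≤ Λ ∧
      HasFDerivWithinAt Y (fderivWithin ℝ Y K y) K y)
    (hunif : UniformContinuousOn (fderivWithin ℝ Y K) (K ∩ Metric.closedBall y₀ R))
    (hlip : ∀ a ∈ K, ∀ b ∈ K, ‖a - y₀‖ ≤ R → ‖b - y₀‖ ≤ R → ‖Y a - Y b‖ ≤ Λ * ‖a - b‖)
    {α : E → ℝ → E} (hα0 : ∀ z ∈ Z, α z 0 = z)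
    (hα : ∀ z ∈ Z, ∀ t, |t| < ε → HasDerivAt (α z) (Y (α z t)) t)
    (hαK : ∀ z ∈ Z, ∀ t, |t| < ε → α z t ∈ K ∧ ‖α z t - y₀‖ ≤ R) (hz₀ : z₀ ∈ Z)
    {A : ℝ → E →L[ℝ] E} (hA0 : A 0 = ContinuousLinearMap.id ℝ E)
    (hA : ∀ t, |t| < ε → HasDerivAt A ((fderivWithin ℝ Y K (α z₀ t)).comp (A t)) t)
    {t : ℝ} (ht : |t| < ε) : HasFDerivWithinAt (fun z => α z t) (A t) Z z₀ := by
  have hdist : ∀ z ∈ Z, ∀ s, |s| < ε → ‖α z s - α z₀ s‖ ≤ 3 * ‖z - z₀‖ := by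
    intro z hz s hs
    have := norm_le_of_norm_deriv_le (f := fun s => α z s - α z₀ s)
      (f' := fun s => Y (α z s) - Y (α z₀ s)) hΛ hΛε le_rfl
      (fun r hr => (hα z hz r hr).sub (hα z₀ hz₀ r hr))
      (fun r hr => by
        rw [add_zero]
        exact hlip _ (hαK z hz r hr).1 _ (hαK z₀ hz₀ r hr).1 (hαK z hz r hr).2
          (hαK z₀ hz₀ r hr).2) hs
    simpa [hα0 z hz, hα0 z₀ hz₀] using this
  refine HasFDerivWithinAt.of_isLittleO (Asymptotics.isLittleO_iff.2 fun c hc => ?_)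
  obtain ⟨δ, hδ, hδ'⟩ := Metric.uniformContinuousOn_iff.1 hunif (c / 6) (by positivity)
  have hnear : ∀ᶠ z in 𝓝[Z] z₀, ‖z - z₀‖ < δ / 3 := by
    filter_upwards [mem_nhdsWithin_of_mem_nhds (Metric.ball_mem_nhds z₀ (by positivity : 0 < δ / 3))]
      with z hz
    simpa [dist_eq_norm] using hz
  filter_upwards [hnear, self_mem_nhdsWithin] with z hzδ hz
  have hrem : ∀ s, |s| < ε → ‖Y (α z s) - Y (α z₀ s) -
      fderivWithin ℝ Y K (α z₀ s) (α z s - α z₀ s)‖ ≤ c / 6 * (3 * ‖z - z₀‖) := by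
    intro s hs
    obtain ⟨ha, ha'⟩ := hαK z hz s hs
    obtain ⟨hb, hb'⟩ := hαK z₀ hz₀ s hs
    have hab := hdist z hz s hs
    have hconv : Convex ℝ ((K ∩ Metric.closedBall y₀ R) ∩ Metric.ball (α z₀ s) δ) :=
      (hK.inter (convex_closedBall _ _)).inter (convex_ball _ _)
    have hmb : α z₀ s ∈ K ∩ Metric.closedBall y₀ R := ⟨hb, by simpa [dist_eq_norm] using hb'⟩
    have := hconv.norm_image_sub_le_of_norm_hasFDerivWithin_le' (f := Y)
      (φ := fderivWithin ℝ Y K (α z₀ s)) (C := c / 6)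
      (fun y hy => (hder y hy.1.1 (by simpa [dist_eq_norm] using hy.1.2)).2.mono
        (inter_subset_left.trans inter_subset_left))
      (fun y hy => by
        rw [← dist_eq_norm]
        exact (hδ' y hy.1 _ hmb hy.2).le)
      (x := α z₀ s) (y := α z s)
      ⟨hmb, Metric.mem_ball_self hδ⟩
      ⟨⟨ha, by simpa [dist_eq_norm] using ha'⟩, by
        rw [Metric.mem_ball, dist_eq_norm]; linarith⟩
    exact this.trans (mul_le_mul_of_nonneg_left hab (by positivity))
  have hfin := norm_le_of_norm_deriv_le (f := fun s => α z s - α z₀ s - A s (z - z₀))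
    (f' := fun s => Y (α z s) - Y (α z₀ s) - fderivWithin ℝ Y K (α z₀ s) (A s (z - z₀)))
    (δ := c / 6 * (3 * ‖z - z₀‖)) hΛ hΛε (by positivity)
    (fun r hr => ((hα z hz r hr).sub (hα z₀ hz₀ r hr)).sub
      ((hA r hr).clm_apply (hasDerivAt_const r (z - z₀)) |>.congr_deriv (by simp)))
    (fun r hr => by
      have e : Y (α z r) - Y (α z₀ r) - fderivWithin ℝ Y K (α z₀ r) (A r (z - z₀)) =
          fderivWithin ℝ Y K (α z₀ r) (α z r - α z₀ r - A r (z - z₀)) +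
          (Y (α z r) - Y (α z₀ r) - fderivWithin ℝ Y K (α z₀ r) (α z r - α z₀ r)) := by
        simp only [map_sub]; abel
      rw [e]
      refine (norm_add_le _ _).trans (add_le_add ?_ (hrem r hr))
      obtain ⟨hb, hb'⟩ := hαK z₀ hz₀ r hr
      exact ((fderivWithin ℝ Y K (α z₀ r)).le_opNorm _).trans
        (mul_le_mul_of_nonneg_right (hder _ hb hb').1 (norm_nonneg _))) ht
  simp only [hα0 z hz, hα0 z₀ hz₀, hA0, ContinuousLinearMap.id_apply, sub_self, norm_zero,
    mul_zero, zero_add] at hfin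
  have ht1 : |t| ≤ 1 := by nlinarith
  calc _ ≤ 2 * (c / 6 * (3 * ‖z - z₀‖)) * |t| := hfin
    _ ≤ 2 * (c / 6 * (3 * ‖z - z₀‖)) * 1 := by gcongr
    _ = c * ‖z - z₀‖ := by ring

/-- A `C¹` vector field on a half-space that is tangent to the boundary has a local flow there,
which is differentiable in the initial value; its derivative solves the variational equation. -/
theorem exists_local_flow [FiniteDimensional ℝ E] (ℓ : E →L[ℝ] ℝ) {K Ω : Set E}
    (hKℓ : K = {v | 0 ≤ ℓ v}) (hKu : UniqueDiffOn ℝ K) {Y : E → E} {y₀ : E} (hy₀ : y₀ ∈ K)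
    (hΩ : Ω ∈ 𝓝[K] y₀) (hY : ∀ y ∈ Ω, ContDiffWithinAt ℝ 1 Y K y)
    (htan : ∀ y ∈ Ω, y ∈ K → ℓ y = 0 → ℓ (Y y) = 0) :
    ∃ ρ > 0, ∃ ε > 0, ∃ (α : E → ℝ → E) (A : E → ℝ → E →L[ℝ] E),
      ∀ z ∈ K, ‖z - y₀‖ < ρ → α z 0 = z ∧ A z 0 = ContinuousLinearMap.id ℝ E ∧
        ∀ t, |t| < ε → α z t ∈ Ω ∧ α z t ∈ K ∧ HasDerivAt (α z) (Y (α z t)) t ∧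
          HasDerivAt (A z) ((fderivWithin ℝ Y K (α z t)).comp (A z t)) t ∧
          HasFDerivWithinAt (fun z => α z t) (A z t) K z ∧ ‖A z t‖ ≤ 3 := by
  have : CompleteSpace E := FiniteDimensional.complete ℝ E
  have hK : Convex ℝ K := by
    rw [hKℓ]; exact convex_halfSpace_ge ℓ.isLinear 0
  have hKc : IsClosed K := by
    rw [hKℓ]; exact isClosed_le continuous_const ℓ.continuous
  have hmemK : ∀ y, y ∈ K ↔ 0 ≤ ℓ y := fun y => by rw [hKℓ]; rfl
  obtain ⟨R, hR, Λ, hΛ, hder, hunif, hlip⟩ := exists_bound_fderivWithin hK hKc hKu hΩ hY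
  obtain ⟨r, κ, hκ, hrlip, hrK, hrid, hrbd⟩ := exists_halfSpace_retraction ℓ
  have hry₀ : r y₀ = y₀ := hrid _ ((hmemK _).1 hy₀)
  -- A globally Lipschitz vector field that agrees with `Y ∘ r` near `y₀`.
  obtain ⟨Ye, κe, hκe, hYe, hYeq⟩ : ∃ (Ye : E → E) (κe : ℝ), 1 ≤ κe ∧
      (∀ a b, ‖Ye a - Ye b‖ ≤ κe * ‖a - b‖) ∧
      ∀ y, ‖y - y₀‖ ≤ R / κ → Ye y = Y (r y) ∧ ‖r y - y₀‖ ≤ R := by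
    have h1 : LipschitzOnWith Λ.toNNReal Y (K ∩ Metric.closedBall y₀ R) := by
      refine LipschitzOnWith.of_dist_le_mul fun a ha b hb => ?_
      rw [dist_eq_norm, dist_eq_norm, Real.coe_toNNReal _ (by linarith)]
      exact hlip a ha.1 b hb.1 (by simpa [dist_eq_norm] using ha.2)
        (by simpa [dist_eq_norm] using hb.2)
    obtain ⟨g, hg, hgY⟩ := h1.extend_finite_dimension
    refine ⟨fun y => g (r y), max 1 ((lipschitzExtensionConstant E * Λ.toNNReal : NNReal) * κ),
      le_max_left _ _, fun a b => ?_, fun y hy => ?_⟩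
    · have h2 := hg.dist_le_mul (r a) (r b)
      rw [dist_eq_norm, dist_eq_norm] at h2
      refine h2.trans ((mul_le_mul_of_nonneg_left (hrlip a b) (NNReal.coe_nonneg _)).trans ?_)
      rw [← mul_assoc]
      exact mul_le_mul_of_nonneg_right (le_max_right _ _) (norm_nonneg _)
    · have h3 : ‖r y - y₀‖ ≤ R := by
        have := hrlip y y₀
        rw [hry₀] at this
        rw [le_div_iff₀ (by positivity)] at hy
        linarith
      exact ⟨(hgY ⟨(hmemK _).2 (hrK y), by simpa [dist_eq_norm] using h3⟩).symm, h3⟩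
  obtain ⟨ε₀, hε₀, α, hα⟩ := exists_flow_of_lipschitz hκe hYe y₀
  set D := ‖Ye y₀‖ + 1
  have hD : 0 < D := by positivity
  set R' := R / κ with hR'
  have hR'pos : 0 < R' := by positivity
  have hR'R : R' ≤ R := div_le_self hR.le hκ
  set ε := min (min (ε₀ / 2) (1 / κe)) (min (1 / (2 * Λ)) (R' / (8 * D))) with hεdef
  have hε : 0 < ε := by positivity
  have hεε₀ : ε < ε₀ := lt_of_le_of_lt ((min_le_left _ _).trans (min_le_left _ _)) (half_lt_self hε₀)
  have hεκ : κe * ε ≤ 1 := by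
    have : ε ≤ 1 / κe := (min_le_left _ _).trans (min_le_right _ _)
    rw [le_div_iff₀ (by positivity)] at this; linarith
  have hεΛ : 2 * Λ * ε ≤ 1 := by
    have : ε ≤ 1 / (2 * Λ) := (min_le_right _ _).trans (min_le_left _ _)
    rw [le_div_iff₀ (by positivity)] at this; linarith
  have hεD : ε * (8 * D) ≤ R' := by
    have : ε ≤ R' / (8 * D) := (min_le_right _ _).trans (min_le_right _ _)
    rwa [le_div_iff₀ (by positivity)] at this
  set ρ := min 1 (R' / 6)
  have hρ : 0 < ρ := by positivity
  have hclose : ∀ z, ‖z - y₀‖ < ρ → ∀ t, |t| < ε → ‖α z t - y₀‖ ≤ R' := by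
    intro z hz t ht
    obtain ⟨h0, hd⟩ := hα z (hz.le.trans (min_le_left _ _))
    have h1 := norm_le_of_norm_deriv_le (f := fun s => α z s - y₀) (f' := fun s => Ye (α z s))
      (δ := ‖Ye y₀‖) hκe hεκ (norm_nonneg _)
      (fun s hs => (hd s (hs.trans hεε₀)).sub_const _)
      (fun s _ => by
        have h2 : ‖Ye (α z s)‖ ≤ ‖Ye y₀‖ + ‖Ye (α z s) - Ye y₀‖ := norm_le_insert' _ _
        linarith [hYe (α z s) y₀]) ht
    simp only [h0] at h1
    have h3 : ‖z - y₀‖ < R' / 6 := hz.trans_le (min_le_right _ _)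
    have h4 : ‖Ye y₀‖ * |t| ≤ D * ε :=
      mul_le_mul (le_add_of_nonneg_right zero_le_one) ht.le (abs_nonneg _) hD.le
    nlinarith
  have hstay : ∀ z ∈ K, ‖z - y₀‖ < ρ → ∀ t, |t| < ε → α z t ∈ K := by
    intro z hzK hz t ht
    obtain ⟨h0, hd⟩ := hα z (hz.le.trans (min_le_left _ _))
    refine (hmemK _).2 (nonneg_of_tangent ℓ (by rw [h0]; exact (hmemK z).1 hzK)
      (fun s hs => hd s (hs.trans hεε₀)) (fun s hs hneg => ?_) ht)
    obtain ⟨e1, e2⟩ := hYeq _ (hclose z hz s hs)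
    have hmem := (hmemK _).2 (hrK (α z s))
    rw [e1]
    exact htan _ (hder _ hmem e2).1 hmem (hrbd _ hneg)
  have hsol : ∀ z ∈ K, ‖z - y₀‖ < ρ → ∀ t, |t| < ε → HasDerivAt (α z) (Y (α z t)) t := by
    intro z hzK hz t ht
    have h1 := (hα z (hz.le.trans (min_le_left _ _))).2 t (ht.trans hεε₀)
    rwa [(hYeq _ (hclose z hz t ht)).1, hrid _ ((hmemK _).1 (hstay z hzK hz t ht))] at h1
  have hhalf : ∀ t ∈ Icc (-(ε / 2)) (ε / 2), |t| < ε := fun t ht =>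
    (abs_le.2 ht).trans_lt (half_lt_self hε)
  have hA : ∀ z, ∃ A : ℝ → E →L[ℝ] E, z ∈ K → ‖z - y₀‖ < ρ →
      A 0 = ContinuousLinearMap.id ℝ E ∧ ∀ t, |t| < ε / 2 →
        HasDerivAt A ((fderivWithin ℝ Y K (α z t)).comp (A t)) t := by
    intro z
    by_cases hz : z ∈ K ∧ ‖z - y₀‖ < ρ
    · have hmem : MapsTo (α z) (Icc (-(ε / 2)) (ε / 2)) (K ∩ Metric.closedBall y₀ R) :=
        fun t ht => ⟨hstay z hz.1 hz.2 t (hhalf t ht), by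
          simpa [dist_eq_norm] using (hclose z hz.2 t (hhalf t ht)).trans hR'R⟩
      obtain ⟨A, hA⟩ := exists_fundamental_solution (B := fun t => fderivWithin ℝ Y K (α z t))
        (ε := ε / 2) hΛ (by positivity) (by nlinarith)
        (hunif.continuousOn.comp
          (fun t ht => (hsol z hz.1 hz.2 t (hhalf t ht)).continuousAt.continuousWithinAt) hmem)
        (fun t ht => (hder _ (hmem ht).1 (by simpa [dist_eq_norm] using (hmem ht).2)).2.1)
      exact ⟨A, fun _ _ => hA⟩
    · exact ⟨0, fun h1 h2 => absurd ⟨h1, h2⟩ hz⟩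
  choose A hA using hA
  refine ⟨ρ, hρ, ε / 2, by positivity, α, A, fun z hzK hz => ?_⟩
  obtain ⟨hA0, hA'⟩ := hA z hzK hz
  refine ⟨(hα z (hz.le.trans (min_le_left _ _))).1, hA0, fun t ht => ?_⟩
  have hlt : ∀ {s : ℝ}, |s| < ε / 2 → |s| < ε := fun hs => hs.trans (half_lt_self hε)
  refine ⟨(hder _ (hstay z hzK hz t (hlt ht)) ((hclose z hz t (hlt ht)).trans hR'R)).1,
    hstay z hzK hz t (hlt ht), hsol z hzK hz t (hlt ht), hA' t ht, ?_, ?_⟩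
  · have hZ : K ∩ Metric.ball y₀ ρ ∈ 𝓝[K] z :=
      inter_mem_nhdsWithin K (Metric.isOpen_ball.mem_nhds (by simpa [dist_eq_norm] using hz))
    have hb : ∀ z ∈ K ∩ Metric.ball y₀ ρ, ‖z - y₀‖ < ρ := fun z hz => by
      simpa [dist_eq_norm] using hz.2
    refine (hasFDerivWithinAt_of_variational (Z := K ∩ Metric.ball y₀ ρ) hK hΛ
      (ε := ε / 2) (by nlinarith) (fun y hy hyR => (hder y hy hyR).2) hunif hlip
      (fun z hz => (hα z ((hb z hz).le.trans (min_le_left _ _))).1)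
      (fun z hz s hs => hsol z hz.1 (hb z hz) s (hlt hs))
      (fun z hz s hs => ⟨hstay z hz.1 (hb z hz) s (hlt hs),
        (hclose z (hb z hz) s (hlt hs)).trans hR'R⟩)
      (mem_of_mem_nhdsWithin hzK hZ) hA0 hA' ht).mono_of_mem_nhdsWithin hZ
  · have h1 := norm_le_of_norm_deriv_le (f := A z) (δ := 0) (K := Λ) (ε := ε / 2) hΛ (by nlinarith)
      le_rfl hA' (fun s hs => by
        rw [add_zero]
        exact (ContinuousLinearMap.opNorm_comp_le _ _).trans (mul_le_mul_of_nonneg_right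
          (hder _ (hstay z hzK hz s (hlt hs)) ((hclose z hz s (hlt hs)).trans hR'R)).2.1
          (norm_nonneg _))) ht
    have h2 : ‖A z 0‖ ≤ 1 := by rw [hA0]; exact ContinuousLinearMap.norm_id_le
    linarith

end LocalFlow

/-! ### Closed 2-forms are preserved by their Hamiltonian flows -/

section LieDerivative

variable {E : Type*} [NormedAddCommGroup E] [NormedSpace ℝ E]

-- Shortcuts for instance problems whose search is otherwise very slow.
noncomputable local instance bilinAddCommGroup : AddCommGroup (E →L[ℝ] E →L[ℝ] ℝ) := inferInstance
noncomputable local instance bilinNormedAddCommGroup :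
    NormedAddCommGroup (E →L[ℝ] E →L[ℝ] ℝ) := inferInstance
noncomputable local instance bilinNormedSpace : NormedSpace ℝ (E →L[ℝ] E →L[ℝ] ℝ) := inferInstance

variable (E) in
/-- The bilinear form `(u, v) ↦ w ![u, v]` of an alternating 2-form `w`, as a continuous linear
map in `w`. -/
noncomputable def altToBilin : (E [⋀^Fin 2]→L[ℝ] ℝ) →L[ℝ] E →L[ℝ] E →L[ℝ] ℝ :=
  ((ContinuousLinearMap.compL ℝ E (ContinuousMultilinearMap ℝ (fun _ : Fin 1 => E) ℝ) (E →L[ℝ] ℝ)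
      (continuousMultilinearCurryFin1 ℝ E ℝ).toContinuousLinearEquiv.toContinuousLinearMap).comp
    (continuousMultilinearCurryLeftEquiv ℝ
      (fun _ : Fin 2 => E) ℝ).toContinuousLinearEquiv.toContinuousLinearMap).comp
    (ContinuousAlternatingMap.toContinuousMultilinearMapCLM ℝ)

@[simp]
lemma altToBilin_apply (w : E [⋀^Fin 2]→L[ℝ] ℝ) (u v : E) : altToBilin E w u v = w ![u, v] := by
  simp only [altToBilin, ContinuousLinearMap.comp_apply, ContinuousLinearMap.compL_apply]
  change w (Fin.cons u (Fin.snoc 0 v)) = _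
  congr 1
  funext i
  fin_cases i <;> rfl

lemma hasFDerivAt_altToBilin (w : E [⋀^Fin 2]→L[ℝ] ℝ) :
    HasFDerivAt (fun w => altToBilin E w) (altToBilin E) w :=
  ContinuousLinearMap.hasFDerivAt (𝕜 := ℝ) (E := E [⋀^Fin 2]→L[ℝ] ℝ) (F := E →L[ℝ] E →L[ℝ] ℝ) _

lemma contDiff_altToBilin {n : ℕ∞ω} : ContDiff ℝ n (fun w => altToBilin E w) :=
  ContinuousLinearMap.contDiff (𝕜 := ℝ) (E := E [⋀^Fin 2]→L[ℝ] ℝ) (F := E →L[ℝ] E →L[ℝ] ℝ) _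

lemma alt_self (w : E [⋀^Fin 2]→L[ℝ] ℝ) (u : E) : w ![u, u] = 0 :=
  w.map_eq_zero_of_eq ![u, u] (i := 0) (j := 1) rfl (by simp)

lemma alt_swap (w : E [⋀^Fin 2]→L[ℝ] ℝ) (u v : E) : w ![u, v] = -w ![v, u] := by
  have h := alt_self w (u + v)
  simp only [← altToBilin_apply, map_add, add_apply] at h
  simp only [altToBilin_apply, alt_self] at h
  linarith

/-- The Lie derivative of a closed 2-form `W` along a vector field `Y` for which `W (Y, ·)` is
exact vanishes. -/
lemma lieDeriv_eq_zero {K : Set E} {y : E} (hKu : UniqueDiffOn ℝ K) (hy : y ∈ K)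
    (hyc : y ∈ closure (interior K)) {W : E → E [⋀^Fin 2]→L[ℝ] ℝ} {Y : E → E} {F : E → ℝ}
    (hW : DifferentiableWithinAt ℝ W K y) (hY : DifferentiableWithinAt ℝ Y K y)
    (hF : ContDiffWithinAt ℝ 2 F K y)
    (hWY : ∀ᶠ x in 𝓝[K] y, ∀ u, W x ![Y x, u] = fderivWithin ℝ F K x u)
    (hclosed : extDerivWithin W K y = 0) (u v : E) :
    fderivWithin ℝ W K y (Y y) ![u, v] + W y ![fderivWithin ℝ Y K y u, v] +
      W y ![u, fderivWithin ℝ Y K y v] = 0 := by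
  have hyu := hKu y hy
  have hd : ∀ w a, fderivWithin ℝ W K y w ![Y y, a] + W y ![fderivWithin ℝ Y K y w, a] =
      fderivWithin ℝ (fderivWithin ℝ F K) K y w a := by
    intro w a
    have h1 : HasFDerivWithinAt (fun x => altToBilin E (W x))
        ((altToBilin E).comp (fderivWithin ℝ W K y)) K y :=
      (hasFDerivAt_altToBilin _).comp_hasFDerivWithinAt y hW.hasFDerivWithinAt
    have h2 := (h1.clm_apply hY.hasFDerivWithinAt).clm_apply (hasFDerivWithinAt_const a y K)
    have h3 := ((hF.fderivWithin_right hKu (m := 1) (by norm_num) hy).differentiableWithinAt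
      (by simp)).hasFDerivWithinAt.clm_apply (hasFDerivWithinAt_const a y K)
    have h4 := h2.congr_of_eventuallyEq (f₁ := fun x => fderivWithin ℝ F K x a)
      (by
        filter_upwards [hWY] with x hx
        rw [altToBilin_apply, hx])
      (by rw [altToBilin_apply, hWY.self_of_nhdsWithin hy])
    have h5 := congrArg (fun L => L w) (hyu.eq h4 h3)
    simpa [add_comm] using h5
  have hs : ∀ a b, fderivWithin ℝ (fderivWithin ℝ F K) K y a b =
      fderivWithin ℝ (fderivWithin ℝ F K) K y b a :=
    hF.isSymmSndFDerivWithinAt (by simp) hKu hyc hy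
  have hc : fderivWithin ℝ W K y (Y y) ![u, v] - fderivWithin ℝ W K y u ![Y y, v] +
      fderivWithin ℝ W K y v ![Y y, u] = 0 := by
    have h1 := congrArg (fun T => T ![Y y, u, v]) hclosed
    simp only [extDerivWithin, ContinuousAlternatingMap.alternatizeUncurryFin_apply] at h1
    erw [Fin.sum_univ_three] at h1
    have e0 : (0 : Fin 3).removeNth ![Y y, u, v] = ![u, v] := by
      funext i; fin_cases i <;> rfl
    have e1 : (1 : Fin 3).removeNth ![Y y, u, v] = ![Y y, v] := by
      funext i; fin_cases i <;> rfl
    have e2 : (2 : Fin 3).removeNth ![Y y, u, v] = ![Y y, u] := by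
      funext i; fin_cases i <;> rfl
    rw [e0, e1, e2] at h1
    simpa [sub_eq_add_neg] using h1
  have h1 := hd u v
  have h2 := hd v u
  have h3 := hs u v
  have h4 := alt_swap (W y) u (fderivWithin ℝ Y K y v)
  linarith

/-- Along a solution of `c' = Y c`, solutions of the variational equation preserve a closed 2-form
`W` for which `W (Y, ·)` is exact. -/
lemma hasDerivAt_form_variational {K : Set E} (hKu : UniqueDiffOn ℝ K)
    (hKc : K ⊆ closure (interior K)) {W : E → E [⋀^Fin 2]→L[ℝ] ℝ} {Y : E → E} {F : E → ℝ}
    {c : ℝ → E} {A : ℝ → E →L[ℝ] E} {t : ℝ} (hcK : ∀ᶠ s in 𝓝 t, c s ∈ K)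
    (hc : HasDerivAt c (Y (c t)) t)
    (hA : HasDerivAt A ((fderivWithin ℝ Y K (c t)).comp (A t)) t)
    (hW : DifferentiableWithinAt ℝ W K (c t)) (hY : DifferentiableWithinAt ℝ Y K (c t))
    (hF : ContDiffWithinAt ℝ 2 F K (c t))
    (hWY : ∀ᶠ x in 𝓝[K] (c t), ∀ u, W x ![Y x, u] = fderivWithin ℝ F K x u)
    (hclosed : extDerivWithin W K (c t) = 0) (u v : E) :
    HasDerivAt (fun s => W (c s) ![A s u, A s v]) 0 t := by
  have hy := hcK.self_of_nhds
  have h1 : HasFDerivWithinAt (fun x => altToBilin E (W x))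
      ((altToBilin E).comp (fderivWithin ℝ W K (c t))) K (c t) :=
    (hasFDerivAt_altToBilin _).comp_hasFDerivWithinAt _ hW.hasFDerivWithinAt
  have h2 : HasDerivAt (fun s => altToBilin E (W (c s)))
      (altToBilin E (fderivWithin ℝ W K (c t) (Y (c t)))) t := by
    have := h1.comp_hasDerivWithinAt (s := c ⁻¹' K) t hc.hasDerivWithinAt (fun s hs => hs)
    exact this.hasDerivAt hcK
  have hAu : ∀ w, HasDerivAt (fun s => A s w) (fderivWithin ℝ Y K (c t) (A t w)) t := fun w => by
    simpa using hA.clm_apply (hasDerivAt_const t w)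
  have h3 := (h2.clm_apply (hAu u)).clm_apply (hAu v)
  simp only [altToBilin_apply, add_apply] at h3
  exact h3.congr_deriv
    (lieDeriv_eq_zero hKu hy (hKc hy) hW hY hF hWY hclosed (A t u) (A t v))

end LieDerivative

/-! ### The Hamiltonian vector field in a chart -/

section ChartCalculus

variable {E : Type*} [NormedAddCommGroup E] [NormedSpace ℝ E]
  {HM : Type*} [TopologicalSpace HM] {I : ModelWithCorners ℝ E HM}
  {M : Type*} [TopologicalSpace M] [ChartedSpace HM M]

variable (I) in
/-- The coordinates of tangent vectors at `x` in the extended chart at `x₀`. -/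
noncomputable def coordMap (x₀ x : M) : TangentSpace I x →L[ℝ] E :=
  mfderiv I 𝓘(ℝ, E) (extChartAt I x₀) x

variable (I) in
/-- The tangent vector at the point with coordinates `y` that has given coordinates in the extended
chart at `x₀`. -/
noncomputable def coordInv (x₀ : M) (y : E) : E →L[ℝ] TangentSpace I ((extChartAt I x₀).symm y) :=
  mfderivWithin 𝓘(ℝ, E) I (extChartAt I x₀).symm (range I) y

lemma chartForm_apply (σ : ∀ p : M, (TangentSpace I p) [⋀^Fin 2]→L[ℝ] ℝ) (x₀ : M) (y u v : E) :
    chartForm I σ x₀ y ![u, v] =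
      σ ((extChartAt I x₀).symm y) ![coordInv I x₀ y u, coordInv I x₀ y v] := by
  change σ _ _ = σ _ _
  refine congrArg (σ ((extChartAt I x₀).symm y)) (funext fun i => ?_)
  fin_cases i <;> rfl

section

variable [IsManifold I 1 M] {x₀ : M} {y : E}

lemma coordMap_coordInv (hy : y ∈ (extChartAt I x₀).target) (u : E) :
    coordMap I x₀ ((extChartAt I x₀).symm y) (coordInv I x₀ y u) = u :=
  congrArg (fun L : E →L[ℝ] E => L u)
    (mfderiv_extChartAt_comp_mfderivWithin_extChartAt_symm hy)

lemma coordInv_coordMap (hy : y ∈ (extChartAt I x₀).target)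
    (v : TangentSpace I ((extChartAt I x₀).symm y)) :
    coordInv I x₀ y (coordMap I x₀ ((extChartAt I x₀).symm y) v) = v :=
  congrArg (fun L : TangentSpace I ((extChartAt I x₀).symm y) →L[ℝ]
      TangentSpace I ((extChartAt I x₀).symm y) => L v)
    (mfderivWithin_extChartAt_symm_comp_mfderiv_extChartAt hy)

lemma hasMFDerivAt_extChartAt' {x : M} (hx : x ∈ (extChartAt I x₀).source) :
    HasMFDerivAt I 𝓘(ℝ, E) (extChartAt I x₀) x (coordMap I x₀ x) :=
  (mdifferentiableAt_extChartAt (by rwa [extChartAt_source] at hx)).hasMFDerivAt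

lemma hasMFDerivWithinAt_extChartAt_symm (hy : y ∈ (extChartAt I x₀).target) :
    HasMFDerivWithinAt 𝓘(ℝ, E) I (extChartAt I x₀).symm (range I) y (coordInv I x₀ y) :=
  (mdifferentiableWithinAt_extChartAt_symm hy).hasMFDerivWithinAt

/-- A form that is nondegenerate at a point is nondegenerate in coordinates. -/
lemma SymplecticForm.chartForm_nondegenerate (σ : SymplecticForm I M)
    (hy : y ∈ (extChartAt I x₀).target) {u : E}
    (hu : ∀ v, chartForm I σ.form x₀ y ![u, v] = 0) : u = 0 := by
  have h1 : coordInv I x₀ y u = 0 := σ.nondegenerate _ _ fun v => by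
    have := hu (coordMap I x₀ _ v)
    rwa [chartForm_apply, coordInv_coordMap hy] at this
  rw [← coordMap_coordInv hy u, h1, map_zero]

end

lemma dH_eq_form [FiniteDimensional ℝ E] (σ : SymplecticForm I M) (H : M → ℝ) (p : M)
    (u : TangentSpace I p) : dH I H p u = σ.form p ![hamVF σ H p, u] :=
  (σ.existsUnique_dual p (dH I H p)).choose_spec.1 u

lemma SymplecticForm.form_self (σ : SymplecticForm I M) (p : M) (u : TangentSpace I p) :
    σ.form p ![u, u] = 0 :=
  (σ.form p).map_eq_zero_of_eq ![u, u] (i := 0) (j := 1) rfl (by simp)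

/-- The Hamiltonian vector field in the extended chart at `x₀`. -/
noncomputable def localVF [FiniteDimensional ℝ E] (σ : SymplecticForm I M) (H : M → ℝ) (x₀ : M)
    (y : E) : E :=
  coordMap I x₀ ((extChartAt I x₀).symm y) (hamVF σ H ((extChartAt I x₀).symm y))

variable {x₀ : M} {y : E} {H : M → ℝ}

lemma target_mem_nhdsWithin (hy : y ∈ (extChartAt I x₀).target) :
    (extChartAt I x₀).target ∈ 𝓝[range I] y :=
  extChartAt_target_mem_nhdsWithin_of_mem hy

lemma IsHamiltonian.mdifferentiableAt (hH : IsHamiltonian I H) (p : M) :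
    MDifferentiableAt I 𝓘(ℝ, ℝ) H p :=
  (hH.contMDiff p).mdifferentiableAt (by norm_num)

lemma SymplecticForm.contDiffWithinAt (σ : SymplecticForm I M)
    (hy : y ∈ (extChartAt I x₀).target) :
    ContDiffWithinAt ℝ ∞ (chartForm I σ.form x₀) (range I) y :=
  (σ.smooth x₀ y hy).mono_of_mem_nhdsWithin (target_mem_nhdsWithin hy)

variable [IsManifold I ∞ M]

lemma IsHamiltonian.contDiffWithinAt (hH : IsHamiltonian I H) (hy : y ∈ (extChartAt I x₀).target) :
    ContDiffWithinAt ℝ 2 (H ∘ (extChartAt I x₀).symm) (range I) y := by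
  have : IsManifold I 2 M := inferInstance
  have h1 : ContMDiffOn 𝓘(ℝ, E) 𝓘(ℝ, ℝ) 2 (H ∘ (extChartAt I x₀).symm) (extChartAt I x₀).target :=
    hH.contMDiff.comp_contMDiffOn (contMDiffOn_extChartAt_symm x₀)
  exact (h1.contDiffOn y hy).mono_of_mem_nhdsWithin (target_mem_nhdsWithin hy)

lemma IsHamiltonian.fderivWithin_eq (hH : IsHamiltonian I H)
    (hy : y ∈ (extChartAt I x₀).target) (u : E) :
    fderivWithin ℝ (H ∘ (extChartAt I x₀).symm) (range I) y u =
      dH I H ((extChartAt I x₀).symm y) (coordInv I x₀ y u) := by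
  have hu : UniqueDiffWithinAt ℝ (range I) y := I.uniqueDiffOn y (extChartAt_target_subset_range x₀ hy)
  have h1 : HasMFDerivWithinAt 𝓘(ℝ, E) 𝓘(ℝ, ℝ) (H ∘ (extChartAt I x₀).symm) (range I) y
      ((dH I H ((extChartAt I x₀).symm y)).comp (coordInv I x₀ y)) :=
    ((hH.mdifferentiableAt ((extChartAt I x₀).symm y)).hasMFDerivAt).comp_hasMFDerivWithinAt
      y (hasMFDerivWithinAt_extChartAt_symm (I := I) hy)
  have h2 : HasFDerivWithinAt (H ∘ (extChartAt I x₀).symm)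
      ((dH I H ((extChartAt I x₀).symm y)).comp (coordInv I x₀ y) : E →L[ℝ] ℝ) (range I) y :=
    hasMFDerivWithinAt_iff_hasFDerivWithinAt.1 h1
  rw [h2.fderivWithin hu]
  rfl

variable [FiniteDimensional ℝ E] (σ : SymplecticForm I M)

lemma chartForm_localVF (hH : IsHamiltonian I H) (hy : y ∈ (extChartAt I x₀).target) (u : E) :
    chartForm I σ.form x₀ y ![localVF σ H x₀ y, u] =
      fderivWithin ℝ (H ∘ (extChartAt I x₀).symm) (range I) y u := by
  rw [hH.fderivWithin_eq hy, dH_eq_form σ, chartForm_apply, localVF, coordInv_coordMap hy]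

/-- The Hamiltonian vector field is `C¹`: it solves a nondegenerate linear system with `C¹`
coefficients. -/
lemma contDiffWithinAt_localVF (hH : IsHamiltonian I H) (hy : y ∈ (extChartAt I x₀).target) :
    ContDiffWithinAt ℝ 1 (localVF σ H x₀) (range I) y := by
  have hyr := extChartAt_target_subset_range x₀ hy
  set B : E → E →L[ℝ] E →L[ℝ] ℝ := fun z => altToBilin E (chartForm I σ.form x₀ z) with hB
  have hequiv : ∀ z ∈ (extChartAt I x₀).target, ∃ e : E ≃L[ℝ] (E →L[ℝ] ℝ), (e : E →L[ℝ] E →L[ℝ] ℝ) = B z := by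
    intro z hz
    have hinj : Function.Injective (B z) := by
      rw [injective_iff_map_eq_zero]
      intro u hu
      refine σ.chartForm_nondegenerate hz fun v => ?_
      rw [← altToBilin_apply]
      exact congrArg (fun L : E →L[ℝ] ℝ => L v) hu
    have hdim : Module.finrank ℝ E = Module.finrank ℝ (E →L[ℝ] ℝ) := by
      rw [← Subspace.dual_finrank_eq (K := ℝ) (V := E)]
      exact LinearMap.toContinuousLinearMap.finrank_eq
    let e := (LinearEquiv.ofInjectiveOfFinrankEq (B z : E →ₗ[ℝ] E →L[ℝ] ℝ) hinj hdim).toContinuousLinearEquiv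
    exact ⟨e, by ext; rfl⟩
  have hBd : ContDiffWithinAt ℝ 1 B (range I) y :=
    contDiff_altToBilin.contDiffAt.comp_contDiffWithinAt y
      ((σ.contDiffWithinAt hy).of_le (by exact_mod_cast le_top))
  obtain ⟨e, he⟩ := hequiv y hy
  have hinv : ContDiffWithinAt ℝ 1 (fun z => ContinuousLinearMap.inverse (B z)) (range I) y := by
    have h1 := contDiffAt_map_inverse (n := 1) e
    rw [he] at h1
    exact h1.comp_contDiffWithinAt y hBd
  have hF := (hH.contDiffWithinAt hy).fderivWithin_right I.uniqueDiffOn (m := 1) (by norm_num) hyr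
  refine (hinv.clm_apply hF).congr_of_eventuallyEq_of_mem ?_ hyr
  filter_upwards [target_mem_nhdsWithin hy] with z hz
  obtain ⟨e', he'⟩ := hequiv z hz
  rw [← he', ContinuousLinearMap.inverse_equiv]
  change _ = e'.symm _
  rw [eq_comm, ContinuousLinearEquiv.symm_apply_eq]
  ext u
  rw [← chartForm_localVF σ hH hz, ← altToBilin_apply]
  exact congrArg (fun L : E →L[ℝ] E →L[ℝ] ℝ => L (localVF σ H x₀ z) u) he'.symm

end ChartCalculus

/-! ### Tangency of the Hamiltonian vector field to the boundary -/

section BoundaryTangency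

variable {E : Type*} [NormedAddCommGroup E] [NormedSpace ℝ E]
  {HM : Type*} [TopologicalSpace HM] {I : ModelWithCorners ℝ E HM}
  {M : Type*} [TopologicalSpace M] [ChartedSpace HM M] [IsManifold I ∞ M]
  {ℓ : E →L[ℝ] ℝ} {x₀ : M} {y : E} {H : M → ℝ}

lemma symm_mem_boundary (hI : range I = {v | 0 ≤ ℓ v}) (hℓ : ℓ ≠ 0)
    (hy : y ∈ (extChartAt I x₀).target) (h0 : ℓ y = 0) :
    (extChartAt I x₀).symm y ∈ I.boundary M := by
  have : IsManifold I 1 M := inferInstance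
  have hs : (extChartAt I x₀).symm y ∈ (chartAt HM x₀).source := by
    have := (extChartAt I x₀).map_target hy
    rwa [extChartAt_source] at this
  change I.IsBoundaryPoint _
  rw [ModelWithCorners.isBoundaryPoint_iff_of_mem_atlas (n := 1) one_ne_zero
    (chart_mem_atlas HM x₀) hs]
  change extChartAt I x₀ _ ∈ frontier (extChartAt I x₀).target
  rw [(extChartAt I x₀).right_inv hy]
  refine ⟨subset_closure hy, fun hint => ?_⟩
  obtain ⟨w, hw⟩ : ∃ w, ℓ w ≠ 0 := by
    by_contra! h
    exact hℓ (ContinuousLinearMap.ext h)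
  have hcont : Filter.Tendsto (fun s : ℝ => y - (s * ℓ w) • w) (𝓝 0) (𝓝 y) := by
    have : Continuous fun s : ℝ => y - (s * ℓ w) • w := by fun_prop
    simpa using this.tendsto 0
  have hev : ∀ᶠ s : ℝ in 𝓝[>] 0, y - (s * ℓ w) • w ∈ (extChartAt I x₀).target :=
    (hcont.mono_left nhdsWithin_le_nhds).eventually (mem_interior_iff_mem_nhds.1 hint)
  obtain ⟨s, hs, hs0⟩ := (hev.and self_mem_nhdsWithin).exists
  have h1 : y - (s * ℓ w) • w ∈ range I := extChartAt_target_subset_range x₀ hs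
  rw [hI, mem_ofPred] at h1
  simp only [map_sub, map_smul, smul_eq_mul, h0] at h1
  have : 0 < s * (ℓ w * ℓ w) := mul_pos hs0 (mul_self_pos.2 hw)
  nlinarith

/-- In boundary charts the derivative of a Hamiltonian vanishes on the directions tangent to the
boundary, because the Hamiltonian is constant on each boundary component. -/
lemma IsHamiltonian.fderivWithin_eq_zero_of_boundary (hI : range I = {v | 0 ≤ ℓ v}) (hℓ : ℓ ≠ 0)
    (hH : IsHamiltonian I H) (hy : y ∈ (extChartAt I x₀).target) (h0 : ℓ y = 0) {u : E}
    (hu : ℓ u = 0) :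
    fderivWithin ℝ (H ∘ (extChartAt I x₀).symm) (range I) y u = 0 := by
  have hline : ∀ s : ℝ, y + s • u ∈ range I := fun s => by
    rw [hI]; simp [h0, hu]
  have hcont : Continuous fun s : ℝ => y + s • u := by fun_prop
  have htend : Filter.Tendsto (fun s : ℝ => y + s • u) (𝓝 0) (𝓝[range I] y) := by
    refine tendsto_nhdsWithin_iff.2 ⟨by simpa using hcont.tendsto 0, .of_forall hline⟩
  obtain ⟨δ, hδ, hδt⟩ := Metric.eventually_nhds_iff_ball.1
    (htend.eventually (target_mem_nhdsWithin hy))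
  have himg : (fun s : ℝ => (extChartAt I x₀).symm (y + s • u)) '' Metric.ball 0 δ ⊆
      connectedComponentIn (I.boundary M) ((extChartAt I x₀).symm y) := by
    refine IsPreconnected.subset_connectedComponentIn ?_ ⟨0, Metric.mem_ball_self hδ, by simp⟩ ?_
    · refine (convex_ball (0 : ℝ) δ).isPreconnected.image _ fun s hs => ?_
      exact ((continuousOn_extChartAt_symm x₀).comp hcont.continuousOn hδt) s hs
    · rintro _ ⟨s, hs, rfl⟩
      exact symm_mem_boundary hI hℓ (hδt s hs) (by simp [h0, hu])
  have hconst : (fun s : ℝ => (H ∘ (extChartAt I x₀).symm) (y + s • u)) =ᶠ[𝓝 0]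
      fun _ => H ((extChartAt I x₀).symm y) := by
    filter_upwards [Metric.ball_mem_nhds (0 : ℝ) hδ] with s hs
    exact hH.const_boundary _ (symm_mem_boundary hI hℓ hy h0) _ (himg ⟨s, hs, rfl⟩)
  have hd : HasFDerivWithinAt (H ∘ (extChartAt I x₀).symm)
      (fderivWithin ℝ (H ∘ (extChartAt I x₀).symm) (range I) y) (range I) y :=
    ((hH.contDiffWithinAt hy).differentiableWithinAt (by norm_num)).hasFDerivWithinAt
  have hl : HasDerivAt (fun s : ℝ => y + s • u) u 0 := by
    simpa using ((hasDerivAt_id (0 : ℝ)).smul_const u).const_add y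
  have h1 : HasDerivAt (fun s : ℝ => (H ∘ (extChartAt I x₀).symm) (y + s • u))
      (fderivWithin ℝ (H ∘ (extChartAt I x₀).symm) (range I) y u) 0 := by
    rw [← hasDerivWithinAt_univ]
    have hd' : HasFDerivWithinAt (H ∘ (extChartAt I x₀).symm)
        (fderivWithin ℝ (H ∘ (extChartAt I x₀).symm) (range I) y) (range I)
        (y + (0 : ℝ) • u) := by
      simpa using hd
    exact hd'.comp_hasDerivWithinAt (0 : ℝ) hl.hasDerivWithinAt fun s _ => hline s
  exact h1.unique ((hasDerivAt_const (0 : ℝ) _).congr_of_eventuallyEq hconst)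

variable [FiniteDimensional ℝ E] (σ : SymplecticForm I M)

/-- The Hamiltonian vector field is tangent to the boundary: if it were transverse at a boundary
point, `dH` would vanish on the boundary directions and on the field itself, hence altogether. -/
lemma localVF_tangent (hI : range I = {v | 0 ≤ ℓ v}) (hH : IsHamiltonian I H)
    (hy : y ∈ (extChartAt I x₀).target) (h0 : ℓ y = 0) : ℓ (localVF σ H x₀ y) = 0 := by
  by_contra hne
  have hℓ : ℓ ≠ 0 := fun h => hne (by simp [h])
  refine hne ?_
  suffices h : localVF σ H x₀ y = 0 by rw [h, map_zero]
  refine σ.chartForm_nondegenerate hy fun u => ?_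
  rw [chartForm_localVF σ hH hy]
  set Y := localVF σ H x₀ y with hY
  have h1 : fderivWithin ℝ (H ∘ (extChartAt I x₀).symm) (range I) y Y = 0 := by
    rw [← chartForm_localVF σ hH hy, chartForm_apply]
    exact σ.form_self _ _
  have h2 := hH.fderivWithin_eq_zero_of_boundary hI hℓ hy h0 (u := u - (ℓ u / ℓ Y) • Y)
    (by simp [hne])
  rwa [map_sub, map_smul, h1, smul_zero, sub_zero] at h2

/-! ### Integral curves in charts -/

lemma hasDerivAt_extChartAt_comp {γ : ℝ → M} {t : ℝ}
    (hγ : HasMFDerivAt 𝓘(ℝ, ℝ) I γ t ((1 : ℝ →L[ℝ] ℝ).smulRight (hamVF σ H (γ t))))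
    (hs : γ t ∈ (extChartAt I x₀).source) :
    HasDerivAt (extChartAt I x₀ ∘ γ) (localVF σ H x₀ (extChartAt I x₀ (γ t))) t := by
  have : IsManifold I 1 M := inferInstance
  have h1 : HasMFDerivAt 𝓘(ℝ, ℝ) 𝓘(ℝ, E) (extChartAt I x₀ ∘ γ) t
      ((coordMap I x₀ (γ t)).comp ((1 : ℝ →L[ℝ] ℝ).smulRight (hamVF σ H (γ t)))) :=
    (hasMFDerivAt_extChartAt' hs).comp t hγ
  have h2 : HasFDerivAt (extChartAt I x₀ ∘ γ)
      ((coordMap I x₀ (γ t)).comp ((1 : ℝ →L[ℝ] ℝ).smulRight (hamVF σ H (γ t))) : ℝ →L[ℝ] E) t :=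
    hasMFDerivAt_iff_hasFDerivAt.1 h1
  have h3 := h2.hasDerivAt
  rw [localVF, (extChartAt I x₀).left_inv hs]
  convert h3 using 1
  change _ = coordMap I x₀ (γ t) ((1 : ℝ) • _)
  rw [one_smul]

lemma hasMFDerivAt_extChartAt_symm_comp {c : ℝ → E} {t : ℝ}
    (hc : HasDerivAt c (localVF σ H x₀ (c t)) t)
    (hct : ∀ᶠ s in 𝓝 t, c s ∈ (extChartAt I x₀).target) :
    HasMFDerivAt 𝓘(ℝ, ℝ) I ((extChartAt I x₀).symm ∘ c) t
      ((1 : ℝ →L[ℝ] ℝ).smulRight (hamVF σ H ((extChartAt I x₀).symm (c t)))) := by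
  have : IsManifold I 1 M := inferInstance
  have hy := hct.self_of_nhds
  have h1 : HasMFDerivWithinAt 𝓘(ℝ, ℝ) 𝓘(ℝ, E) c (c ⁻¹' range I) t
      ((1 : ℝ →L[ℝ] ℝ).smulRight (localVF σ H x₀ (c t)) : ℝ →L[ℝ] E) :=
    (hasMFDerivAt_iff_hasFDerivAt.2 hc.hasFDerivAt).hasMFDerivWithinAt
  have h2 := ((hasMFDerivWithinAt_extChartAt_symm (I := I) hy).comp t h1 subset_rfl).hasMFDerivAt
    (hct.mono fun s hs => extChartAt_target_subset_range x₀ hs)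
  have heq : (1 : ℝ →L[ℝ] ℝ).smulRight (hamVF σ H ((extChartAt I x₀).symm (c t))) =
      (coordInv I x₀ (c t)).comp ((1 : ℝ →L[ℝ] ℝ).smulRight (localVF σ H x₀ (c t))) := by
    refine ContinuousLinearMap.ext fun s => ?_
    change s • hamVF σ H _ = coordInv I x₀ (c t) (s • _)
    rw [map_smul, localVF, coordInv_coordMap hy]
  rw [heq]
  exact h2

end BoundaryTangency

/-! ### Uniqueness of integral curves and completeness of the Hamiltonian flow -/

/-- A property that holds locally with some positive constant, and is inherited by smaller constants,
holds on compact sets with a uniform constant. -/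
lemma IsCompact.exists_pos_forall {X : Type*} [TopologicalSpace X] {S : Set X} (hS : IsCompact S)
    {p : ℝ → X → Prop} (hp : ∀ δ ε x, δ ≤ ε → p ε x → p δ x)
    (h : ∀ x ∈ S, ∃ U ∈ 𝓝 x, ∃ ε > 0, ∀ y ∈ U, p ε y) : ∃ ε > 0, ∀ x ∈ S, p ε x := by
  refine hS.induction_on (p := fun T => ∃ ε > 0, ∀ x ∈ T, p ε x) ⟨1, one_pos, by simp⟩
    (fun T T' hT ⟨ε, hε, h⟩ => ⟨ε, hε, fun x hx => h x (hT hx)⟩) ?_ fun x hx => ?_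
  · rintro T T' ⟨ε, hε, h⟩ ⟨ε', hε', h'⟩
    refine ⟨min ε ε', lt_min hε hε', ?_⟩
    rintro x (hx | hx)
    · exact hp _ _ x (min_le_left _ _) (h x hx)
    · exact hp _ _ x (min_le_right _ _) (h' x hx)
  · obtain ⟨U, hU, h⟩ := h x hx
    exact ⟨U, mem_nhdsWithin_of_mem_nhds hU, h⟩

section GlobalFlow

variable {E : Type*} [NormedAddCommGroup E] [NormedSpace ℝ E] [FiniteDimensional ℝ E]
  {HM : Type*} [TopologicalSpace HM] {I : ModelWithCorners ℝ E HM}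
  {M : Type*} [TopologicalSpace M] [ChartedSpace HM M] [IsManifold I ∞ M]
  {ℓ : E →L[ℝ] ℝ} {H : M → ℝ} {σ : SymplecticForm I M}

/-- The local flow in the extended chart at `x₀`, together with its derivative with respect to the
initial condition. -/
lemma exists_chart_flow (σ : SymplecticForm I M) (hI : range I = {v | 0 ≤ ℓ v})
    (hH : IsHamiltonian I H) (x₀ : M) {V : Set M} (hV : V ∈ 𝓝 x₀) :
    ∃ ρ > 0, ∃ ε > 0, ∃ (α : E → ℝ → E) (A : E → ℝ → E →L[ℝ] E),
      ∀ z ∈ range I, ‖z - extChartAt I x₀ x₀‖ < ρ → α z 0 = z ∧ A z 0 = ContinuousLinearMap.id ℝ E ∧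
        ∀ t, |t| < ε → (α z t ∈ (extChartAt I x₀).target ∧ (extChartAt I x₀).symm (α z t) ∈ V) ∧
          α z t ∈ range I ∧ HasDerivAt (α z) (localVF σ H x₀ (α z t)) t ∧
          HasDerivAt (A z) ((fderivWithin ℝ (localVF σ H x₀) (range I) (α z t)).comp (A z t)) t ∧
          HasFDerivWithinAt (fun z => α z t) (A z t) (range I) z ∧ ‖A z t‖ ≤ 3 :=
  exists_local_flow (Ω := (extChartAt I x₀).target ∩ (extChartAt I x₀).symm ⁻¹' V) ℓ hI
    I.uniqueDiffOn (extChartAt_target_subset_range x₀ (mem_extChartAt_target x₀))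
    (Filter.inter_mem (extChartAt_target_mem_nhdsWithin x₀) (mem_nhdsWithin_of_mem_nhds
      ((continuousAt_extChartAt_symm x₀).preimage_mem_nhds (by rwa [extChartAt_to_inv]))))
    (fun _ hy => contDiffWithinAt_localVF σ hH hy.1)
    fun _ hy _ h0 => localVF_tangent σ hI hH hy.1 h0

lemma eventuallyEq_of_isMIntegralCurveAt (hI : range I = {v | 0 ≤ ℓ v}) (hH : IsHamiltonian I H)
    {γ γ' : ℝ → M} {t₀ : ℝ} (hγ : IsMIntegralCurveAt γ (hamVF σ H) t₀)
    (hγ' : IsMIntegralCurveAt γ' (hamVF σ H) t₀) (h : γ t₀ = γ' t₀) : γ =ᶠ[𝓝 t₀] γ' := by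
  set x₀ := γ t₀ with hx₀
  have hconv : Convex ℝ (range I) := by
    rw [hI]; exact convex_halfSpace_ge ℓ.isLinear 0
  obtain ⟨R, hR, Λ, hΛ, -, -, hlip⟩ := exists_bound_fderivWithin hconv I.isClosed_range
    I.uniqueDiffOn (extChartAt_target_mem_nhdsWithin x₀)
    (fun _ hy => contDiffWithinAt_localVF σ hH hy)
  set s : Set E := range I ∩ Metric.closedBall (extChartAt I x₀ x₀) R with hs
  have hL : LipschitzOnWith ⟨Λ, by linarith⟩ (localVF σ H x₀) s := by
    refine LipschitzOnWith.of_dist_le_mul fun a ha b hb => ?_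
    rw [dist_eq_norm, dist_eq_norm]
    exact hlip a ha.1 b hb.1 (mem_closedBall_iff_norm.1 ha.2) (mem_closedBall_iff_norm.1 hb.2)
  have key : ∀ g : ℝ → M, IsMIntegralCurveAt g (hamVF σ H) t₀ → g t₀ = x₀ →
      (∀ᶠ t in 𝓝 t₀, g t ∈ (extChartAt I x₀).source) ∧
      ∀ᶠ t in 𝓝 t₀, HasDerivAt (extChartAt I x₀ ∘ g)
        (localVF σ H x₀ ((extChartAt I x₀ ∘ g) t)) t ∧ (extChartAt I x₀ ∘ g) t ∈ s := by
    intro g hg hgx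
    have hsrc : ∀ᶠ t in 𝓝 t₀, g t ∈ (extChartAt I x₀).source :=
      hg.continuousAt.eventually_mem (by rw [hgx]; exact extChartAt_source_mem_nhds x₀)
    refine ⟨hsrc, ?_⟩
    have hball : ∀ᶠ t in 𝓝 t₀, (extChartAt I x₀ ∘ g) t ∈
        Metric.closedBall (extChartAt I x₀ x₀) R := by
      have hc : ContinuousAt (extChartAt I x₀ ∘ g) t₀ :=
        ContinuousAt.comp (by rw [hgx]; exact continuousAt_extChartAt x₀) hg.continuousAt
      refine hc.eventually_mem ?_
      simp only [Function.comp_apply, hgx]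
      exact Metric.closedBall_mem_nhds _ hR
    filter_upwards [hsrc, hball, hg] with t h1 h2 h3
    exact ⟨hasDerivAt_extChartAt_comp σ h3 h1,
      extChartAt_target_subset_range x₀ ((extChartAt I x₀).map_source h1), h2⟩
  obtain ⟨h1, h2⟩ := key γ hγ rfl
  obtain ⟨h3, h4⟩ := key γ' hγ' h.symm
  have := ODE_solution_unique_of_eventually (v := fun _ => localVF σ H x₀) (s := fun _ => s)
    (.of_forall fun _ => hL) h2 h4
    (congrArg (extChartAt I x₀) h)
  filter_upwards [h1, h3, this] with t h1 h3 ht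
  exact (extChartAt I x₀).injOn h1 h3 ht

variable [T2Space M]

lemma eqOn_Ioo_of_isMIntegralCurveOn (hI : range I = {v | 0 ≤ ℓ v}) (hH : IsHamiltonian I H)
    {γ γ' : ℝ → M} {a b t₀ : ℝ} (hγ : IsMIntegralCurveOn γ (hamVF σ H) (Ioo a b))
    (hγ' : IsMIntegralCurveOn γ' (hamVF σ H) (Ioo a b)) (ht₀ : t₀ ∈ Ioo a b)
    (h : γ t₀ = γ' t₀) : EqOn γ γ' (Ioo a b) := by
  have hopen : IsOpen ({t | γ t = γ' t} ∩ Ioo a b) := by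
    rw [isOpen_iff_mem_nhds]
    intro t ht
    have hmem := Ioo_mem_nhds ht.2.1 ht.2.2
    filter_upwards [eventuallyEq_of_isMIntegralCurveAt hI hH (hγ.isMIntegralCurveAt hmem)
      (hγ'.isMIntegralCurveAt hmem) ht.1, hmem] with s h1 h2
    exact ⟨h1, h2⟩
  have hsub := isPreconnected_Ioo.subset_of_closure_inter_subset hopen
    ⟨t₀, ht₀, h, ht₀⟩ fun t ht => by
      refine ⟨?_, ht.2⟩
      have hmem := Ioo_mem_nhds ht.2.1 ht.2.2
      have hc := (hγ.isMIntegralCurveAt hmem).continuousAt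
      have hc' := (hγ'.isMIntegralCurveAt hmem).continuousAt
      by_contra hne
      have hev : ∀ᶠ s in 𝓝 t, γ s ≠ γ' s :=
        (hc.prodMk hc').eventually_mem (isClosed_diagonal.isOpen_compl.mem_nhds hne)
      obtain ⟨s, hs1, hs2⟩ := (mem_closure_iff_frequently.1 ht.1 |>.and_eventually hev).exists
      exact hs2 hs1.1
  exact fun t ht => (hsub ht).1

lemma eq_of_isMIntegralCurve (hI : range I = {v | 0 ≤ ℓ v}) (hH : IsHamiltonian I H)
    {γ γ' : ℝ → M} (hγ : IsMIntegralCurve γ (hamVF σ H)) (hγ' : IsMIntegralCurve γ' (hamVF σ H))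
    (h : γ 0 = γ' 0) (t : ℝ) : γ t = γ' t :=
  eqOn_Ioo_of_isMIntegralCurveOn hI hH (hγ.isMIntegralCurveOn (Ioo (-(|t| + 1)) (|t| + 1)))
    (hγ'.isMIntegralCurveOn _) (t₀ := 0) ⟨by have := abs_nonneg t; linarith, by positivity⟩ h
    (abs_lt.1 (lt_add_one _))

/-- Two integral curves on overlapping intervals that agree at one point of the overlap patch
together. -/
lemma isMIntegralCurveOn_union (hI : range I = {v | 0 ≤ ℓ v}) (hH : IsHamiltonian I H)
    {γ γ' : ℝ → M} {a b a' b' t₀ : ℝ} (hγ : IsMIntegralCurveOn γ (hamVF σ H) (Ioo a b))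
    (hγ' : IsMIntegralCurveOn γ' (hamVF σ H) (Ioo a' b')) (ht₀ : t₀ ∈ Ioo a b ∩ Ioo a' b')
    (h : γ t₀ = γ' t₀) :
    ∃ η : ℝ → M, EqOn η γ (Ioo a b) ∧ IsMIntegralCurveOn η (hamVF σ H) (Ioo a b ∪ Ioo a' b') := by
  classical
  have heq : EqOn (piecewise (Ioo a b) γ γ') γ' (Ioo a' b') := by
    intro t ht
    by_cases hmem : t ∈ Ioo a b
    · rw [piecewise_eq_of_mem _ _ _ hmem]
      refine eqOn_Ioo_of_isMIntegralCurveOn hI hH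
        (hγ.mono (Ioo_subset_Ioo (le_max_left a a') (min_le_left b b')))
        (hγ'.mono (Ioo_subset_Ioo (le_max_right a a') (min_le_right b b')))
        ⟨max_lt ht₀.1.1 ht₀.2.1, lt_min ht₀.1.2 ht₀.2.2⟩ h
        ⟨max_lt hmem.1 ht.1, lt_min hmem.2 ht.2⟩
    · rw [piecewise_eq_of_notMem _ _ _ hmem]
  refine ⟨piecewise (Ioo a b) γ γ', piecewise_eqOn _ _ _, ?_⟩
  rw [isMIntegralCurveOn_iff_isMIntegralCurveAt (isOpen_Ioo.union isOpen_Ioo)]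
  have congr : ∀ {η : ℝ → M} {c d : ℝ}, IsMIntegralCurveOn η (hamVF σ H) (Ioo c d) →
      EqOn (piecewise (Ioo a b) γ γ') η (Ioo c d) → ∀ t ∈ Ioo c d,
      IsMIntegralCurveAt (piecewise (Ioo a b) γ γ') (hamVF σ H) t := by
    intro η c d hη he t ht
    have hev := isOpen_Ioo.eventually_mem ht
    filter_upwards [hη.isMIntegralCurveAt (Ioo_mem_nhds ht.1 ht.2), hev] with s hs hs'
    rw [he hs']
    exact hs.congr_of_eventuallyEq
      (Filter.eventuallyEq_of_mem (isOpen_Ioo.mem_nhds hs') he)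
  rintro t (ht | ht)
  · exact congr hγ (piecewise_eqOn _ _ _) t ht
  · exact congr hγ' heq t ht

lemma exists_isMIntegralCurveOn_extend (hI : range I = {v | 0 ≤ ℓ v}) (hH : IsHamiltonian I H)
    {a : ℝ} (ha : 0 < a)
    (h : ∀ x : M, ∃ γ : ℝ → M, γ 0 = x ∧ IsMIntegralCurveOn γ (hamVF σ H) (Ioo (-a) a)) (x : M) :
    ∃ γ : ℝ → M, γ 0 = x ∧
      IsMIntegralCurveOn γ (hamVF σ H) (Ioo (-(3 / 2 * a)) (3 / 2 * a)) := by
  obtain ⟨γ, h0, hγ⟩ := h x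
  obtain ⟨γ₁, h1, hγ₁⟩ := h (γ (a / 2))
  obtain ⟨γ₂, h2, hγ₂⟩ := h (γ (-(a / 2)))
  have hγ₁' : IsMIntegralCurveOn (γ₁ ∘ (· - a / 2)) (hamVF σ H) (Ioo (-(a / 2)) (3 / 2 * a)) := by
    refine ((isMIntegralCurveOn_comp_sub (dt := a / 2)).2 hγ₁).mono fun t ht => ?_
    constructor <;> linarith [ht.1, ht.2]
  have hγ₂' : IsMIntegralCurveOn (γ₂ ∘ (· + a / 2)) (hamVF σ H) (Ioo (-(3 / 2 * a)) (a / 2)) := by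
    refine ((isMIntegralCurveOn_comp_add (dt := a / 2)).2 hγ₂).mono fun t ht => ?_
    constructor <;> linarith [ht.1, ht.2]
  obtain ⟨η, hη, hηi⟩ := isMIntegralCurveOn_union hI hH hγ hγ₁' (t₀ := a / 2)
    ⟨⟨by linarith, by linarith⟩, by linarith, by linarith⟩ (by simp [h1])
  have hηi' : IsMIntegralCurveOn η (hamVF σ H) (Ioo (-a) (3 / 2 * a)) :=
    hηi.mono (Ioo_subset_Ioo_union_Ioo le_rfl (by linarith) le_rfl)
  obtain ⟨ζ, hζ, hζi⟩ := isMIntegralCurveOn_union hI hH hηi' hγ₂' (t₀ := -(a / 2))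
    ⟨⟨by linarith, by linarith⟩, by linarith, by linarith⟩
    (by rw [hη ⟨by linarith, by linarith⟩]; simp [h2])
  refine ⟨ζ, ?_, hζi.mono ?_⟩
  · rw [hζ ⟨by linarith, by linarith⟩, hη ⟨by linarith, by linarith⟩, h0]
  · rw [union_comm]
    exact Ioo_subset_Ioo_union_Ioo le_rfl (by linarith) le_rfl

/-- Integral curves that exist for a uniform time exist for all times. -/
lemma exists_isMIntegralCurve_of_uniform (hI : range I = {v | 0 ≤ ℓ v}) (hH : IsHamiltonian I H)
    {ε : ℝ} (hε : 0 < ε)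
    (h : ∀ x : M, ∃ γ : ℝ → M, γ 0 = x ∧ IsMIntegralCurveOn γ (hamVF σ H) (Ioo (-ε) ε)) (x : M) :
    ∃ γ : ℝ → M, γ 0 = x ∧ IsMIntegralCurve γ (hamVF σ H) := by
  have hn : ∀ n : ℕ, ∀ x : M, ∃ γ : ℝ → M, γ 0 = x ∧
      IsMIntegralCurveOn γ (hamVF σ H) (Ioo (-((3 / 2) ^ n * ε)) ((3 / 2) ^ n * ε)) := by
    intro n
    induction n with
    | zero => simpa using h
    | succ n ih =>
      intro x
      have := exists_isMIntegralCurveOn_extend hI hH (by positivity) ih x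
      rwa [pow_succ', mul_assoc]
  have ha : ∀ a : ℝ, ∃ γ : ℝ → M, γ 0 = x ∧ IsMIntegralCurveOn γ (hamVF σ H) (Ioo (-a) a) := by
    intro a
    obtain ⟨n, hna⟩ := pow_unbounded_of_one_lt (a / ε) (by norm_num : (1 : ℝ) < 3 / 2)
    rw [div_lt_iff₀ hε] at hna
    obtain ⟨γ, h0, hγ⟩ := hn n x
    exact ⟨γ, h0, hγ.mono (Ioo_subset_Ioo (by linarith) hna.le)⟩
  choose γ h0 hγ using ha
  have hEq : ∀ a b : ℝ, 0 < a → a ≤ b → EqOn (γ a) (γ b) (Ioo (-a) a) := fun a b ha hab =>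
    eqOn_Ioo_of_isMIntegralCurveOn hI hH (hγ a)
      ((hγ b).mono (Ioo_subset_Ioo (by linarith) hab)) (t₀ := 0) ⟨by linarith, ha⟩
      (by rw [h0, h0])
  refine ⟨fun t => γ (|t| + 1) t, h0 _, fun t => ?_⟩
  have ht : t ∈ Ioo (-(|t| + 1)) (|t| + 1) := abs_lt.1 (lt_add_one _)
  refine (((hγ (|t| + 1)) t ht).hasMFDerivAt (isOpen_Ioo.mem_nhds ht)).congr_of_eventuallyEq ?_
  filter_upwards [isOpen_Ioo.mem_nhds ht] with s hs
  rcases le_total (|s| + 1) (|t| + 1) with hle | hle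
  · exact hEq _ _ (by positivity) hle (abs_lt.1 (lt_add_one _))
  · exact (hEq _ _ (by positivity) hle hs).symm

variable [CompactSpace M]

lemma exists_isMIntegralCurve_hamVF (σ : SymplecticForm I M) (hI : range I = {v | 0 ≤ ℓ v})
    (hH : IsHamiltonian I H) (x : M) :
    ∃ γ : ℝ → M, γ 0 = x ∧ IsMIntegralCurve γ (hamVF σ H) := by
  have hloc : ∀ x₀ : M, ∃ U ∈ 𝓝 x₀, ∃ ε > 0, ∀ x ∈ U, ∃ γ : ℝ → M, γ 0 = x ∧
      IsMIntegralCurveOn γ (hamVF σ H) (Ioo (-ε) ε) := by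
    intro x₀
    obtain ⟨ρ, hρ, ε, hε, α, A, hα⟩ := exists_chart_flow σ hI hH x₀ Filter.univ_mem
    have hball : ∀ᶠ x in 𝓝 x₀, ‖extChartAt I x₀ x - extChartAt I x₀ x₀‖ < ρ := by
      filter_upwards [(continuousAt_extChartAt (I := I) x₀).eventually_mem
        (Metric.ball_mem_nhds _ hρ)] with x hx
      exact mem_ball_iff_norm.1 hx
    refine ⟨_, Filter.inter_mem (extChartAt_source_mem_nhds (I := I) x₀) hball, ε, hε, ?_⟩
    rintro x ⟨hx, hxρ⟩
    obtain ⟨h0, -, ht⟩ := hα _ (extChartAt_target_subset_range x₀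
      ((extChartAt I x₀).map_source hx)) hxρ
    refine ⟨(extChartAt I x₀).symm ∘ α (extChartAt I x₀ x), ?_, fun t htε => ?_⟩
    · simp only [Function.comp_apply, h0]
      exact (extChartAt I x₀).left_inv hx
    · refine HasMFDerivAt.hasMFDerivWithinAt (hasMFDerivAt_extChartAt_symm_comp σ
        (ht t (abs_lt.2 htε)).2.2.1 ?_)
      filter_upwards [isOpen_Ioo.mem_nhds htε] with s hs
      exact (ht s (abs_lt.2 hs)).1.1
  obtain ⟨ε, hε, h⟩ := isCompact_univ.exists_pos_forall (fun _ _ x h ⟨γ, h0, h1⟩ =>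
    ⟨γ, h0, h1.mono (Ioo_subset_Ioo (neg_le_neg h) h)⟩) fun x₀ _ => hloc x₀
  exact exists_isMIntegralCurve_of_uniform hI hH hε (fun x => h x (mem_univ x)) x

section

variable (σ) (hI : range I = {v | 0 ≤ ℓ v}) (hH : IsHamiltonian I H)
include hI hH

lemma hamFlow_spec (x : M) :
    hamFlow σ H 0 x = x ∧ IsMIntegralCurve (fun t => hamFlow σ H t x) (hamVF σ H) := by
  have h := exists_isMIntegralCurve_hamVF σ hI hH x
  have he : (fun t => hamFlow σ H t x) = h.choose := by
    funext t
    exact dif_pos h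
  refine ⟨?_, he ▸ h.choose_spec.2⟩
  rw [show hamFlow σ H 0 x = h.choose 0 from congrFun he 0]
  exact h.choose_spec.1

lemma hamFlow_zero (x : M) : hamFlow σ H 0 x = x := (hamFlow_spec σ hI hH x).1

lemma isMIntegralCurve_hamFlow (x : M) :
    IsMIntegralCurve (fun t => hamFlow σ H t x) (hamVF σ H) := (hamFlow_spec σ hI hH x).2

lemma hamFlow_eq {γ : ℝ → M} (hγ : IsMIntegralCurve γ (hamVF σ H)) (t : ℝ) :
    γ t = hamFlow σ H t (γ 0) :=
  eq_of_isMIntegralCurve hI hH hγ (isMIntegralCurve_hamFlow σ hI hH _)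
    (hamFlow_zero σ hI hH _).symm t

lemma hamFlow_add (s t : ℝ) (x : M) :
    hamFlow σ H (t + s) x = hamFlow σ H t (hamFlow σ H s x) := by
  have := hamFlow_eq σ hI hH ((isMIntegralCurve_hamFlow σ hI hH x).comp_add s) t
  simpa using this

lemma hamFlow_eq_of_abs_lt {γ : ℝ → M} {ε : ℝ}
    (hγ : IsMIntegralCurveOn γ (hamVF σ H) (Ioo (-ε) ε)) {t : ℝ} (ht : |t| < ε) :
    γ t = hamFlow σ H t (γ 0) :=
  eqOn_Ioo_of_isMIntegralCurveOn hI hH hγ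
    ((isMIntegralCurve_hamFlow σ hI hH (γ 0)).isMIntegralCurveOn _) (t₀ := 0)
    ⟨by linarith [abs_nonneg t], by linarith [abs_nonneg t]⟩ (hamFlow_zero σ hI hH _).symm
    (abs_lt.1 ht)

end

end GlobalFlow

/-! ### The tangent flow -/

section TangentFlow

variable {E : Type*} [NormedAddCommGroup E] [NormedSpace ℝ E]
  {HM : Type*} [TopologicalSpace HM] {I : ModelWithCorners ℝ E HM}
  {M : Type*} [TopologicalSpace M] [ChartedSpace HM M]

/-- The symplectic form as a function of two vectors of the model space. -/
noncomputable def SymplecticForm.pairing (σ : SymplecticForm I M) (x : M) (u v : E) : ℝ :=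
  σ.form x ![(u : TangentSpace I x), (v : TangentSpace I x)]

variable [IsManifold I ∞ M] {ℓ : E →L[ℝ] ℝ} {H : M → ℝ} {σ : SymplecticForm I M} {x₀ : M}

lemma chartForm_coordMap {p : M} (hp : p ∈ (extChartAt I x₀).source) (u v : TangentSpace I p) :
    chartForm I σ.form x₀ (extChartAt I x₀ p) ![coordMap I x₀ p u, coordMap I x₀ p v] =
      σ.form p ![u, v] := by
  have : IsManifold I 1 M := inferInstance
  obtain ⟨y, hy, rfl⟩ : ∃ y ∈ (extChartAt I x₀).target, (extChartAt I x₀).symm y = p :=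
    ⟨_, (extChartAt I x₀).map_source hp, (extChartAt I x₀).left_inv hp⟩
  rw [(extChartAt I x₀).right_inv hy, chartForm_apply, coordInv_coordMap hy, coordInv_coordMap hy]

lemma coordMap_coordInv_of_eq {p : M} {y : E} (hy : y ∈ (extChartAt I x₀).target)
    (hp : p = (extChartAt I x₀).symm y) (u : E) :
    (coordMap I x₀ p : E →L[ℝ] E) ((coordInv I x₀ y : E →L[ℝ] E) u) = u := by
  have : IsManifold I 1 M := inferInstance
  subst hp
  exact coordMap_coordInv hy u

variable [FiniteDimensional ℝ E]

/-- The tangent flow as a map of the model space, to which all tangent spaces are equal; this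
allows comparing tangent vectors at points that are only propositionally equal. -/
noncomputable def flowMap (σ : SymplecticForm I M) (H : M → ℝ) (t : ℝ) (x : M) : E →L[ℝ] E :=
  tangentFlow σ H t x

variable [T2Space M] [CompactSpace M]

/-- Near any point and for short times the flow is differentiable, and the tangent flow is given in
coordinates by the solution `A` of the variational equation. -/
lemma exists_tangentFlow_in_chart (σ : SymplecticForm I M) (hI : range I = {v | 0 ≤ ℓ v})
    (hH : IsHamiltonian I H) (x₀ : M) {V : Set M} (hV : V ∈ 𝓝 x₀) :
    ∃ U ∈ 𝓝 x₀, ∃ ε > 0, ∃ A : M → ℝ → E →L[ℝ] E, ∀ x ∈ U, A x 0 = ContinuousLinearMap.id ℝ E ∧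
      ∀ t, |t| < ε → hamFlow σ H t x ∈ (extChartAt I x₀).source ∧ hamFlow σ H t x ∈ V ∧
        MDifferentiableAt I I (hamFlow σ H t) x ∧
        (∀ v, (coordMap I x₀ (hamFlow σ H t x)) (flowMap σ H t x v) = A x t (coordMap I x₀ x v)) ∧
        HasDerivAt (A x) ((fderivWithin ℝ (localVF σ H x₀) (range I)
          (extChartAt I x₀ (hamFlow σ H t x))).comp (A x t)) t ∧ ‖A x t‖ ≤ 3 := by
  have : IsManifold I 1 M := inferInstance
  obtain ⟨ρ, hρ, ε, hε, α, A, hα⟩ := exists_chart_flow σ hI hH x₀ hV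
  set U : Set M := (extChartAt I x₀).source ∩ extChartAt I x₀ ⁻¹' Metric.ball (extChartAt I x₀ x₀) ρ
    with hU
  have hUo : IsOpen U := isOpen_extChartAt_preimage' x₀ Metric.isOpen_ball
  have hpt : ∀ x ∈ U, extChartAt I x₀ x ∈ range I ∧ ‖extChartAt I x₀ x - extChartAt I x₀ x₀‖ < ρ :=
    fun x hx => ⟨extChartAt_target_subset_range x₀ ((extChartAt I x₀).map_source hx.1),
      mem_ball_iff_norm.1 hx.2⟩
  have hflow : ∀ x ∈ U, ∀ t, |t| < ε →
      hamFlow σ H t x = (extChartAt I x₀).symm (α (extChartAt I x₀ x) t) := by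
    intro x hx t ht
    obtain ⟨h0, -, h1⟩ := hα _ (hpt x hx).1 (hpt x hx).2
    have hint : IsMIntegralCurveOn ((extChartAt I x₀).symm ∘ α (extChartAt I x₀ x)) (hamVF σ H)
        (Ioo (-ε) ε) := fun s hs => by
      refine HasMFDerivAt.hasMFDerivWithinAt (hasMFDerivAt_extChartAt_symm_comp σ
        (h1 s (abs_lt.2 hs)).2.2.1 ?_)
      filter_upwards [isOpen_Ioo.mem_nhds hs] with s hs
      exact (h1 s (abs_lt.2 hs)).1.1
    have := hamFlow_eq_of_abs_lt σ hI hH hint ht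
    simp only [Function.comp_apply, h0] at this
    rw [(extChartAt I x₀).left_inv hx.1] at this
    exact this.symm
  refine ⟨U, hUo.mem_nhds ⟨mem_extChartAt_source x₀, Metric.mem_ball_self hρ⟩, ε, hε,
    fun x => A (extChartAt I x₀ x), fun x hx => ?_⟩
  obtain ⟨h0, hA0, h1⟩ := hα _ (hpt x hx).1 (hpt x hx).2
  refine ⟨hA0, fun t ht => ?_⟩
  obtain ⟨⟨htar, htV⟩, -, -, hAd, hαd, hAn⟩ := h1 t ht
  have hfl := hflow x hx t ht
  have hext : extChartAt I x₀ (hamFlow σ H t x) = α (extChartAt I x₀ x) t := by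
    rw [hfl, (extChartAt I x₀).right_inv htar]
  have hball : range I ∩ Metric.ball (extChartAt I x₀ x₀) ρ ∈ 𝓝[range I] (extChartAt I x₀ x) :=
    Filter.inter_mem self_mem_nhdsWithin (mem_nhdsWithin_of_mem_nhds
      (Metric.isOpen_ball.mem_nhds hx.2))
  have hd : HasMFDerivAt I I ((extChartAt I x₀).symm ∘ (fun z => α z t) ∘ extChartAt I x₀) x
      ((coordInv I x₀ (α (extChartAt I x₀ x) t)).comp
        ((A (extChartAt I x₀ x) t).comp (coordMap I x₀ x))) := by
    have e1 : HasMFDerivWithinAt I 𝓘(ℝ, E) (extChartAt I x₀) U x (coordMap I x₀ x) :=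
      (hasMFDerivAt_extChartAt' hx.1).hasMFDerivWithinAt
    have e2 : HasMFDerivWithinAt 𝓘(ℝ, E) 𝓘(ℝ, E) (fun z => α z t)
        (range I ∩ Metric.ball (extChartAt I x₀ x₀) ρ) (extChartAt I x₀ x)
        (A (extChartAt I x₀ x) t) :=
      hasMFDerivWithinAt_iff_hasFDerivWithinAt.2 (hαd.mono inter_subset_left)
    have e3 := e2.comp x e1 fun z hz => ⟨(hpt z hz).1, hz.2⟩
    have e4 : HasMFDerivWithinAt I I
        ((extChartAt I x₀).symm ∘ (fun z => α z t) ∘ extChartAt I x₀) U x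
        ((coordInv I x₀ (α (extChartAt I x₀ x) t)).comp
        ((A (extChartAt I x₀ x) t).comp (coordMap I x₀ x))) :=
      HasMFDerivWithinAt.comp x (hasMFDerivWithinAt_extChartAt_symm (I := I) htar) e3
        fun z hz => ((hα _ (hpt z hz).1 (hpt z hz).2).2.2 t ht).2.1
    exact e4.hasMFDerivAt (hUo.mem_nhds hx)
  have hd' := hd.congr_of_eventuallyEq (f₁ := hamFlow σ H t)
    (Filter.eventuallyEq_of_mem (hUo.mem_nhds hx) fun z hz => hflow z hz t ht)
  refine ⟨?_, ?_, hd'.mdifferentiableAt, fun v => ?_, ?_, hAn⟩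
  · rw [hfl]
    exact (extChartAt I x₀).map_target htar
  · rwa [hfl]
  · have : flowMap σ H t x v = (coordInv I x₀ (α (extChartAt I x₀ x) t) : E →L[ℝ] E)
        ((A (extChartAt I x₀ x) t) (coordMap I x₀ x v)) := by
      unfold flowMap tangentFlow
      rw [hd'.mfderiv]
      rfl
    rw [this]
    exact coordMap_coordInv_of_eq htar hfl _
  · rw [hext]
    exact hAd

end TangentFlow

/-! ### Group law and differentiability of the global flow -/

/-- A property of real numbers that is stable under addition and holds near `0` holds everywhere. -/
lemma forall_real_of_add {Q : ℝ → Prop} {ε : ℝ} (hε : 0 < ε) (hsmall : ∀ t, |t| < ε → Q t)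
    (hadd : ∀ s t, Q s → Q t → Q (t + s)) (t : ℝ) : Q t := by
  obtain ⟨n, hn⟩ := exists_nat_gt (|t| / ε)
  have hn0 : (0 : ℝ) < n := (div_nonneg (abs_nonneg t) hε.le).trans_lt hn
  have hq : Q (t / n) := hsmall _ (by
    rw [abs_div, Nat.abs_cast, div_lt_iff₀ hn0, mul_comm]
    rwa [div_lt_iff₀ hε] at hn)
  have hk : ∀ k : ℕ, Q ((k + 1) * (t / n)) := by
    intro k
    induction k with
    | zero => simpa using hq
    | succ k ih =>
      have := hadd _ _ ih hq
      convert this using 1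
      push_cast
      ring
  obtain ⟨k, rfl⟩ : ∃ k, n = k + 1 := Nat.exists_eq_succ_of_ne_zero (by rintro rfl; simp at hn0)
  have := hk k
  push_cast at this hn0
  rwa [mul_div_cancel₀ _ hn0.ne'] at this

section FlowProperties

variable {E : Type*} [NormedAddCommGroup E] [NormedSpace ℝ E] [FiniteDimensional ℝ E]
  {HM : Type*} [TopologicalSpace HM] {I : ModelWithCorners ℝ E HM}
  {M : Type*} [TopologicalSpace M] [ChartedSpace HM M]
  [IsManifold I ∞ M] {ℓ : E →L[ℝ] ℝ} {H : M → ℝ}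
  [T2Space M] [CompactSpace M] (σ : SymplecticForm I M) (hI : range I = {v | 0 ≤ ℓ v})
  (hH : IsHamiltonian I H)
include hI hH

lemma hamFlow_comp (s t : ℝ) : hamFlow σ H (t + s) = hamFlow σ H t ∘ hamFlow σ H s :=
  funext fun x => hamFlow_add σ hI hH s t x

lemma mdifferentiableAt_hamFlow (t : ℝ) (x : M) : MDifferentiableAt I I (hamFlow σ H t) x := by
  obtain ⟨ε, hε, h⟩ := isCompact_univ.exists_pos_forall
    (p := fun ε x => ∀ t, |t| < ε → MDifferentiableAt I I (hamFlow σ H t) x)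
    (fun _ _ x hle h t ht => h t (ht.trans_le hle)) fun x₀ _ => by
      obtain ⟨U, hU, ε, hε, A, h⟩ := exists_tangentFlow_in_chart σ hI hH x₀ Filter.univ_mem
      exact ⟨U, hU, ε, hε, fun x hx t ht => ((h x hx).2 t ht).2.2.1⟩
  refine forall_real_of_add (Q := fun t => ∀ x, MDifferentiableAt I I (hamFlow σ H t) x) hε
    (fun t ht x => h x (mem_univ x) t ht) (fun s t hs ht x => ?_) t x
  rw [hamFlow_comp σ hI hH]
  exact (ht _).comp x (hs x)

lemma flowMap_add (s t : ℝ) (x : M) :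
    flowMap σ H (t + s) x = (flowMap σ H t (hamFlow σ H s x)).comp (flowMap σ H s x) := by
  have h1 : mfderiv I I (hamFlow σ H t ∘ hamFlow σ H s) x = _ :=
    mfderiv_comp x (mdifferentiableAt_hamFlow σ hI hH t _) (mdifferentiableAt_hamFlow σ hI hH s x)
  rw [← hamFlow_comp σ hI hH] at h1
  exact h1

lemma flowMap_zero (x : M) : flowMap σ H 0 x = ContinuousLinearMap.id ℝ E := by
  have h : hamFlow σ H 0 = id := funext fun x => hamFlow_zero σ hI hH x
  have h1 : mfderiv I I (id : M → M) x = ContinuousLinearMap.id ℝ (TangentSpace I x) := mfderiv_id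
  rw [← h] at h1
  exact h1

/-- The tangent flow maps the Hamiltonian vector field to itself. -/
lemma flowMap_hamVF (t : ℝ) (x : M) :
    flowMap σ H t x (hamVF σ H x) = hamVF σ H (hamFlow σ H t x) := by
  have h1 : HasMFDerivAt 𝓘(ℝ, ℝ) I (hamFlow σ H t ∘ fun s => hamFlow σ H s x) 0
      ((mfderiv I I (hamFlow σ H t) (hamFlow σ H 0 x)).comp
        ((1 : ℝ →L[ℝ] ℝ).smulRight (hamVF σ H (hamFlow σ H 0 x)))) :=
    (mdifferentiableAt_hamFlow σ hI hH t _).hasMFDerivAt.comp 0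
      (isMIntegralCurve_hamFlow σ hI hH x 0)
  have h2 : (hamFlow σ H t ∘ fun s => hamFlow σ H s x) =
      fun s => hamFlow σ H s (hamFlow σ H t x) := by
    funext s
    change hamFlow σ H t (hamFlow σ H s x) = _
    rw [← hamFlow_add σ hI hH, ← hamFlow_add σ hI hH, add_comm]
  rw [h2] at h1
  have h3 := hasMFDerivAt_unique h1 (isMIntegralCurve_hamFlow σ hI hH (hamFlow σ H t x) 0)
  have h4 := congrArg (fun L : ℝ →L[ℝ] E => L 1) h3
  change flowMap σ H t (hamFlow σ H 0 x) ((1 : ℝ) • hamVF σ H (hamFlow σ H 0 x) : E) =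
    ((1 : ℝ) • hamVF σ H (hamFlow σ H 0 (hamFlow σ H t x)) : E) at h4
  have h5 : ∀ p q : M, p = q → (hamVF σ H p : E) = hamVF σ H q := by
    rintro p _ rfl
    rfl
  rw [one_smul, one_smul, h5 _ _ (hamFlow_zero σ hI hH x),
    h5 _ _ (hamFlow_zero σ hI hH (hamFlow σ H t x)), hamFlow_zero σ hI hH x] at h4
  exact h4

/-- Conservation of energy. -/
lemma apply_hamFlow (t : ℝ) (x : M) : H (hamFlow σ H t x) = H x := by
  have hd : ∀ s, HasDerivAt (fun s => H (hamFlow σ H s x)) 0 s := by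
    intro s
    have h1 : HasMFDerivAt 𝓘(ℝ, ℝ) 𝓘(ℝ, ℝ) (H ∘ fun s => hamFlow σ H s x) s
        ((dH I H (hamFlow σ H s x)).comp
          ((1 : ℝ →L[ℝ] ℝ).smulRight (hamVF σ H (hamFlow σ H s x)))) :=
      (hH.mdifferentiableAt _).hasMFDerivAt.comp s (isMIntegralCurve_hamFlow σ hI hH x s)
    have h2 : HasFDerivAt (fun s => H (hamFlow σ H s x)) ((dH I H (hamFlow σ H s x)).comp
        ((1 : ℝ →L[ℝ] ℝ).smulRight (hamVF σ H (hamFlow σ H s x))) : ℝ →L[ℝ] ℝ) s :=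
      hasMFDerivAt_iff_hasFDerivAt.1 h1
    have h3 : HasDerivAt (fun s => H (hamFlow σ H s x))
        (dH I H (hamFlow σ H s x) ((1 : ℝ) • hamVF σ H (hamFlow σ H s x))) s := h2.hasDerivAt
    rwa [one_smul, dH_eq_form, σ.form_self] at h3
  have := is_const_of_deriv_eq_zero (fun s => (hd s).differentiableAt) (fun s => (hd s).deriv) t 0
  rwa [hamFlow_zero σ hI hH] at this

lemma dH_flowMap (t : ℝ) (x : M) (v : E) :
    dH I H (hamFlow σ H t x) (flowMap σ H t x v) = dH I H x v := by
  have h1 : mfderiv I 𝓘(ℝ, ℝ) (H ∘ hamFlow σ H t) x = _ :=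
    mfderiv_comp x (hH.mdifferentiableAt _) (mdifferentiableAt_hamFlow σ hI hH t x)
  have h2 : H ∘ hamFlow σ H t = H := funext fun y => apply_hamFlow σ hI hH t y
  rw [h2] at h1
  exact (congrArg (fun L : E →L[ℝ] ℝ => L v) h1).symm

/-- The Hamiltonian flow preserves the symplectic form. -/
lemma pairing_flowMap (t : ℝ) (x : M) (u v : E) :
    σ.pairing (hamFlow σ H t x) (flowMap σ H t x u) (flowMap σ H t x v) = σ.pairing x u v := by
  obtain ⟨ε, hε, h⟩ := isCompact_univ.exists_pos_forall
    (p := fun ε x => ∀ t, |t| < ε → ∀ u v,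
      σ.pairing (hamFlow σ H t x) (flowMap σ H t x u) (flowMap σ H t x v) = σ.pairing x u v)
    (fun _ _ x hle h t ht => h t (ht.trans_le hle)) fun x₀ _ => by
      obtain ⟨U, hU, ε, hε, A, h⟩ := exists_tangentFlow_in_chart σ hI hH x₀ Filter.univ_mem
      refine ⟨U, hU, ε, hε, fun x hx t ht u v => ?_⟩
      obtain ⟨hA0, h⟩ := h x hx
      set a : E := coordMap I x₀ x u
      set b : E := coordMap I x₀ x v
      have key : ∀ s, |s| < ε → chartForm I σ.form x₀ (extChartAt I x₀ (hamFlow σ H s x))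
          ![A x s a, A x s b] = σ.pairing (hamFlow σ H s x) (flowMap σ H s x u)
            (flowMap σ H s x v) := by
        intro s hs
        obtain ⟨hsrc, -, -, hD, -⟩ := h s hs
        rw [← hD, ← hD]
        exact chartForm_coordMap hsrc _ _
      have hconst : ∀ s, |s| < ε → HasDerivAt (fun s => chartForm I σ.form x₀
          (extChartAt I x₀ (hamFlow σ H s x)) ![A x s a, A x s b]) 0 s := by
        intro s hs
        obtain ⟨hsrc, -, -, -, hA, -⟩ := h s hs
        have htar := (extChartAt I x₀).map_source hsrc
        refine hasDerivAt_form_variational I.uniqueDiffOn I.range_subset_closure_interior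
          (Y := localVF σ H x₀) (F := H ∘ (extChartAt I x₀).symm)
          (c := fun s => extChartAt I x₀ (hamFlow σ H s x)) ?_
          (hasDerivAt_extChartAt_comp σ (isMIntegralCurve_hamFlow σ hI hH x s) hsrc) hA
          ((σ.contDiffWithinAt htar).differentiableWithinAt (by simp))
          ((contDiffWithinAt_localVF σ hH htar).differentiableWithinAt (by simp))
          (hH.contDiffWithinAt htar) ?_ (σ.closed x₀ _ htar) a b
        · exact .of_forall fun r => mem_range_self _
        · filter_upwards [target_mem_nhdsWithin htar] with y hy w
          exact chartForm_localVF σ hH hy w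
      have := eq_of_forall_hasDerivAt_zero hconst ht
      rw [key t ht, key 0 (by simpa using hε), flowMap_zero σ hI hH, hamFlow_zero σ hI hH] at this
      exact this
  refine forall_real_of_add (Q := fun t => ∀ x u v,
      σ.pairing (hamFlow σ H t x) (flowMap σ H t x u) (flowMap σ H t x v) = σ.pairing x u v) hε
    (fun t ht x => h x (mem_univ x) t ht) (fun s t hs ht x u v => ?_) t x u v
  rw [flowMap_add σ hI hH, hamFlow_add σ hI hH, ContinuousLinearMap.comp_apply,
    ContinuousLinearMap.comp_apply, ht, hs]

end FlowProperties

/-! ### Uniform bounds for the Riemannian norm -/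

section RiemannianBounds

variable {E : Type*} [NormedAddCommGroup E] [NormedSpace ℝ E]
  {HM : Type*} [TopologicalSpace HM] {I : ModelWithCorners ℝ E HM}
  {M : Type*} [TopologicalSpace M] [ChartedSpace HM M]

lemma SymplecticForm.pairing_eq (σ : SymplecticForm I M) (x : M) (u v : E) :
    σ.pairing x u v = altToBilin E (σ.form x : E [⋀^Fin 2]→L[ℝ] ℝ) u v :=
  (@altToBilin_apply E _ _ (σ.form x) u v).symm

lemma SymplecticForm.pairing_smul_smul (σ : SymplecticForm I M) (x : M) (a b : ℝ) (u v : E) :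
    σ.pairing x (a • u) (b • v) = a * b * σ.pairing x u v := by
  simp only [SymplecticForm.pairing_eq, map_smul, smul_apply, smul_eq_mul]
  ring

lemma SymplecticForm.pairing_smul_left (σ : SymplecticForm I M) (x : M) (a : ℝ) (u v : E) :
    σ.pairing x (a • u) v = a * σ.pairing x u v := by
  simpa using σ.pairing_smul_smul x a 1 u v

lemma SymplecticForm.pairing_zero_left (σ : SymplecticForm I M) (x : M) (u : E) :
    σ.pairing x 0 u = 0 := by
  rw [SymplecticForm.pairing_eq, map_zero, zero_apply]

lemma SymplecticForm.pairing_swap (σ : SymplecticForm I M) (x : M) (u v : E) :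
    σ.pairing x v u = - σ.pairing x u v :=
  @alt_swap E _ _ (σ.form x) v u

/-- Near `x₀`, a continuous line field is spanned by a field with continuous coordinates. -/
lemma IsContinuousSubbundle.exists_frame [IsManifold I ∞ M] {S : Set M}
    {N : ∀ x : M, Submodule ℝ (TangentSpace I x)} (hN : IsContinuousSubbundle N S)
    (h1 : ∀ x ∈ S, Module.finrank ℝ (N x) = 1) {x₀ : M} (hx₀ : x₀ ∈ S) :
    ∃ U ∈ 𝓝 x₀, ∃ s : ∀ x : M, TangentSpace I x,
      ContinuousWithinAt (fun x => coordMap I x₀ x (s x)) S x₀ ∧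
      ∀ x ∈ S ∩ U, s x ≠ 0 ∧ N x = Submodule.span ℝ {s x} := by
  have : IsManifold I 1 M := inferInstance
  obtain ⟨U, hU, k, s, hs, hspan⟩ := hN x₀ hx₀
  have hk : k = 1 := by
    obtain ⟨hli, hsp⟩ := hspan x₀ ⟨hx₀, mem_of_mem_nhds hU⟩
    have h2 := finrank_span_eq_card hli
    rw [hsp, h1 x₀ hx₀, Fintype.card_fin] at h2
    exact h2.symm
  subst hk
  refine ⟨U, hU, s 0, ?_, fun x hx => ?_⟩
  · have h2 := ((FiberBundle.continuousWithinAt_totalSpace E _).1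
      (hs 0 x₀ ⟨hx₀, mem_of_mem_nhds hU⟩)).2
    have h3 : ContinuousWithinAt (fun x => coordMap I x₀ x (s 0 x)) (S ∩ U) x₀ := by
      have hev : ∀ᶠ x in 𝓝 x₀, (trivializationAt E (TangentSpace I) x₀
          (⟨x, s 0 x⟩ : TangentBundle I M)).2 = coordMap I x₀ x (s 0 x) := by
        filter_upwards [chart_source_mem_nhds HM x₀] with x hx
        have e : (trivializationAt E (TangentSpace I) x₀).continuousLinearMapAt ℝ x =
          coordMap I x₀ x := TangentBundle.continuousLinearMapAt_trivializationAt hx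
        rw [← e, Trivialization.continuousLinearMapAt_apply, Trivialization.coe_linearMapAt_of_mem]
        rwa [TangentBundle.trivializationAt_baseSet]
      exact h2.congr_of_eventuallyEq (mem_nhdsWithin_of_mem_nhds (hev.mono fun x hx => hx.symm))
        hev.self_of_nhds.symm
    exact h3.mono_of_mem_nhdsWithin (Filter.inter_mem self_mem_nhdsWithin
      (mem_nhdsWithin_of_mem_nhds hU))
  · obtain ⟨hli, hsp⟩ := hspan x hx
    refine ⟨hli.ne_zero 0, ?_⟩
    rw [← hsp, range_unique]
    rfl

variable [RiemannianBundle (fun x : M => TangentSpace I x)]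

variable (I) in
/-- The Riemannian norm as a function of vectors of the model space. -/
noncomputable def fibreNorm (x : M) (v : E) : ℝ := norm (E := TangentSpace I x) v

lemma fibreNorm_nonneg (x : M) (v : E) : 0 ≤ fibreNorm I x v :=
  norm_nonneg (E := TangentSpace I x) v

lemma fibreNorm_smul (x : M) (a : ℝ) (v : E) : fibreNorm I x (a • v) = |a| * fibreNorm I x v :=
  norm_smul (β := TangentSpace I x) a v

variable [IsManifold I ∞ M] [IsContMDiffRiemannianBundle I ∞ E (fun x : M => TangentSpace I x)]
  {H : M → ℝ}

/-- Near `x₀`, the Riemannian norm and the norm of the coordinates are comparable. -/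
lemma exists_fibreNorm_comparison (x₀ : M) :
    ∃ V ∈ 𝓝 x₀, ∃ C > 0, ∀ x ∈ V, x ∈ (extChartAt I x₀).source ∧ ∀ v : E,
      ‖coordMap I x₀ x v‖ ≤ C * fibreNorm I x v ∧ fibreNorm I x v ≤ C * ‖coordMap I x₀ x v‖ := by
  have : IsContinuousRiemannianBundle E (fun x : M => TangentSpace I x) := by
    obtain ⟨g, hg, h⟩ := IsContMDiffRiemannianBundle.exists_contMDiff (IB := I) (n := ∞) (F := E)
      (E := fun x : M => TangentSpace I x)
    exact ⟨g, hg.continuous, h⟩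
  obtain ⟨C₁, hC₁, h1⟩ := eventually_norm_trivializationAt_lt E
    (fun x : M => TangentSpace I x) x₀
  obtain ⟨C₂, hC₂, h2⟩ := eventually_norm_symmL_trivializationAt_lt E
    (fun x : M => TangentSpace I x) x₀
  refine ⟨_, h1.and (h2.and (extChartAt_source_mem_nhds (I := I) x₀)), max C₁ C₂,
    lt_max_of_lt_left hC₁, ?_⟩
  rintro x ⟨h1, h2, h3⟩
  refine ⟨h3, fun v => ?_⟩
  rw [extChartAt_source] at h3
  have e : (trivializationAt E (TangentSpace I) x₀).continuousLinearMapAt ℝ x = coordMap I x₀ x :=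
    TangentBundle.continuousLinearMapAt_trivializationAt h3
  let w : TangentSpace I x := v
  have h4 := (trivializationAt E (TangentSpace I) x₀).symmL_continuousLinearMapAt (R := ℝ)
    (b := x) (by rwa [TangentBundle.trivializationAt_baseSet]) w
  constructor
  · rw [← e]
    exact (ContinuousLinearMap.le_opNorm _ w).trans
      (mul_le_mul_of_nonneg_right (h1.le.trans (le_max_left _ _)) (norm_nonneg w))
  · rw [← e]
    change ‖w‖ ≤ _
    conv_lhs => rw [← h4]
    exact (ContinuousLinearMap.le_opNorm _ _).trans
      (mul_le_mul_of_nonneg_right (h2.le.trans (le_max_right _ _)) (norm_nonneg _))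

/-- A symplectic form on a compact manifold is bounded for the Riemannian norm. -/
lemma exists_pairing_le [CompactSpace M] (σ : SymplecticForm I M) :
    ∃ C ≥ 0, ∀ x u v, |σ.pairing x u v| ≤ C * (fibreNorm I x u * fibreNorm I x v) := by
  obtain ⟨ε, hε, h⟩ := isCompact_univ.exists_pos_forall
    (p := fun ε (x : M) => ∀ u v, ε * |σ.pairing x u v| ≤ fibreNorm I x u * fibreNorm I x v)
    (fun δ ε x hle h u v => (mul_le_mul_of_nonneg_right hle (abs_nonneg _)).trans (h u v))
    fun x₀ _ => by
      obtain ⟨V, hV, C, hC, h⟩ := exists_fibreNorm_comparison (I := I) x₀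
      set y₀ := extChartAt I x₀ x₀
      have hW : ContinuousWithinAt (chartForm I σ.form x₀) (extChartAt I x₀).target y₀ :=
        (σ.smooth x₀).continuousOn y₀ (mem_extChartAt_target x₀)
      have hb : ∀ᶠ x in 𝓝 x₀, ‖chartForm I σ.form x₀ (extChartAt I x₀ x)‖ <
          ‖chartForm I σ.form x₀ y₀‖ + 1 := by
        have hc : Filter.Tendsto (extChartAt I x₀) (𝓝 x₀) (𝓝[(extChartAt I x₀).target] y₀) :=
          tendsto_nhdsWithin_iff.2 ⟨continuousAt_extChartAt x₀, by
            filter_upwards [extChartAt_source_mem_nhds (I := I) x₀] with x hx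
            exact (extChartAt I x₀).map_source hx⟩
        exact (hW.norm.tendsto.comp hc).eventually_lt_const (lt_add_one _)
      set B := ‖chartForm I σ.form x₀ y₀‖ + 1 with hB
      have hB0 : 0 < B := by positivity
      refine ⟨_, Filter.inter_mem hV hb, (B * (C * C))⁻¹, by positivity, ?_⟩
      rintro x ⟨hxV, hxB⟩ u v
      obtain ⟨hsrc, hx⟩ := h x hxV
      have h1 : |σ.pairing x u v| ≤ B * (‖coordMap I x₀ x u‖ * ‖coordMap I x₀ x v‖) := by
        have h2 : σ.pairing x u v = _ := (chartForm_coordMap (σ := σ) hsrc u v).symm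
        rw [h2]
        refine ((chartForm I σ.form x₀ (extChartAt I x₀ x)).le_opNorm _).trans ?_
        rw [Fin.prod_univ_two]
        exact mul_le_mul_of_nonneg_right hxB.le (by positivity)
      rw [inv_mul_le_iff₀ (by positivity)]
      refine h1.trans ?_
      calc B * (‖coordMap I x₀ x u‖ * ‖coordMap I x₀ x v‖)
          ≤ B * ((C * fibreNorm I x u) * (C * fibreNorm I x v)) := by
            have := fibreNorm_nonneg (I := I) x u
            gcongr
            exacts [(hx u).1, (hx v).1]
        _ = B * (C * C) * (fibreNorm I x u * fibreNorm I x v) := by ring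
  refine ⟨ε⁻¹, by positivity, fun x u v => ?_⟩
  rw [← div_eq_inv_mul, le_div_iff₀' hε]
  exact h x (mem_univ x) u v

variable {S : Set M}

/-- Two continuous line fields over a compact set that are nowhere orthogonal for the symplectic
form have a symplectic pairing that is bounded below. -/
lemma exists_le_pairing (σ : SymplecticForm I M) (hS : IsCompact S)
    {Nm Np : ∀ x : M, Submodule ℝ (TangentSpace I x)} (hm : IsContinuousSubbundle Nm S)
    (hp : IsContinuousSubbundle Np S) (hm1 : ∀ x ∈ S, Module.finrank ℝ (Nm x) = 1)
    (hp1 : ∀ x ∈ S, Module.finrank ℝ (Np x) = 1)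
    (hne : ∀ x ∈ S, ∀ u ∈ Nm x, ∀ v ∈ Np x, u ≠ 0 → v ≠ 0 → σ.pairing x u v ≠ 0) :
    ∃ c > 0, ∀ x ∈ S, ∀ u ∈ Nm x, ∀ v ∈ Np x,
      c * (fibreNorm I x u * fibreNorm I x v) ≤ |σ.pairing x u v| := by
  obtain ⟨c, hc, h⟩ := hS.exists_pos_forall (p := fun c (x : M) => x ∈ S → ∀ u ∈ Nm x, ∀ v ∈ Np x,
      c * (fibreNorm I x u * fibreNorm I x v) ≤ |σ.pairing x u v|)
    (fun δ ε x hle h hx u hu v hv => (mul_le_mul_of_nonneg_right hle (mul_nonneg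
      (fibreNorm_nonneg _ _) (fibreNorm_nonneg _ _))).trans (h hx u hu v hv)) fun x₀ hx₀ => by
      obtain ⟨V, hV, C, hC, h⟩ := exists_fibreNorm_comparison (I := I) x₀
      obtain ⟨Um, hUm, a, hac, ha⟩ := hm.exists_frame hm1 hx₀
      obtain ⟨Up, hUp, b, hbc, hb⟩ := hp.exists_frame hp1 hx₀
      set y₀ := extChartAt I x₀ x₀
      set w : M → ℝ := fun x => chartForm I σ.form x₀ (extChartAt I x₀ x)
        ![coordMap I x₀ x (a x), coordMap I x₀ x (b x)] with hw
      have hwσ : ∀ x ∈ (extChartAt I x₀).source, w x = σ.pairing x (a x) (b x) := fun x hx =>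
        chartForm_coordMap hx _ _
      have hwc : ContinuousWithinAt w S x₀ := by
        have hc : Filter.Tendsto (extChartAt I x₀) (𝓝[S] x₀) (𝓝[(extChartAt I x₀).target] y₀) := by
          refine tendsto_nhdsWithin_iff.2
            ⟨(continuousAt_extChartAt x₀).tendsto.mono_left nhdsWithin_le_nhds, ?_⟩
          filter_upwards [mem_nhdsWithin_of_mem_nhds (extChartAt_source_mem_nhds (I := I) x₀)]
            with x hx
          exact (extChartAt I x₀).map_source hx
        have h1 : ContinuousWithinAt (fun x => chartForm I σ.form x₀ (extChartAt I x₀ x)) S x₀ :=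
          ((σ.smooth x₀).continuousOn y₀ (mem_extChartAt_target x₀)).tendsto.comp hc
        have h2 : w = fun x => altToBilin E (chartForm I σ.form x₀ (extChartAt I x₀ x))
            (coordMap I x₀ x (a x)) (coordMap I x₀ x (b x)) := by
          funext x
          rw [altToBilin_apply]
        rw [h2]
        exact (((altToBilin E).continuous.continuousAt.comp_continuousWithinAt h1).clm_apply
          hac).clm_apply hbc
      have hw0 : 0 < |w x₀| := by
        rw [abs_pos, hwσ _ (mem_extChartAt_source x₀)]
        obtain ⟨h1, h2⟩ := ha x₀ ⟨hx₀, mem_of_mem_nhds hUm⟩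
        obtain ⟨h3, h4⟩ := hb x₀ ⟨hx₀, mem_of_mem_nhds hUp⟩
        exact hne x₀ hx₀ _ (h2 ▸ Submodule.mem_span_singleton_self _) _
          (h4 ▸ Submodule.mem_span_singleton_self _) h1 h3
      set A := ‖coordMap I x₀ x₀ (a x₀)‖ + 1
      set B := ‖coordMap I x₀ x₀ (b x₀)‖ + 1
      have e1 : ∀ᶠ x in 𝓝[S] x₀, |w x₀| / 2 < |w x| :=
        hwc.abs.tendsto.eventually_const_lt (by linarith)
      have e2 : ∀ᶠ x in 𝓝[S] x₀, ‖coordMap I x₀ x (a x)‖ < A :=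
        hac.norm.tendsto.eventually_lt_const (lt_add_one _)
      have e3 : ∀ᶠ x in 𝓝[S] x₀, ‖coordMap I x₀ x (b x)‖ < B :=
        hbc.norm.tendsto.eventually_lt_const (lt_add_one _)
      obtain ⟨W, hW, hWS⟩ := mem_nhdsWithin_iff_exists_mem_nhds_inter.1 (e1.and (e2.and e3))
      have hA : 0 < A := by positivity
      have hB : 0 < B := by positivity
      refine ⟨W ∩ V ∩ Um ∩ Up, by simp only [Filter.inter_mem_iff]; exact ⟨⟨⟨hW, hV⟩, hUm⟩, hUp⟩,
        |w x₀| / 2 / ((C * A) * (C * B)), by positivity, ?_⟩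
      rintro x ⟨⟨⟨hxW, hxV⟩, hxm⟩, hxp⟩ hxS u hu v hv
      obtain ⟨h1, h2, h3⟩ := hWS ⟨hxW, hxS⟩
      obtain ⟨hsrc, hx⟩ := h x hxV
      rw [(ha x ⟨hxS, hxm⟩).2] at hu
      rw [(hb x ⟨hxS, hxp⟩).2] at hv
      obtain ⟨r, rfl⟩ := Submodule.mem_span_singleton.1 hu
      obtain ⟨q, rfl⟩ := Submodule.mem_span_singleton.1 hv
      have e4 : σ.pairing x (r • a x) (q • b x) = r * q * w x := by
        rw [hwσ x hsrc]
        exact σ.pairing_smul_smul x r q _ _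
      have e5 : fibreNorm I x (r • a x) = |r| * fibreNorm I x (a x) := fibreNorm_smul x r _
      have e6 : fibreNorm I x (q • b x) = |q| * fibreNorm I x (b x) := fibreNorm_smul x q _
      have e7 : fibreNorm I x (a x) ≤ C * A := (hx _).2.trans (mul_le_mul_of_nonneg_left h2.le hC.le)
      have e8 : fibreNorm I x (b x) ≤ C * B := (hx _).2.trans (mul_le_mul_of_nonneg_left h3.le hC.le)
      rw [e4, e5, e6, abs_mul, abs_mul, div_mul_eq_mul_div, div_le_iff₀ (by positivity)]
      have e9 : fibreNorm I x (a x) * fibreNorm I x (b x) ≤ (C * A) * (C * B) :=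
        mul_le_mul e7 e8 (fibreNorm_nonneg _ _) (by positivity)
      calc |w x₀| / 2 * (|r| * fibreNorm I x (a x) * (|q| * fibreNorm I x (b x)))
          = |r| * |q| * ((|w x₀| / 2) * (fibreNorm I x (a x) * fibreNorm I x (b x))) := by ring
        _ ≤ |r| * |q| * (|w x| * ((C * A) * (C * B))) :=
          mul_le_mul_of_nonneg_left (mul_le_mul h1.le e9 (mul_nonneg (fibreNorm_nonneg _ _)
            (fibreNorm_nonneg _ _)) (abs_nonneg _)) (by positivity)
        _ = _ := by ring
  exact ⟨c, hc, fun x hx => h x hx hx⟩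

variable [FiniteDimensional ℝ E]

/-- On a compact set without critical points the Hamiltonian vector field is bounded above and
below. -/
lemma exists_hamVF_bounds (σ : SymplecticForm I M) (hH : IsHamiltonian I H) (hS : IsCompact S)
    (hreg : IsRegularSet I H S) :
    ∃ c > 0, ∀ x ∈ S, c ≤ fibreNorm I x (hamVF σ H x) ∧ c * fibreNorm I x (hamVF σ H x) ≤ 1 := by
  have : IsManifold I 1 M := inferInstance
  refine hS.exists_pos_forall (p := fun c (x : M) => c ≤ fibreNorm I x (hamVF σ H x) ∧
    c * fibreNorm I x (hamVF σ H x) ≤ 1) (fun δ ε x hle h => ⟨hle.trans h.1,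
      (mul_le_mul_of_nonneg_right hle (fibreNorm_nonneg _ _)).trans h.2⟩) fun x₀ hx₀ => ?_
  obtain ⟨V, hV, C, hC, h⟩ := exists_fibreNorm_comparison (I := I) x₀
  set y₀ := extChartAt I x₀ x₀
  have hy₀ := mem_extChartAt_target (I := I) x₀
  set B := ‖localVF σ H x₀ y₀‖ with hB
  have hB0 : 0 < B := by
    rw [hB, norm_pos_iff]
    intro h0
    refine hreg x₀ hx₀ (ContinuousLinearMap.ext fun u => ?_)
    have h1 : (extChartAt I x₀).symm y₀ = x₀ := extChartAt_to_inv x₀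
    have h2 : hamVF σ H ((extChartAt I x₀).symm y₀) = 0 := by
      rw [← coordInv_coordMap hy₀ (hamVF σ H ((extChartAt I x₀).symm y₀))]
      change coordInv I x₀ y₀ (localVF σ H x₀ y₀) = 0
      rw [h0, map_zero]
    have h3 : hamVF σ H x₀ = 0 := by rwa [h1] at h2
    rw [dH_eq_form, h3]
    exact σ.pairing_zero_left x₀ u
  have hc : Filter.Tendsto (extChartAt I x₀) (𝓝 x₀) (𝓝[range I] y₀) :=
    tendsto_nhdsWithin_iff.2 ⟨continuousAt_extChartAt x₀, .of_forall fun x => mem_range_self _⟩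
  have hY := ((contDiffWithinAt_localVF σ hH hy₀).continuousWithinAt.norm.tendsto.comp hc)
  have h1 := hY.eventually_lt_const (show B < 2 * B by linarith)
  have h2 := hY.eventually_const_lt (show B / 2 < B by linarith)
  refine ⟨_, Filter.inter_mem hV (h1.and h2), min (B / 2 / C) (C * (2 * B))⁻¹, by positivity, ?_⟩
  rintro x ⟨hxV, hx1, hx2⟩
  obtain ⟨hsrc, hx⟩ := h x hxV
  obtain ⟨h3, h4⟩ := hx (hamVF σ H x)
  have h5 : localVF σ H x₀ (extChartAt I x₀ x) = coordMap I x₀ x (hamVF σ H x) := by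
    rw [localVF, (extChartAt I x₀).left_inv hsrc]
  simp only [Function.comp_apply, h5] at hx1 hx2
  constructor
  · refine (min_le_left _ _).trans ?_
    rw [div_le_iff₀' hC]
    exact hx2.le.trans h3
  · refine (mul_le_mul_of_nonneg_right (min_le_right _ _) (fibreNorm_nonneg _ _)).trans ?_
    rw [inv_mul_le_iff₀ (by positivity), mul_one]
    exact h4.trans (mul_le_mul_of_nonneg_left hx1.le hC.le)

/-- At every time the tangent flow is bounded for the Riemannian norm. -/
lemma exists_flowMap_le [T2Space M] [CompactSpace M] {ℓ : E →L[ℝ] ℝ} (σ : SymplecticForm I M)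
    (hI : range I = {v | 0 ≤ ℓ v}) (hH : IsHamiltonian I H) (t : ℝ) :
    ∃ K ≥ 0, ∀ x v, fibreNorm I (hamFlow σ H t x) (flowMap σ H t x v) ≤ K * fibreNorm I x v := by
  obtain ⟨ε, hε, h⟩ := isCompact_univ.exists_pos_forall
    (p := fun ε x => ∀ t, |t| < ε → ∀ v,
      ε * fibreNorm I (hamFlow σ H t x) (flowMap σ H t x v) ≤ fibreNorm I x v)
    (fun _ _ x hle h t ht v => (mul_le_mul_of_nonneg_right hle (fibreNorm_nonneg _ _)).trans
      (h t (ht.trans_le hle) v)) fun x₀ _ => by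
      obtain ⟨V, hV, C, hC, h⟩ := exists_fibreNorm_comparison (I := I) x₀
      obtain ⟨U, hU, ε, hε, A, hA⟩ := exists_tangentFlow_in_chart σ hI hH x₀ hV
      refine ⟨_, Filter.inter_mem hU hV, min ε (C * (3 * C))⁻¹, by positivity, ?_⟩
      rintro x ⟨hxU, hxV⟩ t ht v
      obtain ⟨-, hmem, -, hD, -, h3⟩ := (hA x hxU).2 t (ht.trans_le (min_le_left _ _))
      refine (mul_le_mul_of_nonneg_right (min_le_right _ _) (fibreNorm_nonneg _ _)).trans ?_
      rw [inv_mul_le_iff₀ (by positivity)]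
      refine ((h _ hmem).2 _).2.trans ?_
      rw [hD, mul_assoc]
      refine mul_le_mul_of_nonneg_left ?_ hC.le
      refine ((A x t).le_opNorm _).trans ?_
      rw [mul_assoc]
      exact mul_le_mul h3 ((h x hxV).2 v).1 (norm_nonneg _) (by norm_num)
  refine forall_real_of_add (Q := fun t => ∃ K ≥ 0, ∀ x v,
    fibreNorm I (hamFlow σ H t x) (flowMap σ H t x v) ≤ K * fibreNorm I x v) hε
    (fun t ht => ⟨ε⁻¹, by positivity, fun x v => ?_⟩) ?_ t
  · rw [← div_eq_inv_mul, le_div_iff₀' hε]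
    exact h x (mem_univ x) t ht v
  · rintro s t ⟨K, hK, hs⟩ ⟨L, hL, ht⟩
    refine ⟨L * K, by positivity, fun x v => ?_⟩
    rw [flowMap_add σ hI hH, hamFlow_add σ hI hH, ContinuousLinearMap.comp_apply, mul_assoc]
    exact (ht _ _).trans (mul_le_mul_of_nonneg_left (hs x v) hL)

end RiemannianBounds

/-! ### The transversal Poincaré flow as a quotient cocycle -/

section EnergySurface

variable {E : Type*} [NormedAddCommGroup E] [NormedSpace ℝ E]
  {HM : Type*} [TopologicalSpace HM] {I : ModelWithCorners ℝ E HM}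
  {M : Type*} [TopologicalSpace M] [ChartedSpace HM M]
  {H : M → ℝ} {S : Set M} {e : ℝ}

lemma IsEnergySurface.isCompact [CompactSpace M] (hS : IsEnergySurface H e S)
    (hH : Continuous H) : IsCompact S := by
  obtain ⟨x, hx, rfl⟩ := hS
  refine (isClosed_of_closure_subset ?_).isCompact
  exact isPreconnected_connectedComponentIn.closure.subset_connectedComponentIn
    (subset_closure (mem_connectedComponentIn hx))
    (closure_minimal (connectedComponentIn_subset _ _) (isClosed_singleton.preimage hH))

variable [FiniteDimensional ℝ E] [IsManifold I ∞ M] [T2Space M] [CompactSpace M]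
  {ℓ : E →L[ℝ] ℝ} (σ : SymplecticForm I M)

/-- An orbit is a connected set on which `H` is constant, so it stays in one connected component of
its level set. -/
lemma IsEnergySurface.hamFlow_mem (hS : IsEnergySurface H e S) (hI : range I = {v | 0 ≤ ℓ v})
    (hH : IsHamiltonian I H) (t : ℝ) {x : M} (hx : x ∈ S) : hamFlow σ H t x ∈ S := by
  obtain ⟨x₀, -, rfl⟩ := hS
  have hxe : x ∈ H ⁻¹' {e} := connectedComponentIn_subset _ _ hx
  rw [connectedComponentIn_eq hx]
  refine (isPreconnected_range (isMIntegralCurve_hamFlow σ hI hH x).continuous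
    ).subset_connectedComponentIn ⟨0, hamFlow_zero σ hI hH x⟩ ?_ (mem_range_self t)
  rintro _ ⟨s, rfl⟩
  simpa [apply_hamFlow σ hI hH] using hxe

lemma IsEnergySurface.hamFlow_image (hS : IsEnergySurface H e S) (hI : range I = {v | 0 ≤ ℓ v})
    (hH : IsHamiltonian I H) (t : ℝ) : hamFlow σ H t '' S = S := by
  refine Subset.antisymm (image_subset_iff.2 fun x hx => hS.hamFlow_mem σ hI hH t hx) fun x hx =>
    ⟨hamFlow σ H (-t) x, hS.hamFlow_mem σ hI hH _ hx, ?_⟩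
  rw [← hamFlow_add σ hI hH, add_neg_cancel, hamFlow_zero σ hI hH]

end EnergySurface

section LevelTangent

variable {E : Type*} [NormedAddCommGroup E] [NormedSpace ℝ E] [FiniteDimensional ℝ E]
  {HM : Type*} [TopologicalSpace HM] {I : ModelWithCorners ℝ E HM}
  {M : Type*} [TopologicalSpace M] [ChartedSpace HM M] {H : M → ℝ}

lemma hamVF_mem_levelTangent (σ : SymplecticForm I M) (x : M) : hamVF σ H x ∈ levelTangent I H x := by
  change dH I H x (hamVF σ H x) = 0
  rw [dH_eq_form, σ.form_self]

end LevelTangent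

section PoincareFlow

variable {E : Type*} [NormedAddCommGroup E] [NormedSpace ℝ E]
  {HM : Type*} [TopologicalSpace HM] {I : ModelWithCorners ℝ E HM}
  {M : Type*} [TopologicalSpace M] [ChartedSpace HM M]
  [RiemannianBundle (fun x : M => TangentSpace I x)]
  {H : M → ℝ} {S : Set M} {e : ℝ}

/-- On a line, the operator norm is attained at every vector. -/
lemma restrNorm_mul_norm {x y : M} (L : TangentSpace I x →L[ℝ] TangentSpace I y)
    {V : Submodule ℝ (TangentSpace I x)} (hV : Module.finrank ℝ V = 1) {u : TangentSpace I x}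
    (hu : u ∈ V) : restrNorm L V * ‖u‖ = ‖L u‖ := by
  by_cases hu0 : u = 0
  · simp [hu0]
  have hn : 0 < ‖u‖ := norm_pos_iff.2 hu0
  refine le_antisymm ?_ ((L.comp V.subtypeL).le_opNorm ⟨u, hu⟩)
  rw [← le_div_iff₀ hn]
  refine ContinuousLinearMap.opNorm_le_bound _ (by positivity) fun w => ?_
  obtain ⟨a, rfl⟩ := (finrank_eq_one_iff_of_nonzero' (⟨u, hu⟩ : V)
    (fun h => hu0 (congrArg Subtype.val h))).1 hV w
  change ‖L (a • u)‖ ≤ ‖L u‖ / ‖u‖ * ‖a • u‖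
  rw [map_smul, norm_smul, norm_smul]
  refine le_of_eq ?_
  field_simp

lemma restrNorm_le {x y : M} {L : TangentSpace I x →L[ℝ] TangentSpace I y}
    {V : Submodule ℝ (TangentSpace I x)} {C : ℝ} (hC : 0 ≤ C) (h : ∀ v ∈ V, ‖L v‖ ≤ C * ‖v‖) :
    restrNorm L V ≤ C :=
  ContinuousLinearMap.opNorm_le_bound _ hC fun v => h v v.2

/-- Domination of operator norms on lines, as an inequality between vectors. -/
lemma norm_mul_norm_le_of_restrNorm_div_le {x y : M} {L : TangentSpace I x →L[ℝ] TangentSpace I y}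
    {V W : Submodule ℝ (TangentSpace I x)} {W' : Submodule ℝ (TangentSpace I y)} {θ : ℝ}
    (hV : Module.finrank ℝ V = 1) (hW : Module.finrank ℝ W = 1) (hW' : Module.finrank ℝ W' = 1)
    (hmap : W.map (L : TangentSpace I x →ₗ[ℝ] TangentSpace I y) = W')
    (hle : restrNorm L V / restrNorm L W ≤ θ) {u v : TangentSpace I x} (hu : u ∈ V) (hv : v ∈ W) :
    ‖L u‖ * ‖v‖ ≤ θ * (‖L v‖ * ‖u‖) := by
  -- `L` is nonzero on `W`, so the ratio of the norms is a genuine quotient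
  have hpos : 0 < restrNorm L W := by
    refine lt_of_le_of_ne (norm_nonneg (L.comp W.subtypeL)) fun h0 => ?_
    have hbot : W' = ⊥ := by
      rw [← hmap, Submodule.eq_bot_iff]
      rintro _ ⟨w, hw, rfl⟩
      have := restrNorm_mul_norm L hW hw
      rw [← h0, zero_mul] at this
      exact norm_eq_zero.1 this.symm
    rw [hbot, finrank_bot] at hW'
    exact zero_ne_one hW'
  rw [div_le_iff₀ hpos] at hle
  rw [← restrNorm_mul_norm L hV hu, ← restrNorm_mul_norm L hW hv]
  calc restrNorm L V * ‖u‖ * ‖v‖ = restrNorm L V * (‖u‖ * ‖v‖) := by ring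
    _ ≤ θ * restrNorm L W * (‖u‖ * ‖v‖) := mul_le_mul_of_nonneg_right hle (by positivity)
    _ = _ := by ring

lemma exists_mem_norm_pos {x : M} {V : Submodule ℝ (TangentSpace I x)}
    (hV : Module.finrank ℝ V = 1) : ∃ u ∈ V, 0 < fibreNorm I x u := by
  obtain ⟨u, hu, -⟩ := finrank_eq_one_iff'.1 hV
  exact ⟨u, u.2, norm_pos_iff.2 fun h => hu (Subtype.ext h)⟩

variable [FiniteDimensional ℝ E] (σ : SymplecticForm I M)

/-- The coefficient of `X_H` in the orthogonal decomposition of a tangent vector. -/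
noncomputable def hamCoord (σ : SymplecticForm I M) (H : M → ℝ) (x : M) : E →ₗ[ℝ] ℝ :=
  (‖hamVF σ H x‖ ^ 2)⁻¹ • (innerₛₗ ℝ (hamVF σ H x) : TangentSpace I x →ₗ[ℝ] ℝ)

lemma hamCoord_apply (x : M) (v : TangentSpace I x) :
    hamCoord σ H x v = ⟪hamVF σ H x, v⟫ / ‖hamVF σ H x‖ ^ 2 :=
  inv_mul_eq_div _ _

lemma normalProj_apply (x : M) (v : TangentSpace I x) :
    normalProj σ H x v = v - hamCoord σ H x v • hamVF σ H x := by
  rw [normalProj, Submodule.starProjection_orthogonal_val, Submodule.starProjection_singleton,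
    hamCoord_apply]
  rfl

lemma fibreNorm_sub_hamCoord_le (x : M) (v : E) :
    fibreNorm I x (v - hamCoord σ H x v • (show E from hamVF σ H x)) ≤ fibreNorm I x v := by
  have h := Submodule.norm_starProjection_apply_le (Submodule.span ℝ {hamVF σ H x})ᗮ
    (show TangentSpace I x from v)
  have h2 := normalProj_apply σ (H := H) x v
  rw [normalProj] at h2
  rw [h2] at h
  exact h

lemma hamCoord_eq_zero {x : M} {v : TangentSpace I x} (hv : v ∈ transFibre σ H x) :
    hamCoord σ H x v = 0 := by
  rw [hamCoord_apply, Submodule.mem_orthogonal_singleton_iff_inner_right.1 hv.1, zero_div]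

lemma levelTangent_eq_sup (x : M) :
    transFibre σ H x ⊔ Submodule.span ℝ {hamVF σ H x} = levelTangent I H x := by
  refine le_antisymm (sup_le inf_le_right ?_) fun w hw => ?_
  · rw [Submodule.span_singleton_le_iff_mem]
    exact hamVF_mem_levelTangent σ x
  · have h1 : normalProj σ H x w + hamCoord σ H x w • hamVF σ H x = w := by
      rw [normalProj_apply, sub_add_cancel]
    rw [← h1]
    refine Submodule.add_mem_sup
      ⟨Submodule.starProjection_apply_mem (Submodule.span ℝ {hamVF σ H x})ᗮ w, ?_⟩
      (Submodule.smul_mem _ _ (Submodule.mem_span_singleton_self _))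
    rw [normalProj_apply]
    exact Submodule.sub_mem _ hw (Submodule.smul_mem _ _ (hamVF_mem_levelTangent σ x))

/-- Two nonzero vectors that span the transversal plane are not symplectically orthogonal:
otherwise the first one would be orthogonal to the whole level tangent space, hence a multiple of
`X_H`. -/
lemma pairing_ne_zero {x : M} (hx : dH I H x ≠ 0) {Nm Np : Submodule ℝ (TangentSpace I x)}
    (hsup : Nm ⊔ Np = transFibre σ H x) (hm : Module.finrank ℝ Nm = 1)
    (hp : Module.finrank ℝ Np = 1) {u v : TangentSpace I x} (hu : u ∈ Nm) (hv : v ∈ Np)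
    (hu0 : u ≠ 0) (hv0 : v ≠ 0) : σ.pairing x u v ≠ 0 := by
  intro h0
  obtain ⟨B, hBp⟩ : ∃ B : TangentSpace I x →L[ℝ] ℝ, ∀ w, B w = σ.form x ![u, w] :=
    ⟨altToBilin E (σ.form x : E [⋀^Fin 2]→L[ℝ] ℝ) u, fun w => (σ.pairing_eq x u w).symm⟩
  have huT : u ∈ transFibre σ H x := hsup ▸ Submodule.mem_sup_left hu
  have hker : ∀ w : TangentSpace I x, dH I H x w = 0 → B w = 0 := by
    intro w hw
    have hw' : w ∈ transFibre σ H x ⊔ Submodule.span ℝ {hamVF σ H x} := by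
      rw [levelTangent_eq_sup]
      exact hw
    rw [← hsup] at hw'
    obtain ⟨y, hy, z, hz, rfl⟩ := Submodule.mem_sup.1 hw'
    obtain ⟨n, hn, p, hp', rfl⟩ := Submodule.mem_sup.1 hy
    obtain ⟨c, rfl⟩ := Submodule.mem_span_singleton.1 hz
    obtain ⟨a, ha⟩ := (finrank_eq_one_iff_of_nonzero' (⟨u, hu⟩ : Nm)
      (fun h => hu0 (congrArg Subtype.val h))).1 hm ⟨n, hn⟩
    obtain ⟨b, hb⟩ := (finrank_eq_one_iff_of_nonzero' (⟨v, hv⟩ : Np)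
      (fun h => hv0 (congrArg Subtype.val h))).1 hp ⟨p, hp'⟩
    have ha' : a • u = n := congrArg Subtype.val ha
    have hb' : b • v = p := congrArg Subtype.val hb
    have e1 : B u = 0 := (hBp u).trans (σ.form_self x u)
    have e2 : B v = 0 := (hBp v).trans h0
    have e3 : B (hamVF σ H x) = 0 := by
      have e4 : σ.form x ![u, hamVF σ H x] = -σ.form x ![hamVF σ H x, u] :=
        σ.pairing_swap x (hamVF σ H x) u
      rw [hBp, e4, ← dH_eq_form, show dH I H x u = 0 from huT.2, neg_zero]
    rw [← ha', ← hb']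
    rw [map_add, map_add, map_smul, map_smul, map_smul, e1, e2, e3]
    simp
  obtain ⟨w₀, hw₀⟩ : ∃ w₀, dH I H x w₀ ≠ 0 := by
    by_contra! h
    exact hx (ContinuousLinearMap.ext h)
  set r : ℝ := B w₀ / dH I H x w₀ with hr
  have hall : ∀ w : TangentSpace I x, B w = r * dH I H x w := by
    intro w
    have h1 := hker (w - (dH I H x w / dH I H x w₀) • w₀) (by
      rw [map_sub, map_smul, smul_eq_mul, div_mul_cancel₀ _ hw₀, sub_self])
    rw [map_sub, map_smul, smul_eq_mul, sub_eq_zero] at h1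
    rw [hr, h1]
    ring
  have hur : u = r • hamVF σ H x := by
    refine (σ.existsUnique_dual x B).unique hBp fun w => ?_
    rw [hall, dH_eq_form σ]
    exact (σ.pairing_smul_left x r (hamVF σ H x) w).symm
  have h1 : ⟪hamVF σ H x, u⟫ = 0 := Submodule.mem_orthogonal_singleton_iff_inner_right.1 huT.1
  rw [hur, inner_smul_right, real_inner_self_eq_norm_sq, mul_eq_zero] at h1
  rcases h1 with h1 | h1
  · exact hu0 (by rw [hur, h1, zero_smul])
  · exact hu0 (by rw [hur, norm_eq_zero.1 (pow_eq_zero_iff two_ne_zero |>.1 h1), smul_zero])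

lemma quotCocycle_eq_poincareFlow (t : ℝ) (x : M) (v : TangentSpace I x) :
    quotCocycle (hamFlow σ H) (fun t x => (flowMap σ H t x : E →ₗ[ℝ] E))
      (fun x => (hamVF σ H x : E)) (hamCoord σ H) t x v = poincareFlow σ H t x v :=
  (normalProj_apply σ (hamFlow σ H t x) (tangentFlow σ H t x v)).symm

/-- On the level tangent space the symplectic form descends to the quotient by `X_H`, where it is
preserved by the induced flow. -/
lemma pairing_quotCocycle [IsManifold I ∞ M] [T2Space M] [CompactSpace M]
    {ℓ : E →L[ℝ] ℝ} (hI : range I = {v | 0 ≤ ℓ v}) (hH : IsHamiltonian I H)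
    (t : ℝ) (x : M) {u v : E} (hu : dH I H x u = 0) (hv : dH I H x v = 0) :
    σ.pairing (hamFlow σ H t x)
      (quotCocycle (hamFlow σ H) (fun t x => (flowMap σ H t x : E →ₗ[ℝ] E))
        (fun x => (hamVF σ H x : E)) (hamCoord σ H) t x u)
      (quotCocycle (hamFlow σ H) (fun t x => (flowMap σ H t x : E →ₗ[ℝ] E))
        (fun x => (hamVF σ H x : E)) (hamCoord σ H) t x v) = σ.pairing x u v := by
  set y := hamFlow σ H t x with hy
  have h1 : ∀ w : E, dH I H x w = 0 → σ.pairing y (hamVF σ H y) (flowMap σ H t x w) = 0 := by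
    intro w hw
    rw [← hw, ← dH_flowMap σ hI hH t x w]
    exact (dH_eq_form σ H y _).symm
  have h2 : σ.pairing y (hamVF σ H y) (hamVF σ H y) = 0 := σ.form_self y _
  have h3 : ∀ (p q X : E) (a b : ℝ), σ.pairing y X p = 0 → σ.pairing y X q = 0 →
      σ.pairing y X X = 0 → σ.pairing y (p - a • X) (q - b • X) = σ.pairing y p q := by
    intro p q X a b hp hq hX
    have hp' : σ.pairing y p X = 0 := by rw [σ.pairing_swap, hp, neg_zero]
    simp only [σ.pairing_eq] at hp' hq hX ⊢
    simp only [map_sub, map_smul, sub_apply, smul_apply, hp', hq, hX]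
    simp
  exact (h3 _ _ _ _ _ (h1 u hu) (h1 v hv) h2).trans (pairing_flowMap σ hI hH t x u v)

end PoincareFlow

/-! ### From domination to hyperbolicity -/

section MainProof

variable {E : Type*} [NormedAddCommGroup E] [NormedSpace ℝ E] [FiniteDimensional ℝ E]
  {HM : Type*} [TopologicalSpace HM] {I : ModelWithCorners ℝ E HM}
  {M : Type*} [TopologicalSpace M] [ChartedSpace HM M] [IsManifold I ∞ M]
  [T2Space M] [CompactSpace M] [RiemannianBundle (fun x : M => TangentSpace I x)]
  [IsContMDiffRiemannianBundle I ∞ E (fun x : M => TangentSpace I x)]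
  {ℓ : E →L[ℝ] ℝ} {H : M → ℝ} {S : Set M} {e : ℝ} (σ : SymplecticForm I M)

/-- The tangent flow over a regular energy surface is a linear cocycle in the abstract sense. -/
lemma isFlowCocycle_flowMap (hI : range I = {v | 0 ≤ ℓ v}) (hH : IsHamiltonian I H)
    (hS : IsEnergySurface H e S) (hreg : IsRegularSet I H S) :
    IsFlowCocycle S (hamFlow σ H) (fun t x => (flowMap σ H t x : E →ₗ[ℝ] E))
      (fun x => (hamVF σ H x : E)) (hamCoord σ H) (fibreNorm I) := by
  obtain ⟨c, hc, hX⟩ := exists_hamVF_bounds σ hH (hS.isCompact hH.contMDiff.continuous) hreg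
  exact
  { mem := fun t x hx => hS.hamFlow_mem σ hI hH t hx
    flow_zero := fun x _ => hamFlow_zero σ hI hH x
    flow_add := fun t s x _ => hamFlow_add σ hI hH s t x
    map_zero := fun x _ v => by
      simp only [flowMap_zero σ hI hH]
      rfl
    map_add := fun t s x _ v => by
      simp only [flowMap_add σ hI hH]
      rfl
    map_X := fun t x _ => flowMap_hamVF σ hI hH t x
    coord_X := fun x hx => by
      have hpos : 0 < ‖hamVF σ H x‖ := hc.trans_le (hX x hx).1
      refine (hamCoord_apply σ x (hamVF σ H x)).trans ?_
      rw [real_inner_self_eq_norm_sq, div_self (by positivity)]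
    nrm_nonneg := fibreNorm_nonneg
    nrm_add := fun x v w => norm_add_le (E := TangentSpace I x) v w
    nrm_smul := fibreNorm_smul
    nrm_proj := fun x _ v => fibreNorm_sub_hamCoord_le σ x v
    bound := fun t => by
      obtain ⟨K, hK, h⟩ := exists_flowMap_le σ hI hH t
      exact ⟨K, hK, fun x _ v => h x v⟩
    lower := ⟨c, hc, fun x hx => (hX x hx).1⟩
    upper := ⟨c⁻¹, fun x hx => by
      rw [le_inv_comm₀ (lt_of_lt_of_le hc (hX x hx).1) hc, ← one_div,
        le_div_iff₀ (lt_of_lt_of_le hc (hX x hx).1)]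
      exact (hX x hx).2⟩ }

theorem isHyperbolicSet_of_hasDominatedSplitting (hI : range I = {v | 0 ≤ ℓ v})
    (hH : IsHamiltonian I H) (hS : IsEnergySurface H e S) (hreg : IsRegularSet I H S)
    (hdom : HasDominatedSplitting σ H S) : IsHyperbolicSet σ H S := by
  obtain ⟨m, Nm, Np, hd⟩ := hdom
  have hcpt := hS.isCompact hH.contMDiff.continuous
  obtain ⟨θ, hθ, hθ1, hratio⟩ := hd.dominated
  obtain ⟨c, hc, hlow⟩ := exists_le_pairing σ hcpt hd.continuous_minus hd.continuous_plus
    hd.finrank_minus hd.finrank_plus fun x hx u hu v hv hu0 hv0 =>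
      pairing_ne_zero σ (hreg x hx) (hd.sup_eq x hx) (hd.finrank_minus x hx)
        (hd.finrank_plus x hx) hu hv hu0 hv0
  obtain ⟨C, hC, hupp⟩ := exists_pairing_le (M := M) σ
  have hmT : ∀ x ∈ S, ∀ u ∈ Nm x, u ∈ transFibre σ H x := fun x hx u hu =>
    hd.sup_eq x hx ▸ Submodule.mem_sup_left hu
  have hpT : ∀ x ∈ S, ∀ u ∈ Np x, u ∈ transFibre σ H x := fun x hx u hu =>
    hd.sup_eq x hx ▸ Submodule.mem_sup_right hu
  let Fm : M → Submodule ℝ E := fun x => Nm x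
  let Fp : M → Submodule ℝ E := fun x => Np x
  obtain ⟨p, Em, Ep, hp, hE⟩ :=
    (isFlowCocycle_flowMap σ hI hH hS hreg).exists_hyperbolic_splitting
      (Nm := Fm) (Np := Fp) (A := σ.pairing) (c := c) (C := C) (θ := θ)
      (m := m)
      (fun t x hx n hn => by
        have h1 : poincareFlow σ H t x n ∈ Nm (hamFlow σ H t x) :=
          hd.invariant_minus x hx t ▸ Submodule.mem_map_of_mem hn
        rw [← quotCocycle_eq_poincareFlow σ t x n] at h1
        exact h1)
      (fun t x hx n hn => by
        have h1 : poincareFlow σ H t x n ∈ Np (hamFlow σ H t x) :=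
          hd.invariant_plus x hx t ▸ Submodule.mem_map_of_mem hn
        rw [← quotCocycle_eq_poincareFlow σ t x n] at h1
        exact h1)
      (fun x hx => exists_mem_norm_pos (hd.finrank_minus x hx))
      (fun x hx => exists_mem_norm_pos (hd.finrank_plus x hx))
      (fun x hx u hu => hamCoord_eq_zero σ (hmT x hx u hu))
      (fun x hx u hu => hamCoord_eq_zero σ (hpT x hx u hu))
      hd.disjoint hc hC hlow (fun x _ u v => hupp x u v)
      (fun t x hx u hu v hv =>
        pairing_quotCocycle σ hI hH t x (hmT x hx u hu).2 (hpT x hx v hv).2)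
      hθ hθ1 hd.pos
      (fun x hx u hu v hv => by
        have h1 := norm_mul_norm_le_of_restrNorm_div_le (hd.finrank_minus x hx)
          (hd.finrank_plus x hx) (hd.finrank_plus _ (hS.hamFlow_mem σ hI hH m hx))
          (hd.invariant_plus x hx m) (hratio x hx) hu hv
        rw [show quotCocycle _ _ _ _ _ _ u = _ from quotCocycle_eq_poincareFlow σ m x u,
          show quotCocycle _ _ _ _ _ _ v = _ from quotCocycle_eq_poincareFlow σ m x v]
        exact h1)
  refine ⟨hcpt, hS.hamFlow_image σ hI hH, hreg, p, 1 / 2, fun x => Em x, fun x => Ep x, hp,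
    by norm_num, by norm_num, fun x hx => ?_⟩
  obtain ⟨hsup, hind, hinv, hm, hp⟩ := hE x hx
  refine ⟨?_, hind, hinv, ?_, ?_⟩
  · refine Eq.trans hsup ?_
    rw [← levelTangent_eq_sup σ x, ← hd.sup_eq x hx]
    rfl
  · exact restrNorm_le (by norm_num) fun v hv => hm v hv
  · exact restrNorm_le (by norm_num) fun v hv => hp v hv

end MainProof

theorem mainTheorem3
    {E : Type*} [NormedAddCommGroup E] [NormedSpace ℝ E] [FiniteDimensional ℝ E]
    (hdim : Module.finrank ℝ E = 4)
    {HM : Type*} [TopologicalSpace HM] (I : ModelWithCorners ℝ E HM)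
    -- `M` is a manifold without boundary (`ℓ = 0`) or a manifold with boundary (`ℓ ≠ 0`)
    (hI : ∃ ℓ : E →L[ℝ] ℝ, Set.range I = {v | 0 ≤ ℓ v})
    {M : Type*} [TopologicalSpace M] [ChartedSpace HM M] [IsManifold I ∞ M]
    [T2Space M] [CompactSpace M]
    [RiemannianBundle (fun x : M => TangentSpace I x)]
    [IsContMDiffRiemannianBundle I ∞ E (fun x : M => TangentSpace I x)]
    (σ : SymplecticForm I M) (H : M → ℝ) (hH : IsHamiltonian I H) (e : ℝ)
    (S : Set M) (hS : IsEnergySurface H e S) (hreg : IsRegularSet I H S)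
    (hdom : HasDominatedSplitting σ H S) :
    IsAnosovLevel σ H e := by
  obtain ⟨ℓ, hI⟩ := hI
  exact ⟨S, hS, isHyperbolicSet_of_hasDominatedSplitting σ hI hH hS hreg hdom⟩
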